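/- **Theorem (adaptive fused quantile method, overestimation case).** *Model.* Let $p\ge1$, $\tau\in(0,1)$ and $K^*\ge0$ be fixed. For each $n$ let $1=t^*_0<t^*_1<\dots<t^*_{K^*}<t^*_{K^*+1}=n$ (for $n$ large; the $t^*_k$ may depend on $n$), let $\phi^*_1,\dots,\phi^*_{K^*+1}\in\mathbb R^p$ (possibly depending on $n$) and put $\beta^*_i=\phi^*_{k+1}$ for $t^*_k\le i<t^*_{k+1}$, $\beta^*_n=\phi^*_{K^*+1}$. The observations are $Y_i=\mathbf x_i^\top\beta^*_i+\varepsilon_i$, $i=1,\dots,n$, with deterministic $\mathbf x_i\in\mathbb R^p$. Let ${\cal A}^*=\{t^*_1,\dots,t^*_{K^*}\}$ and $I^*_{min}=\min_{0\le k\le K^*}(t^*_{k+1}-t^*_k)$. Norms are Euclidean unless marked $\|\cdot\|_\infty$, and constants do not depend on $n$. Let $(\delta_n),(\lambda_n),(d_n)$ be positive sequences. Assume: - (A1) the first coordinate of every $\mathbf x_i$ is a constant $c^{(0)}\ne0$, and $\max_{i\le n}\|\mathbf x_i\|\le c^{(1)}$ with a constant $0<c^{(1)}<1$; - (A2) the $\varepsilon_i$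 are i.i.d. with distribution function $F>0$ on $\mathbb R$, $\mathbb P[\varepsilon_i<0]=\tau$, and with a bounded density $f$ that is bounded below by a positive constant on some neighbourhood of $0$; - (A3) there are constants $0<m_0\le M_0<\infty$ such that, for all large $n$ and all $1\le n_1<n_2\le n$ with $n_2-n_1\ge n\delta_n$, the eigenvalues of $(n_2-n_1)^{-1}\sum_{i=n_1}^{n_2-1}\mathbf x_i\mathbf x_i^\top$ lie in $[m_0,M_0]$; - (A4) $(\delta_n)$ is decreasing, $\delta_n\to0$, $(\log n)^{-1}n\delta_n\to\infty$, and $I^*_{min}\ge n\delta_n$ for all large $n$; - (A5) there are constants $0<c^{(b)},c^{(a)}<\infty$ with $c^{(b)}<\|\phi^*_{k+1}-\phi^*_k\|<c^{(a)}$ for $k=1,\dots,K^*$; - (A6) $K^*$ does not depend on $n$; - (A7) $n\lambda_n\to\infty$ and $\lambda_n/\delta_n\to0$; - (A8) for $k=1,\dots,K^*$ the limit $L_k=\lim_n (n\delta_n)^{-1}\sum_{i=t^*_k-[n\delta_n]}^{t^*_k-1}F(\mathbf x_i^\top(\phi^*_{k+1}-\phi^*_k))$ exists and $L_k\ne\tau$;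 - (A9) $(n\delta_n)^{-1}I^*_{min}\to\infty$. *First-step estimator.* With $\rho_\tau(u)=u(\tau-1_{\{u<0\}})$, let $\check\beta=(\check\beta_1,\dots,\check\beta_n)$ be a (measurable) minimizer over $(\mathbb R^p)^n$ of $\sum_{i=1}^n\rho_\tau(Y_i-\mathbf x_i^\top\beta_i)+n\lambda_n\sum_{i=2}^n\|\beta_i-\beta_{i-1}\|$, and let $\check{\cal A}_n=\{i\in\{2,\dots,n\}:\check\beta_i\ne\check\beta_{i-1}\}$. Let $\breve{\cal A}_n\subseteq\check{\cal A}_n$ be a (measurable) random set obtained by merging clusters of $\check{\cal A}_n$ into their smallest elements, in the following sense (with $1$ as the initial point of both sets): the minimal distance of a point of $\breve{\cal A}_n$ from the preceding point of $\check{\cal A}_n$ tends to infinity in probability, and the maximal distance of a point of $\check{\cal A}_n\setminus\breve{\cal A}_n$ from the preceding point of $\breve{\cal A}_n$ is $o_{\mathbb P}(n\lambda_n)$ (in particular, it may be bounded in probability). Let $\breve\beta_i=\check\beta_{s-1}$, where $s$ is the smallest element of $\breve{\cal A}_n$ greater than $i$, and $\breve\beta_i=\check\beta_n$ if there is none. Assume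 that, for some constant $K_0$, $K^*\le|\breve{\cal A}_n|\le K_0$ with probability tending to one. *Adaptive estimator.* Let $\gamma>0$, $b_n=n\lambda_n/I^*_{min}+(I^*_{min})^{-1/2}$, and assume $$d_n\to0,\qquad \frac{\lambda_n}{\delta_n(\max(d_n,b_n))^\gamma}\to0 .$$ Let $\omega_i=(\max(\|\breve\beta_i-\breve\beta_{i-1}\|_\infty,d_n))^{-\gamma}$, let $\widehat\beta$ be a (measurable) minimizer over $(\mathbb R^p)^n$ of $\sum_{i=1}^n\rho_\tau(Y_i-\mathbf x_i^\top\beta_i)+n\lambda_n\sum_{i=2}^n\omega_i\|\beta_i-\beta_{i-1}\|$, and let $\widehat{\cal A}_n=\{i\in\{2,\dots,n\}:\widehat\beta_i\ne\widehat\beta_{i-1}\}$. For sets $A,B$ put ${\cal E}(A\|B)=\sup_{b\in B}\inf_{a\in A}|a-b|$ ($\sup\emptyset=0$, $\inf\emptyset=\infty$). *Conclusion.* For every fixed $K_{max}<\infty$, $$\lim_{n\to\infty}\mathbb P\Big[K^*\le|\widehat{\cal A}_n|\le K_{max}\ \text{ and }\ {\cal E}(\widehat{\cal A}_n\|{\cal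 A}^*)>n\delta_n\Big]=0 .$$ In particular, if $K^*\le|\widehat{\cal A}_n|\le K_{max}$ holds with probability tending to one, then $\lim_{n\to\infty}\mathbb P[{\cal E}(\widehat{\cal A}_n\|{\cal A}^*)\le n\delta_n]=1$. -/

import Mathlib

open Filter Topology MeasureTheory ProbabilityTheory
open scoped ENNReal

noncomputable section

namespace FusedQuantile

/-- Column vectors of `ℝ^p` with the Euclidean norm. -/
abbrev Vec (p : ℕ) : Type := EuclideanSpace ℝ (Fin p)

/-- The deterministic ingredients of the change-point regression model with `K` change-points.
For the sample size `n`, the change-points are `t n 1 < ... < t n K`, with the conventions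
`t n 0 = 1` and `t n (K + 1) = n`; the coefficient vector of the `k`-th phase is `phi n k`,
`k = 1, ..., K + 1`; the design vectors are `x n i`, `i = 1, ..., n`. -/
structure Model (p : ℕ) where
  K : ℕ
  t : ℕ → ℕ → ℕ
  phi : ℕ → ℕ → Vec p
  x : ℕ → ℕ → Vec p

variable {p : ℕ} {Ω : Type*}

namespace Model

/-- The index of the phase to which the observation `i` belongs. -/
def phase (m : Model p) (n i : ℕ) : ℕ :=
  1 + ((Finset.Icc 1 m.K).filter (fun k => m.t n k ≤ i)).card

/-- The true coefficient vector of the observation `i`. -/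
def trueCoef (m : Model p) (n i : ℕ) : Vec p := m.phi n (m.phase n i)

/-- The response of the observation `i`. -/
def response (m : Model p) (ε : ℕ → Ω → ℝ) (n : ℕ) (ω : Ω) (i : ℕ) : ℝ :=
  inner ℝ (m.x n i) (m.trueCoef n i) + ε i ω

/-- The set of the true change-points. -/
def trueLocations (m : Model p) (n : ℕ) : Finset ℕ := (Finset.Icc 1 m.K).image (m.t n)

/-- The minimal length of a phase, `min_{0 ≤ k ≤ K} (t_{k+1} - t_k)`. -/
def Imin (m : Model p) (n : ℕ) : ℝ :=
  (Finset.range (m.K + 1)).inf' ⟨0, by simp⟩ (fun k => (m.t n (k + 1) : ℝ) - (m.t n k : ℝ))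

/-- The matrix `(n₂ - n₁)⁻¹ ∑_{i = n₁}^{n₂ - 1} x_i x_iᵀ`. -/
def gram (m : Model p) (n n₁ n₂ : ℕ) : Matrix (Fin p) (Fin p) ℝ :=
  ((n₂ : ℝ) - (n₁ : ℝ))⁻¹ • ∑ i ∈ Finset.Ico n₁ n₂,
    Matrix.vecMulVec (fun j => m.x n i j) (fun j => m.x n i j)

/-- The rate `b_n = n λ_n / I_min + I_min ^ (-1/2)`. -/
def rate (m : Model p) (lam : ℕ → ℝ) (n : ℕ) : ℝ :=
  n * lam n / m.Imin n + (m.Imin n) ^ (-(1 / 2) : ℝ)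

end Model

/-- The distribution with density `f`. -/
def errorLaw (f : ℝ → ℝ) : Measure ℝ := volume.withDensity (fun u => ENNReal.ofReal (f u))

/-- The distribution function of the errors. -/
def errorCdf (f : ℝ → ℝ) (u : ℝ) : ℝ := (errorLaw f).real (Set.Iic u)

/-- The errors are i.i.d. with the bounded density `f`, their distribution function is positive,
`P[ε < 0] = τ`, and `f` is bounded away from zero near the origin. -/
structure ErrorAssumptions [MeasurableSpace Ω] (μ : Measure Ω) (ε : ℕ → Ω → ℝ) (f : ℝ → ℝ)
    (τ : ℝ) : Prop where
  measurable : ∀ i, Measurable (ε i)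
  indep : iIndepFun ε μ
  law : ∀ i, μ.map (ε i) = errorLaw f
  density_measurable : Measurable f
  density_nonneg : ∀ u, 0 ≤ f u
  density_bounded : ∃ C, ∀ u, f u ≤ C
  density_pos_near_zero : ∃ η > 0, ∃ c > 0, ∀ u, |u| ≤ η → c ≤ f u
  cdf_pos : ∀ u, 0 < errorCdf f u
  quantile : ∀ i, μ {ω | ε i ω < 0} = ENNReal.ofReal τ

/-- The assumptions on the design, on the change-points, on the coefficients and on the sequences
`δ` and `lam`. -/
structure ModelAssumptions [NeZero p] (m : Model p) (f : ℝ → ℝ) (τ : ℝ) (δ lam : ℕ → ℝ) :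
    Prop where
  start : ∀ n, m.t n 0 = 1
  finish : ∀ n, m.t n (m.K + 1) = n
  increasing : ∀ᶠ n in atTop, ∀ k ≤ m.K, m.t n k < m.t n (k + 1)
  intercept : ∃ c₀ : ℝ, c₀ ≠ 0 ∧ ∀ n, ∀ i ∈ Finset.Icc 1 n, m.x n i 0 = c₀
  design_bounded : ∃ c₁ : ℝ, 0 < c₁ ∧ c₁ < 1 ∧ ∀ n, ∀ i ∈ Finset.Icc 1 n, ‖m.x n i‖ ≤ c₁
  design_eigenvalues : ∃ m₀ M₀ : ℝ, 0 < m₀ ∧ m₀ ≤ M₀ ∧ ∀ᶠ n : ℕ in atTop, ∀ n₁ n₂ : ℕ,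
    1 ≤ n₁ → n₁ < n₂ → n₂ ≤ n → n * δ n ≤ (n₂ : ℝ) - (n₁ : ℝ) → spectrum ℝ (m.gram n n₁ n₂) ⊆ Set.Icc m₀ M₀
  delta_pos : ∀ n, 0 < δ n
  delta_antitone : Antitone δ
  delta_tendsto : Tendsto δ atTop (𝓝 0)
  delta_log : Tendsto (fun n : ℕ => (Real.log n)⁻¹ * (n * δ n)) atTop atTop
  separation : ∀ᶠ n : ℕ in atTop, n * δ n ≤ m.Imin n
  jump_lt : ∃ ca : ℝ, 0 < ca ∧ ∀ n, ∀ k ∈ Finset.Icc 1 m.K, ‖m.phi n (k + 1) - m.phi n k‖ < ca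
  jump_gt : ∃ cb : ℝ, 0 < cb ∧ ∀ n, ∀ k ∈ Finset.Icc 1 m.K, cb < ‖m.phi n (k + 1) - m.phi n k‖
  lam_pos : ∀ n, 0 < lam n
  lam_tendsto : Tendsto (fun n : ℕ => n * lam n) atTop atTop
  lam_delta : Tendsto (fun n => lam n / δ n) atTop (𝓝 0)
  identifiability : ∀ k ∈ Finset.Icc 1 m.K, ∃ L : ℝ, L ≠ τ ∧
    Tendsto (fun n : ℕ => ((n : ℝ) * δ n)⁻¹ *
      ∑ i ∈ Finset.Ico (m.t n k - ⌊(n : ℝ) * δ n⌋₊) (m.t n k),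
        errorCdf f (inner ℝ (m.x n i) (m.phi n (k + 1) - m.phi n k))) atTop (𝓝 L)

/-- The check function `ρ_τ(u) = u (τ - 1_{u < 0})`. -/
def check (τ u : ℝ) : ℝ := u * (τ - Set.indicator (Set.Iio 0) 1 u)

/-- The quantile objective function with a fused group penalty with weights `w`. Only the values
`b 1, ..., b n` matter. -/
def objective (τ : ℝ) (n : ℕ) (x : ℕ → Vec p) (Y : ℕ → ℝ) (w : ℕ → ℝ) (b : ℕ → Vec p) : ℝ :=
  ∑ i ∈ Finset.Icc 1 n, check τ (Y i - inner ℝ (x i) (b i)) +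
    ∑ i ∈ Finset.Icc 2 n, w i * ‖b i - b (i - 1)‖

/-- `b` minimizes the objective function over all sequences of coefficient vectors. -/
def IsEstimator (τ : ℝ) (n : ℕ) (x : ℕ → Vec p) (Y : ℕ → ℝ) (w : ℕ → ℝ) (b : ℕ → Vec p) : Prop :=
  ∀ b' : ℕ → Vec p, objective τ n x Y w b ≤ objective τ n x Y w b'

open Classical in
/-- The set of the estimated change-points of `b`. -/
def changePoints (n : ℕ) (b : ℕ → Vec p) : Finset ℕ :=
  (Finset.Icc 2 n).filter (fun i => b i ≠ b (i - 1))

/-- The largest element of `S` below `t`, and `1` if there is none. -/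
def prev (S : Finset ℕ) (t : ℕ) : ℕ := max 1 ((S.filter (fun s => s < t)).sup id)

/-- `B n` arises from `A n` by merging clusters: the points that are kept in `B n` have a distance
from the preceding point of `A n` that tends to infinity in probability, and the points that are
not kept are within a distance `o_P(r n)` of the preceding kept point. As `r` tends to infinity in
all uses, this includes the case that the latter distances are bounded in probability. Hence `B n`
consists of the smallest elements of the clusters of `A n`. The point `1` counts as the initial
point of both sets. -/
structure IsMerging [MeasurableSpace Ω] (μ : Measure Ω) (r : ℕ → ℝ) (A B : ℕ → Ω → Finset ℕ) :
    Prop where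
  subset : ∀ n ω, B n ω ⊆ A n ω
  kept : ∀ M : ℕ, Tendsto (fun n => μ {ω | ∃ t ∈ B n ω, t ≤ prev (A n ω) t + M}) atTop (𝓝 0)
  dropped : ∀ η : ℝ, 0 < η → Tendsto
    (fun n => μ {ω | ∃ t ∈ A n ω \ B n ω, η * r n < (t : ℝ) - (prev (B n ω) t : ℝ)}) atTop (𝓝 0)

/-- The last observation before the first element of `B` after `i`, and `n` if there is none. -/
def lastBeforeNext (n : ℕ) (B : Finset ℕ) (i : ℕ) : ℕ :=
  if h : (B.filter (fun t => i < t)).Nonempty then (B.filter (fun t => i < t)).min' h - 1 else n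

/-- The piecewise constant sequence with change-points in `B` that takes, between two consecutive
elements of `B`, the value of `b` just before the second one. -/
def mergedCoef (n : ℕ) (B : Finset ℕ) (b : ℕ → Vec p) (i : ℕ) : Vec p := b (lastBeforeNext n B i)

/-- The maximum norm. -/
def maxNorm (v : Vec p) : ℝ := ‖(fun j => v j : Fin p → ℝ)‖

/-- The adaptive weight `(max (‖b_i - b_{i-1}‖_∞, d)) ^ (-γ)`. -/
def adaptiveWeight (d γ : ℝ) (b : ℕ → Vec p) (i : ℕ) : ℝ :=
  (max (maxNorm (b i - b (i - 1))) d) ^ (-γ)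

/-- The distance `sup_{b ∈ B} inf_{a ∈ A} |a - b|`; it is `0` if `B` is empty, and otherwise `∞`
if `A` is empty. -/
def excess (A B : Finset ℕ) : ℝ≥0∞ := ⨆ b ∈ B, ⨅ a ∈ A, edist (a : ℝ) (b : ℝ)

end FusedQuantile

end

open FusedQuantile

/-! The engine is a two-sided estimate of the excess loss. For a minimizer `b` and any sequence
`b₀`, compare `b` with `b - trunc R (b - b₀)`. The complement of the projection onto a ball is
1-Lipschitz, so the penalty grows by at most twice the penalty of `b₀`; convexity of the check
function then bounds the excess loss of the truncated step from `b₀` by the same amount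
(`IsEstimator.sum_trunc_le`). Conversely, Chernoff bounds on a grid show that on every interval of
observations a shift `u` in a fixed ball has excess loss at least `c ∑ ⟨x_i, u⟩²` minus a multiple
of `log n` (`ErrorAssumptions.whp_uniformLower`). Summing over pieces of constancy costs one such
term per piece (`neg_card_mul_le_sum`). As `log n` and `n λ_n` are `o(n δ_n)`, sequences with
boundedly many jumps have sums of squares `o(n δ_n)`, and the eigenvalue condition makes a piece of
length `n δ_n` close to the truth.

For the adaptive estimator the truth itself is a bad comparison sequence, since the weights at the
true change-points may be large. Instead, every true jump is replaced by jumps at places where the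
merged first-step estimator jumps by at least a fixed `κ`. The weights there are at most `κ ^ (-γ)`,
and the replacement changes the loss by at most an arbitrarily small multiple of `n δ_n`
(`exists_bump`, `FirstStep.exists_whp_bump`). An adaptive estimator with few jumps and none near a
true change-point would then be one constant close to both neighbouring phase values
(`FirstStep.whp_exists_near`), which are too far apart for this.

This needs the merged estimator to be bounded and close to the truth. The first-step estimator may
have many jumps, but it differs from its merged version only at few observations, a small multiple
of `n λ_n`, so its truncated deviations are small (`FirstStep.whp_sum_trunc_sq_le`). To remove the
truncation, the total variation must be bounded, for which `n λ_n` has to dominate `log n`. This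
holds because a block of about `log n` very negative errors inside a well-fitted interval would
otherwise make it profitable to shift the intercept there (`FirstStep.exists_log_le`). With an
exponential moment bound whose `log n` term has a small slope in the size of the deviations
(`QuantileLaw.exists_integral_exp_le_one`), the penalty wins and the variation is bounded
(`FirstStep.exists_whp_norm_sub_le`). -/

namespace FusedQuantile

/-! ### Lipschitz and convexity properties of the check function. -/

section Check

variable {τ : ℝ}

lemma check_eq_max (τ u : ℝ) : check τ u = max (τ * u) ((τ - 1) * u) := by
  unfold check
  by_cases hu : u < 0
  · rw [Set.indicator_of_mem (by exact hu), max_eq_right (by nlinarith)]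
    simp; ring
  · rw [Set.indicator_of_notMem (by exact hu), max_eq_left (by nlinarith)]
    ring

lemma check_sub_le (h₀ : 0 ≤ τ) (h₁ : τ ≤ 1) (a b : ℝ) : check τ a - check τ b ≤ |a - b| := by
  rw [sub_le_iff_le_add, check_eq_max τ a]
  have hb₁ : τ * b ≤ check τ b := by rw [check_eq_max]; exact le_max_left _ _
  have hb₂ : (τ - 1) * b ≤ check τ b := by rw [check_eq_max]; exact le_max_right _ _
  have h₃ := le_abs_self (a - b)
  have h₄ := neg_abs_le (a - b)
  have h₅ := abs_nonneg (a - b)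
  refine max_le ?_ ?_ <;> nlinarith

lemma abs_check_sub_le (h₀ : 0 ≤ τ) (h₁ : τ ≤ 1) (a b : ℝ) :
    |check τ a - check τ b| ≤ |a - b| := by
  rw [abs_le]
  have h := check_sub_le h₀ h₁ b a
  rw [abs_sub_comm] at h
  exact ⟨by linarith, check_sub_le h₀ h₁ a b⟩

lemma check_convex (a b : ℝ) {t : ℝ} (ht₀ : 0 ≤ t) (ht₁ : t ≤ 1) :
    check τ (t * a + (1 - t) * b) ≤ t * check τ a + (1 - t) * check τ b := by
  have ha₁ : τ * a ≤ check τ a := by rw [check_eq_max]; exact le_max_left _ _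
  have ha₂ : (τ - 1) * a ≤ check τ a := by rw [check_eq_max]; exact le_max_right _ _
  have hb₁ : τ * b ≤ check τ b := by rw [check_eq_max]; exact le_max_left _ _
  have hb₂ : (τ - 1) * b ≤ check τ b := by rw [check_eq_max]; exact le_max_right _ _
  have ht := sub_nonneg.2 ht₁
  rw [check_eq_max τ (t * a + (1 - t) * b)]
  refine max_le ?_ ?_
  · linarith [mul_le_mul_of_nonneg_left ha₁ ht₀, mul_le_mul_of_nonneg_left hb₁ ht]
  · linarith [mul_le_mul_of_nonneg_left ha₂ ht₀, mul_le_mul_of_nonneg_left hb₂ ht]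

/-- The points `e - t * w` and `e - w + t * w` lie on the segment from `e` to `e - w` and have the
same sum as its ends, so two convexity inequalities add up to the claim. With `t` the truncation
factor, it transfers optimality at the far end of the segment to a truncated step from the near end.
-/
lemma check_scaled_le (e w : ℝ) {t : ℝ} (ht₀ : 0 ≤ t) (ht₁ : t ≤ 1) :
    check τ (e - t * w) - check τ e ≤ check τ (e - w) - check τ (e - w + t * w) := by
  have h₁ := check_convex (τ := τ) (e - w) e ht₀ ht₁
  have h₂ := check_convex (τ := τ) e (e - w) ht₀ ht₁
  rw [show t * (e - w) + (1 - t) * e = e - t * w by ring] at h₁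
  rw [show t * e + (1 - t) * (e - w) = e - w + t * w by ring] at h₂
  linarith

end Check

/-! ### Projection onto a ball. -/

section Trunc

variable {E : Type*} [NormedAddCommGroup E] [InnerProductSpace ℝ E] {R : ℝ}

/-- The projection onto the closed ball of radius `R` around the origin. -/
noncomputable def trunc (R : ℝ) (u : E) : E := (min 1 (R / ‖u‖)) • u

lemma trunc_factor_nonneg {E : Type*} [NormedAddCommGroup E] {R : ℝ} (hR : 0 < R) (u : E) :
    0 ≤ min 1 (R / ‖u‖) := by positivity

lemma trunc_of_le {u : E} (h : ‖u‖ ≤ R) : trunc R u = u := by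
  rcases eq_or_ne u 0 with rfl | hu
  · simp [trunc]
  · rw [trunc, min_eq_left, one_smul]
    rwa [le_div_iff₀ (norm_pos_iff.2 hu), one_mul]

lemma norm_trunc_of_ge (hR : 0 < R) {u : E} (h : R ≤ ‖u‖) : ‖trunc R u‖ = R := by
  have hu : 0 < ‖u‖ := hR.trans_le h
  rw [trunc, min_eq_right ((div_le_one hu).2 h), norm_smul, Real.norm_of_nonneg (by positivity)]
  field_simp

lemma norm_trunc_le (hR : 0 < R) (u : E) : ‖trunc R u‖ ≤ R := by
  rcases le_total ‖u‖ R with h | h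
  · rwa [trunc_of_le h]
  · rw [norm_trunc_of_ge hR h]

lemma norm_lt_of_norm_trunc_lt (hR : 0 < R) {u : E} {r : ℝ} (hr : r ≤ R) (h : ‖trunc R u‖ < r) :
    ‖u‖ < r := by
  rcases le_total ‖u‖ R with h' | h'
  · rwa [trunc_of_le h'] at h
  · rw [norm_trunc_of_ge hR h'] at h
    linarith

lemma inner_sub_trunc_le (hR : 0 < R) (u : E) {w : E} (hw : ‖w‖ ≤ R) :
    inner ℝ (u - trunc R u) (w - trunc R u) ≤ 0 := by
  rcases le_total ‖u‖ R with h | h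
  · simp [trunc_of_le h]
  · have hu : 0 < ‖u‖ := hR.trans_le h
    have hT : trunc R u = (R / ‖u‖) • u := by
      rw [trunc, min_eq_right ((div_le_one hu).2 h)]
    have h₁ : u - trunc R u = (1 - R / ‖u‖) • u := by rw [hT, sub_smul, one_smul]
    have h₂ : inner ℝ u (w - trunc R u) ≤ 0 := by
      rw [inner_sub_right, hT, real_inner_smul_right, real_inner_self_eq_norm_sq]
      have h₃ : inner ℝ u w ≤ ‖u‖ * R :=
        (real_inner_le_norm u w).trans (mul_le_mul_of_nonneg_left hw hu.le)
      have h₄ : R / ‖u‖ * ‖u‖ ^ 2 = ‖u‖ * R := by field_simp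
      linarith
    rw [h₁, real_inner_smul_left]
    exact mul_nonpos_of_nonneg_of_nonpos (sub_nonneg.2 ((div_le_one hu).2 h)) h₂

/-- Firm nonexpansiveness: the variational inequality of the projection at `u`, tested with `trunc R
v`, is added to the one at `v`, tested with `trunc R u`. It makes both the projection and its
complement 1-Lipschitz. -/
lemma inner_trunc_sub_nonneg (hR : 0 < R) (u v : E) :
    0 ≤ inner ℝ (trunc R u - trunc R v) ((u - v) - (trunc R u - trunc R v)) := by
  have h₁ := inner_sub_trunc_le hR u (norm_trunc_le hR v)
  have h₂ := inner_sub_trunc_le hR v (norm_trunc_le hR u)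
  have h₃ : inner ℝ (trunc R u - trunc R v) ((u - v) - (trunc R u - trunc R v)) =
      -inner ℝ (u - trunc R u) (trunc R v - trunc R u)
        - inner ℝ (v - trunc R v) (trunc R u - trunc R v) := by
    rw [← neg_sub (trunc R u) (trunc R v), inner_neg_right, neg_neg, ← inner_sub_left,
      real_inner_comm]
    congr 1
    abel
  rw [h₃]
  linarith

lemma norm_sub_trunc_sub_le (hR : 0 < R) (u v : E) :
    ‖(u - trunc R u) - (v - trunc R v)‖ ≤ ‖u - v‖ := by
  have h := inner_trunc_sub_nonneg hR u v
  have h₁ := norm_add_sq_real (trunc R u - trunc R v) ((u - v) - (trunc R u - trunc R v))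
  rw [add_sub_cancel] at h₁
  have h₂ : (u - trunc R u) - (v - trunc R v) = (u - v) - (trunc R u - trunc R v) := by abel
  rw [h₂]
  refine le_of_sq_le_sq ?_ (norm_nonneg _)
  nlinarith [sq_nonneg ‖trunc R u - trunc R v‖]

lemma norm_trunc_sub_le (hR : 0 < R) (u v : E) : ‖trunc R u - trunc R v‖ ≤ ‖u - v‖ := by
  have h := inner_trunc_sub_nonneg hR u v
  have h₁ := norm_add_sq_real (trunc R u - trunc R v) ((u - v) - (trunc R u - trunc R v))
  rw [add_sub_cancel] at h₁
  refine le_of_sq_le_sq ?_ (norm_nonneg _)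
  nlinarith [sq_nonneg ‖(u - v) - (trunc R u - trunc R v)‖]

end Trunc

/-! ### From the spectrum of the design matrices to quadratic forms. -/

section Gram

variable {p : ℕ}

lemma Model.gram_isHermitian (m : Model p) (n n₁ n₂ : ℕ) : (m.gram n n₁ n₂).IsHermitian := by
  ext i j
  simp [Model.gram, Matrix.sum_apply, Matrix.vecMulVec_apply, mul_comm]

lemma Model.dotProduct_gram_mulVec (m : Model p) (n n₁ n₂ : ℕ) (u : Vec p) :
    (fun j => u j) ⬝ᵥ ((m.gram n n₁ n₂).mulVec fun j => u j) =
      ((n₂ : ℝ) - n₁)⁻¹ * ∑ i ∈ Finset.Ico n₁ n₂, (inner ℝ (m.x n i) u) ^ 2 := by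
  rw [Model.gram, Matrix.smul_mulVec, dotProduct_smul, smul_eq_mul, Matrix.sum_mulVec,
    dotProduct_sum]
  congr 1
  refine Finset.sum_congr rfl fun i _ => ?_
  have h : (inner ℝ (m.x n i) u : ℝ) = (fun j => m.x n i j) ⬝ᵥ fun j => u j := by
    simp [PiLp.inner_apply, dotProduct, mul_comm]
  rw [h, Matrix.vecMulVec_mulVec, sq]
  simp [dotProduct_comm]

/-- Subtracting `m₀` moves the spectrum into the nonnegative reals, so the shifted matrix is
positive semidefinite; its quadratic form at `u` gives the bound. -/
lemma Model.mul_norm_sq_le_of_spectrum (m : Model p) {n n₁ n₂ : ℕ} {m₀ M₀ : ℝ} (h₁₂ : n₁ < n₂)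
    (h : spectrum ℝ (m.gram n n₁ n₂) ⊆ Set.Icc m₀ M₀) (u : Vec p) :
    m₀ * ((n₂ : ℝ) - n₁) * ‖u‖ ^ 2 ≤ ∑ i ∈ Finset.Ico n₁ n₂, (inner ℝ (m.x n i) u) ^ 2 := by
  have hpos : (0 : ℝ) < (n₂ : ℝ) - n₁ := by
    rw [sub_pos]; exact_mod_cast h₁₂
  have hS : (m.gram n n₁ n₂ - algebraMap ℝ _ m₀).PosSemidef := by
    rw [Matrix.posSemidef_iff_isHermitian_and_spectrum_nonneg]
    refine ⟨(m.gram_isHermitian n n₁ n₂).sub ?_, ?_⟩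
    · ext i j
      by_cases hij : i = j <;> simp [Matrix.algebraMap_matrix_apply, hij, eq_comm]
    · intro r hr
      have hr' : r + m₀ ∈ spectrum ℝ (m.gram n n₁ n₂) := by
        rw [← sub_add_cancel (m.gram n n₁ n₂) (algebraMap ℝ _ m₀), add_comm]
        exact spectrum.add_mem_add_iff.2 hr
      have := (h hr').1
      simpa using this
  have h₁ := hS.dotProduct_mulVec_nonneg (fun j => u j)
  rw [Matrix.sub_mulVec, dotProduct_sub] at h₁
  have h₂ : star (fun j => u j) = (fun j => u j) := by ext; simp
  have h₃ : (fun j => u j) ⬝ᵥ ((algebraMap ℝ (Matrix (Fin p) (Fin p) ℝ) m₀).mulVec fun j => u j) =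
      m₀ * ‖u‖ ^ 2 := by
    rw [Algebra.algebraMap_eq_smul_one, Matrix.smul_mulVec, Matrix.one_mulVec, dotProduct_smul,
      EuclideanSpace.real_norm_sq_eq, smul_eq_mul]
    simp [dotProduct, sq]
  rw [h₂, m.dotProduct_gram_mulVec, h₃] at h₁
  have h₄ := mul_le_mul_of_nonneg_left (sub_nonneg.1 h₁) hpos.le
  rw [mul_inv_cancel_left₀ hpos.ne'] at h₄
  linarith

end Gram

/-! ### The basic inequality, and sums over pieces of constancy. -/

section Estimator

variable {p : ℕ}

/-- Optimality against the comparison sequence `b - trunc R (b - b₀)`, combined with the convexity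
of the check function: a version of the basic inequality in which the deviations are bounded. -/
lemma IsEstimator.sum_trunc_le {τ : ℝ} {n : ℕ} {x : ℕ → Vec p} {Y w : ℕ → ℝ} {b : ℕ → Vec p}
    (hb : IsEstimator τ n x Y w b) (hw : ∀ i ∈ Finset.Icc 2 n, 0 ≤ w i) (b₀ : ℕ → Vec p) {R : ℝ}
    (hR : 0 < R) :
    ∑ i ∈ Finset.Icc 1 n, (check τ (Y i - inner ℝ (x i) (b₀ i + trunc R (b i - b₀ i)))
        - check τ (Y i - inner ℝ (x i) (b₀ i)))
      ≤ 2 * ∑ i ∈ Finset.Icc 2 n, w i * ‖b₀ i - b₀ (i - 1)‖ := by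
  have h := hb (fun i => b i - trunc R (b i - b₀ i))
  unfold objective at h
  -- An increment of the comparison sequence is an increment of the complement of the projection, no
  -- larger than that of `b - b₀`, plus an increment of `b₀`; this explains the factor 2.
  have hpen : ∑ i ∈ Finset.Icc 2 n,
      w i * ‖(b i - trunc R (b i - b₀ i)) - (b (i - 1) - trunc R (b (i - 1) - b₀ (i - 1)))‖ ≤
      ∑ i ∈ Finset.Icc 2 n, w i * ‖b i - b (i - 1)‖ +
        2 * ∑ i ∈ Finset.Icc 2 n, w i * ‖b₀ i - b₀ (i - 1)‖ := by
    rw [Finset.mul_sum, ← Finset.sum_add_distrib]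
    refine Finset.sum_le_sum fun i hi => ?_
    have h₁ := norm_sub_trunc_sub_le hR (b i - b₀ i) (b (i - 1) - b₀ (i - 1))
    have h₂ : (b i - trunc R (b i - b₀ i)) - (b (i - 1) - trunc R (b (i - 1) - b₀ (i - 1))) =
        (((b i - b₀ i) - trunc R (b i - b₀ i)) -
          ((b (i - 1) - b₀ (i - 1)) - trunc R (b (i - 1) - b₀ (i - 1)))) +
        (b₀ i - b₀ (i - 1)) := by abel
    have h₃ : (b i - b₀ i) - (b (i - 1) - b₀ (i - 1)) =
        (b i - b (i - 1)) - (b₀ i - b₀ (i - 1)) := by abel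
    rw [h₃] at h₁
    have h₄ := norm_sub_le (b i - b (i - 1)) (b₀ i - b₀ (i - 1))
    have h₅ := norm_add_le (((b i - b₀ i) - trunc R (b i - b₀ i)) -
          ((b (i - 1) - b₀ (i - 1)) - trunc R (b (i - 1) - b₀ (i - 1)))) (b₀ i - b₀ (i - 1))
    rw [h₂]
    have h₆ := mul_le_mul_of_nonneg_left ((h₅.trans (add_le_add_left (h₁.trans h₄) _))) (hw i hi)
    linarith
  have hloss : ∑ i ∈ Finset.Icc 1 n, (check τ (Y i - inner ℝ (x i) (b₀ i + trunc R (b i - b₀ i)))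
        - check τ (Y i - inner ℝ (x i) (b₀ i))) ≤
      ∑ i ∈ Finset.Icc 1 n, (check τ (Y i - inner ℝ (x i) (b i)) -
        check τ (Y i - inner ℝ (x i) (b i - trunc R (b i - b₀ i)))) := by
    refine Finset.sum_le_sum fun i _ => ?_
    have h₁ := check_scaled_le (τ := τ) (Y i - inner ℝ (x i) (b₀ i)) (inner ℝ (x i) (b i - b₀ i))
      (trunc_factor_nonneg hR (b i - b₀ i)) (min_le_left _ _)
    rw [← real_inner_smul_right, ← trunc] at h₁
    simp only [inner_add_right, inner_sub_right] at h₁ ⊢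
    convert h₁ using 2 <;> congr 1 <;> ring
  rw [Finset.sum_sub_distrib] at hloss
  rw [Finset.sum_sub_distrib] at hloss ⊢
  linarith

lemma changePoints_mem {n : ℕ} {b : ℕ → Vec p} {i : ℕ} :
    i ∈ changePoints n b ↔ (2 ≤ i ∧ i ≤ n) ∧ b i ≠ b (i - 1) := by
  simp [changePoints]

lemma eq_of_forall_notMem_changePoints {n : ℕ} {b : ℕ → Vec p} {i j : ℕ} (hi : 1 ≤ i) (hij : i ≤ j)
    (hj : j ≤ n) (h : ∀ t, i < t → t ≤ j → t ∉ changePoints n b) : b j = b i := by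
  induction j, hij using Nat.le_induction with
  | base => rfl
  | succ j hij ih =>
    have h₁ := h (j + 1) (by omega) le_rfl
    rw [changePoints_mem] at h₁
    have h₂ : b (j + 1) = b j := by
      by_contra hne
      exact h₁ ⟨⟨by omega, hj⟩, by simpa using hne⟩
    rw [h₂]
    exact ih (by omega) fun t ht ht' => h t ht (by omega)

/-- A lower bound for the sums over the intervals on which `u` is constant gives a lower bound for
the total sum. -/
lemma neg_card_mul_le_sum {A : ℝ} (hA : 0 ≤ A) (h : ℕ → Vec p → ℝ) (u : ℕ → Vec p) (n : ℕ)
    (hc : ∀ a b v, 1 ≤ a → a ≤ b → b ≤ n + 1 → v ∈ u '' Set.Icc 1 n → -A ≤ ∑ i ∈ Finset.Ico a b, h i v) :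
    -(((changePoints n u).card + 1) * A) ≤ ∑ i ∈ Finset.Icc 1 n, h i (u i) := by
  induction n using Nat.strong_induction_on with
  | _ n ih =>
    rcases Nat.eq_zero_or_pos n with rfl | hn0
    · simpa using (neg_nonpos.2 (mul_nonneg (by positivity : (0 : ℝ) ≤ (changePoints 0 u).card + 1)
        hA))
    have hIcc : ∀ m, Finset.Icc 1 m = Finset.Ico 1 (m + 1) := fun m => by
      ext; simp
    rw [hIcc]
    by_cases hS : (changePoints n u).Nonempty
    -- The last change-point `c` splits off the final constant piece; the first `c - 1` observations
    -- have fewer change-points, so the induction hypothesis pays for the rest.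
    · set c := (changePoints n u).max' hS with hcdef
      have hcm := (changePoints n u).max'_mem hS
      rw [← hcdef] at hcm
      obtain ⟨⟨hc2, hcn⟩, -⟩ := changePoints_mem.1 hcm
      have hconst : ∀ i ∈ Finset.Ico c (n + 1), u i = u c := by
        intro i hi
        rw [Finset.mem_Ico] at hi
        refine eq_of_forall_notMem_changePoints (n := n) (by omega) hi.1 (by omega) ?_
        intro t ht _ htm
        have := (changePoints n u).le_max' t htm
        omega
      have h₁ := hc c (n + 1) (u c) (by omega) (by omega) le_rfl ⟨c, ⟨by omega, hcn⟩, rfl⟩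
      have h₂ := ih (c - 1) (by omega) (fun a b v ha hab hb hv => hc a b v ha hab (by omega)
        (Set.image_mono (Set.Icc_subset_Icc_right (by omega)) hv))
      have hsub : changePoints (c - 1) u ⊆ (changePoints n u).erase c := by
        intro t ht
        rw [changePoints_mem] at ht
        rw [Finset.mem_erase, changePoints_mem]
        exact ⟨by omega, ⟨by omega, by omega⟩, ht.2⟩
      have hcard := Finset.card_le_card hsub
      rw [Finset.card_erase_of_mem hcm] at hcard
      have hpos := Finset.card_pos.2 hS
      have hcard' : ((changePoints (c - 1) u).card : ℝ) + 1 ≤ (changePoints n u).card := by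
        exact_mod_cast (by omega : (changePoints (c - 1) u).card + 1 ≤ (changePoints n u).card)
      rw [hIcc, Nat.sub_add_cancel (by omega)] at h₂
      rw [← Finset.sum_Ico_consecutive _ (show 1 ≤ c by omega) (show c ≤ n + 1 by omega),
        Finset.sum_congr (s₁ := Finset.Ico c (n + 1)) rfl fun i hi => by rw [hconst i hi]]
      have := mul_le_mul_of_nonneg_right hcard' hA
      linarith
    · rw [Finset.not_nonempty_iff_eq_empty] at hS
      have hconst : ∀ i ∈ Finset.Ico 1 (n + 1), u i = u 1 := by
        intro i hi
        rw [Finset.mem_Ico] at hi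
        refine eq_of_forall_notMem_changePoints (n := n) le_rfl hi.1 (by omega) ?_
        intro t _ _ htm
        simp [hS] at htm
      rw [Finset.sum_congr rfl fun i hi => by rw [hconst i hi], hS]
      have := hc 1 (n + 1) (u 1) le_rfl (by omega) le_rfl ⟨1, ⟨le_rfl, hn0⟩, rfl⟩
      simpa using this

end Estimator

variable {p : ℕ}

/-! ### Merged sequences and the places where they differ from the original. -/

section Merging

lemma lastBeforeNext_spec {n : ℕ} {B : Finset ℕ} (hB : B ⊆ Finset.Icc 2 n) {i : ℕ} (hi : i ≤ n) :
    i ≤ lastBeforeNext n B i ∧ lastBeforeNext n B i ≤ n ∧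
      (∀ t, i < t → t ≤ lastBeforeNext n B i → t ∉ B) ∧
      (lastBeforeNext n B i < n → lastBeforeNext n B i + 1 ∈ B) := by
  unfold lastBeforeNext
  split_ifs with h
  · have hm := Finset.min'_mem _ h
    set s := (B.filter (fun t => i < t)).min' h with hs
    rw [Finset.mem_filter] at hm
    have h2 := Finset.mem_Icc.1 (hB hm.1)
    refine ⟨by omega, by omega, fun t ht hts htB => ?_, fun _ => ?_⟩
    · have := (B.filter (fun t => i < t)).min'_le t (Finset.mem_filter.2 ⟨htB, ht⟩)
      omega
    · rw [Nat.sub_add_cancel (by omega)]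
      exact hm.1
  · refine ⟨hi, le_rfl, fun t ht _ htB => h ⟨t, Finset.mem_filter.2 ⟨htB, ht⟩⟩, fun hn => ?_⟩
    exact absurd hn (lt_irrefl n)

lemma lastBeforeNext_pred {n : ℕ} {B : Finset ℕ} {i : ℕ} (hi : i ∉ B) (h1 : 1 ≤ i) :
    lastBeforeNext n B (i - 1) = lastBeforeNext n B i := by
  have : B.filter (fun t => i - 1 < t) = B.filter (fun t => i < t) := by
    refine Finset.filter_congr fun t ht => ?_
    have : t ≠ i := fun h => hi (h ▸ ht)
    omega
  unfold lastBeforeNext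
  simp only [this]

lemma changePoints_mergedCoef_subset (n : ℕ) (B : Finset ℕ) (b : ℕ → Vec p) :
    changePoints n (mergedCoef n B b) ⊆ B := by
  intro i hi
  rw [changePoints_mem] at hi
  by_contra h
  exact hi.2 (by rw [mergedCoef, mergedCoef, lastBeforeNext_pred h (by omega)])

lemma prev_le_of_forall_notMem {B : Finset ℕ} {i c : ℕ} (hi : 1 ≤ i)
    (h : ∀ t, i < t → t < c → t ∉ B) : prev B c ≤ i := by
  unfold prev
  refine max_le hi (Finset.sup_le fun t ht => ?_)
  rw [Finset.mem_filter] at ht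
  by_contra hlt
  exact h t (not_le.1 hlt) ht.2 ht.1

lemma prev_mem (B : Finset ℕ) (c : ℕ) : prev B c ∈ insert 1 B := by
  unfold prev
  rcases max_choice 1 ((B.filter (fun s => s < c)).sup id) with h | h <;> rw [h]
  · simp
  · rcases (B.filter (fun s => s < c)).eq_empty_or_nonempty with h0 | h0
    · simp [h0] at h
    · obtain ⟨t, ht, hts⟩ := Finset.exists_mem_eq_sup _ h0 id
      rw [hts]
      exact Finset.mem_insert_of_mem (Finset.mem_filter.1 ht).1

/-- The observations within the distance `r` after a point of `B`, or after the first
observation. -/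
noncomputable def clusterZone (B : Finset ℕ) (r : ℝ) : Finset ℕ :=
  (insert 1 B).biUnion fun s => Finset.Icc s (s + ⌊r⌋₊)

lemma card_clusterZone_le (B : Finset ℕ) {r : ℝ} (hr : 0 ≤ r) :
    ((clusterZone B r).card : ℝ) ≤ (B.card + 1) * (r + 1) := by
  have h : (clusterZone B r).card ≤ (B.card + 1) * (⌊r⌋₊ + 1) := by
    refine Finset.card_biUnion_le.trans ?_
    refine (Finset.sum_le_card_nsmul _ _ (⌊r⌋₊ + 1) fun s _ => ?_).trans ?_
    · rw [Nat.card_Icc]; omega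
    · rw [smul_eq_mul]
      exact Nat.mul_le_mul_right _ (Finset.card_insert_le _ _)
  calc ((clusterZone B r).card : ℝ) ≤ ((B.card + 1) * (⌊r⌋₊ + 1) : ℕ) := by exact_mod_cast h
    _ ≤ _ := by
      push_cast
      gcongr
      exact Nat.floor_le hr

/-- If the points that are not kept are close to the kept ones, then the merged sequence differs
from the original sequence at few places only. -/
lemma mergedCoef_eq_of_notMem_clusterZone {n : ℕ} {B : Finset ℕ} {b : ℕ → Vec p} {r : ℝ}
    (hB : B ⊆ changePoints n b)
    (hr : ∀ t ∈ changePoints n b \ B, (t : ℝ) - (prev B t : ℝ) ≤ r) {i : ℕ}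
    (hi : i ∈ Finset.Icc 1 n) (hz : i ∉ clusterZone B r) : mergedCoef n B b i = b i := by
  rw [Finset.mem_Icc] at hi
  have hB2 : B ⊆ Finset.Icc 2 n := hB.trans (Finset.filter_subset _ _)
  obtain ⟨h₁, h₂, h₃, -⟩ := lastBeforeNext_spec hB2 hi.2
  -- A jump of `b` after `i` and before the next kept point is a dropped one. The kept point
  -- preceding it is at or before `i`, so `i` lies between the two, hence in the zone.
  refine eq_of_forall_notMem_changePoints hi.1 h₁ h₂ fun c hic hcs hc => hz ?_
  have hcB := h₃ c hic hcs
  have h₄ := hr c (Finset.mem_sdiff.2 ⟨hc, hcB⟩)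
  have h₅ : prev B c ≤ i :=
    prev_le_of_forall_notMem hi.1 fun t ht htc => h₃ t ht (htc.le.trans hcs)
  refine Finset.mem_biUnion.2 ⟨prev B c, prev_mem B c, Finset.mem_Icc.2 ⟨h₅, ?_⟩⟩
  have h₆ : ((c - prev B c : ℕ) : ℝ) ≤ r := by
    rw [Nat.cast_sub (by omega)]; exact h₄
  have h₇ := Nat.le_floor h₆
  omega

end Merging

/-! ### The true coefficient sequence and its jumps. -/

section Phase

variable {m : Model p} {n : ℕ}

lemma Model.t_lt_of_lt (h : ∀ k ≤ m.K, m.t n k < m.t n (k + 1)) {j k : ℕ} (hjk : j < k)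
    (hk : k ≤ m.K + 1) : m.t n j < m.t n k := by
  induction k, hjk using Nat.le_induction with
  | base => exact h j (by omega)
  | succ k hjk ih => exact (ih (by omega)).trans (h k (by omega))

lemma Model.t_le_of_le (h : ∀ k ≤ m.K, m.t n k < m.t n (k + 1)) {j k : ℕ} (hjk : j ≤ k)
    (hk : k ≤ m.K + 1) : m.t n j ≤ m.t n k := by
  rcases hjk.eq_or_lt with rfl | hlt
  · exact le_rfl
  · exact (Model.t_lt_of_lt h hlt hk).le

/-- The phase counts only the change-points with index `1, ..., K`. Hence the first phase needs no
lower bound on `i` and the last one no upper bound, and the observation `n` belongs to the last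
phase. -/
lemma Model.trueCoef_eq (h : ∀ k ≤ m.K, m.t n k < m.t n (k + 1)) {k i : ℕ} (hk : k ≤ m.K)
    (hki : k = 0 ∨ m.t n k ≤ i) (hik : k = m.K ∨ i < m.t n (k + 1)) :
    m.trueCoef n i = m.phi n (k + 1) := by
  have hS : (Finset.Icc 1 m.K).filter (fun j => m.t n j ≤ i) = Finset.Icc 1 k := by
    ext j
    simp only [Finset.mem_filter, Finset.mem_Icc]
    constructor
    · rintro ⟨⟨h1, h2⟩, h3⟩
      refine ⟨h1, ?_⟩
      by_contra hlt
      rcases hik with rfl | hik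
      · omega
      · have := Model.t_le_of_le h (show k + 1 ≤ j by omega) (by omega)
        omega
    · rintro ⟨h1, h2⟩
      refine ⟨⟨h1, by omega⟩, ?_⟩
      rcases hki with rfl | hki
      · omega
      · exact (Model.t_le_of_le h h2 (by omega)).trans hki
  rw [Model.trueCoef, Model.phase, hS]
  simp [add_comm]

lemma changePoints_trueCoef_subset (m : Model p) (n : ℕ) :
    changePoints n (m.trueCoef n) ⊆ m.trueLocations n := by
  intro i hi
  rw [changePoints_mem] at hi
  by_contra hn
  refine hi.2 ?_
  unfold Model.trueCoef Model.phase
  congr 3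
  refine Finset.filter_congr fun k hk => ?_
  have : m.t n k ≠ i := fun he => hn (Finset.mem_image.2 ⟨k, hk, he⟩)
  omega

lemma card_changePoints_trueCoef_le (m : Model p) (n : ℕ) :
    (changePoints n (m.trueCoef n)).card ≤ m.K :=
  (Finset.card_le_card (changePoints_trueCoef_subset m n)).trans
    (Finset.card_image_le.trans (by simp))

/-- The change-points of a sequence computed pointwise from two other sequences. -/
lemma changePoints_map₂_subset {q r s : ℕ} (g : Vec q → Vec r → Vec s) (u : ℕ → Vec q)
    (v : ℕ → Vec r) :
    changePoints n (fun i => g (u i) (v i)) ⊆ changePoints n u ∪ changePoints n v := by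
  intro i hi
  rw [Finset.mem_union]
  by_contra hn
  push Not at hn
  rw [changePoints_mem] at hi
  simp only [changePoints_mem, not_and, not_not] at hn
  exact hi.2 (by rw [hn.1 hi.1, hn.2 hi.1])

lemma card_changePoints_map₂_le {q r s : ℕ} (g : Vec q → Vec r → Vec s) (u : ℕ → Vec q)
    (v : ℕ → Vec r) :
    (changePoints n (fun i => g (u i) (v i))).card ≤
      (changePoints n u).card + (changePoints n v).card :=
  (Finset.card_le_card (changePoints_map₂_subset g u v)).trans (Finset.card_union_le _ _)

lemma Model.trueCoef_sub_pred (h : ∀ k ≤ m.K, m.t n k < m.t n (k + 1)) (hstart : m.t n 0 = 1)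
    {i : ℕ} (hi : i ∈ m.trueLocations n) :
    ∃ k ∈ Finset.Icc 1 m.K, i = m.t n k ∧
      m.trueCoef n i - m.trueCoef n (i - 1) = m.phi n (k + 1) - m.phi n k := by
  obtain ⟨k, hk, rfl⟩ := Finset.mem_image.1 hi
  refine ⟨k, hk, rfl, ?_⟩
  rw [Finset.mem_Icc] at hk
  have h0 := Model.t_lt_of_lt h (show 0 < k by omega) (by omega)
  have h1 := h (k - 1) (by omega)
  have h2 := h k (by omega)
  rw [show k - 1 + 1 = k by omega] at h1
  rw [Model.trueCoef_eq h hk.2 (Or.inr le_rfl) (Or.inr h2),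
    Model.trueCoef_eq h (show k - 1 ≤ m.K by omega) (Or.inr (by omega)) (Or.inr (by
      rw [show k - 1 + 1 = k by omega]; omega)), show k - 1 + 1 = k by omega]

lemma Model.sum_norm_trueCoef_sub_le (h : ∀ k ≤ m.K, m.t n k < m.t n (k + 1))
    (hstart : m.t n 0 = 1) {C : ℝ} (hC : 0 ≤ C)
    (hj : ∀ k ∈ Finset.Icc 1 m.K, ‖m.phi n (k + 1) - m.phi n k‖ ≤ C) :
    ∑ i ∈ Finset.Icc 2 n, ‖m.trueCoef n i - m.trueCoef n (i - 1)‖ ≤ m.K * C := by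
  have h₁ : ∑ i ∈ Finset.Icc 2 n, ‖m.trueCoef n i - m.trueCoef n (i - 1)‖ =
      ∑ i ∈ changePoints n (m.trueCoef n), ‖m.trueCoef n i - m.trueCoef n (i - 1)‖ := by
    symm
    refine Finset.sum_subset (Finset.filter_subset _ _) fun i hi hn => ?_
    rw [norm_eq_zero, sub_eq_zero]
    by_contra hne
    exact hn (Finset.mem_filter.2 ⟨hi, hne⟩)
  rw [h₁]
  refine (Finset.sum_le_card_nsmul _ _ C fun i hi => ?_).trans ?_
  · obtain ⟨k, hk, -, he⟩ := Model.trueCoef_sub_pred h hstart (changePoints_trueCoef_subset m n hi)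
    rw [he]
    exact hj k hk
  · rw [nsmul_eq_mul]
    gcongr
    exact card_changePoints_trueCoef_le m n

end Phase

/-! ### Events with probability tending to one. -/

section Whp

variable {Ω : Type*} [MeasurableSpace Ω] {μ : Measure Ω}

/-- `P n` holds with (inner) probability tending to one. -/
def Whp (μ : Measure Ω) (P : ℕ → Ω → Prop) : Prop :=
  Tendsto (fun n => μ {ω | ¬ P n ω}) atTop (𝓝 0)

lemma Whp.mono {P Q : ℕ → Ω → Prop} (hP : Whp μ P) (h : ∀ᶠ n in atTop, ∀ ω, P n ω → Q n ω) :
    Whp μ Q := by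
  refine tendsto_of_tendsto_of_tendsto_of_le_of_le' tendsto_const_nhds hP
    (Eventually.of_forall fun _ => zero_le) ?_
  filter_upwards [h] with n hn
  exact measure_mono fun ω hω hPω => hω (hn ω hPω)

lemma Whp.and {P Q : ℕ → Ω → Prop} (hP : Whp μ P) (hQ : Whp μ Q) :
    Whp μ (fun n ω => P n ω ∧ Q n ω) := by
  have h := Tendsto.add hP hQ
  rw [add_zero] at h
  refine tendsto_of_tendsto_of_tendsto_of_le_of_le tendsto_const_nhds h
    (fun _ => zero_le) fun n => ?_
  refine (measure_mono ?_).trans (measure_union_le _ _)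
  intro ω hω
  by_cases hp : P n ω
  · exact Or.inr fun hq => hω ⟨hp, hq⟩
  · exact Or.inl hp

lemma whp_of_ae {P : ℕ → Ω → Prop} (h : ∀ n, ∀ᵐ ω ∂μ, P n ω) : Whp μ P := by
  have : (fun n => μ {ω | ¬ P n ω}) = fun _ => 0 := funext fun n => ae_iff.1 (h n)
  rw [Whp, this]
  exact tendsto_const_nhds

lemma Whp.forall_finset {ι : Type*} {P : ι → ℕ → Ω → Prop} (S : Finset ι)
    (h : ∀ i ∈ S, Whp μ (P i)) : Whp μ (fun n ω => ∀ i ∈ S, P i n ω) := by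
  classical
  induction S using Finset.induction_on with
  | empty => exact whp_of_ae fun n => by simp
  | insert a S _ ih =>
    refine ((h a (by simp)).and (ih fun i hi => h i (by simp [hi]))).mono
      (Eventually.of_forall fun n ω hω => ?_)
    simpa using hω

lemma Whp.tendsto_one [IsProbabilityMeasure μ] {P : ℕ → Ω → Prop} (h : Whp μ P) :
    Tendsto (fun n => μ {ω | P n ω}) atTop (𝓝 1) := by
  have h₁ : Tendsto (fun n => 1 - μ {ω | ¬ P n ω}) atTop (𝓝 1) := by
    simpa using ENNReal.Tendsto.sub tendsto_const_nhds h (Or.inl ENNReal.one_ne_top)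
  refine tendsto_of_tendsto_of_tendsto_of_le_of_le h₁ tendsto_const_nhds (fun n => ?_)
    fun n => prob_le_one
  rw [tsub_le_iff_right, ← measure_univ (μ := μ)]
  refine (measure_mono ?_).trans (measure_union_le _ _)
  intro ω _
  exact em (P n ω)

/-- Measurability is essential here: for outer measure, `P n` and its complement could both have
measure near one. The converse needs only subadditivity. -/
lemma whp_of_tendsto_one [IsProbabilityMeasure μ] {P : ℕ → Ω → Prop}
    (hm : ∀ n, MeasurableSet {ω | P n ω}) (h : Tendsto (fun n => μ {ω | P n ω}) atTop (𝓝 1)) :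
    Whp μ P := by
  have h₁ : (fun n => μ {ω | ¬ P n ω}) = fun n => 1 - μ {ω | P n ω} :=
    funext fun n => prob_compl_eq_one_sub (hm n)
  rw [Whp, h₁]
  simpa using ENNReal.Tendsto.sub tendsto_const_nhds h (Or.inl ENNReal.one_ne_top)

/-- Turns a probabilistic argument into a deterministic conclusion, as needed to compare `n λ_n`
with `log n`. -/
lemma Whp.eventually_exists [IsProbabilityMeasure μ] {P : ℕ → Ω → Prop} (h : Whp μ P) :
    ∀ᶠ n in atTop, ∃ ω, P n ω := by
  filter_upwards [h.eventually_lt_const one_pos] with n hn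
  by_contra hne
  push Not at hne
  have : {ω | ¬ P n ω} = Set.univ := Set.eq_univ_of_forall hne
  rw [this, measure_univ] at hn
  exact lt_irrefl _ hn

end Whp

/-! ### Moments and exponential moments of the excess loss. -/

section ErrorLaw

variable {ν : Measure ℝ} [IsProbabilityMeasure ν] {τ η c : ℝ}

lemma continuous_check (τ : ℝ) : Continuous (check τ) := by
  have : check τ = fun u => max (τ * u) ((τ - 1) * u) := funext (check_eq_max τ)
  rw [this]
  fun_prop

lemma measurable_check_sub (τ w : ℝ) : Measurable fun e => check τ (e - w) - check τ e := by
  have h := continuous_check τ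
  exact Continuous.measurable (by fun_prop)

lemma abs_check_sub_check_le (h₀ : 0 ≤ τ) (h₁ : τ ≤ 1) (w e : ℝ) :
    |check τ (e - w) - check τ e| ≤ |w| := by
  simpa using abs_check_sub_le h₀ h₁ (e - w) e

lemma integrable_of_abs_le {g : ℝ → ℝ} (hg : Measurable g) (C : ℝ) (h : ∀ e, |g e| ≤ C) :
    Integrable g ν :=
  Integrable.of_bound hg.aestronglyMeasurable C (Eventually.of_forall h)

lemma integrable_check_sub (h₀ : 0 ≤ τ) (h₁ : τ ≤ 1) (w : ℝ) :
    Integrable (fun e => check τ (e - w) - check τ e) ν :=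
  integrable_of_abs_le (measurable_check_sub τ w) |w| (abs_check_sub_check_le h₀ h₁ w)

lemma integrable_exp_check_sub (h₀ : 0 ≤ τ) (h₁ : τ ≤ 1) (s w : ℝ) :
    Integrable (fun e => Real.exp (s * (check τ (e - w) - check τ e))) ν := by
  refine integrable_of_abs_le ((measurable_check_sub τ w).const_mul s).exp
    (Real.exp (|s| * |w|)) fun e => ?_
  rw [abs_of_nonneg (Real.exp_pos _).le, Real.exp_le_exp]
  refine (le_abs_self _).trans ?_
  rw [abs_mul]
  exact mul_le_mul_of_nonneg_left (abs_check_sub_check_le h₀ h₁ w e) (abs_nonneg s)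

/-- The law `ν` has the `τ`-quantile `0`, and puts mass at least `c * a` on both sides of the
origin, within the distance `a`, for `a ≤ η`. -/
structure QuantileLaw (ν : Measure ℝ) (τ η c : ℝ) : Prop where
  tau_pos : 0 < τ
  tau_lt : τ < 1
  eta_pos : 0 < η
  c_pos : 0 < c
  quantile : ν.real (Set.Iio 0) = τ
  right : ∀ a, 0 ≤ a → a ≤ η → c * a ≤ ν.real (Set.Ico 0 a)
  left : ∀ a, 0 ≤ a → a ≤ η → c * a ≤ ν.real (Set.Ico (-a) 0)

namespace QuantileLaw

lemma integral_check_sub_ge (h : QuantileLaw ν τ η c) (w : ℝ) :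
    |w| / 2 * (c * min (|w| / 2) η) ≤ ∫ e, (check τ (e - w) - check τ e) ∂ν := by
  have h₀ := h.tau_pos.le
  have h₁ := h.tau_lt.le
  set a := min (|w| / 2) η with ha
  have ha0 : 0 ≤ a := le_min (by positivity) h.eta_pos.le
  have haη : a ≤ η := min_le_right _ _
  have haw : a ≤ |w| / 2 := min_le_left _ _
  -- The term `w * (1_{e < 0} - τ)` has mean zero because `0` is the `τ`-quantile. `S` collects the
  -- errors between `0` and `a` on the side of `w`; as `a ≤ |w| / 2`, the loss exceeds the mean-zero
  -- term there by at least `|w| / 2`.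
  obtain ⟨S, hS, hcS, hpt⟩ : ∃ S : Set ℝ, MeasurableSet S ∧ c * a ≤ ν.real S ∧
      ∀ e, w * (Set.Iio 0).indicator 1 e + |w| / 2 * S.indicator 1 e - w * τ ≤
        check τ (e - w) - check τ e := by
    rcases le_total 0 w with hw | hw
    · rw [abs_of_nonneg hw] at haw ⊢
      refine ⟨Set.Ico 0 a, measurableSet_Ico, h.right a ha0 haη, fun e => ?_⟩
      rw [check_eq_max τ e]
      by_cases he : e < 0
      · rw [Set.indicator_of_mem (show e ∈ Set.Iio 0 from he),
          Set.indicator_of_notMem (fun hm => absurd hm.1 (not_le.2 he)), max_eq_right (by nlinarith)]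
        have := le_max_right (τ * (e - w)) ((τ - 1) * (e - w))
        rw [← check_eq_max] at this
        simp only [Pi.one_apply]
        linarith
      · rw [Set.indicator_of_notMem (show e ∉ Set.Iio 0 from he), max_eq_left (by nlinarith)]
        by_cases hea : e < a
        · rw [Set.indicator_of_mem (show e ∈ Set.Ico 0 a from ⟨not_lt.1 he, hea⟩)]
          have := le_max_right (τ * (e - w)) ((τ - 1) * (e - w))
          rw [← check_eq_max] at this
          simp only [Pi.one_apply]
          linarith
        · rw [Set.indicator_of_notMem (fun hm => hea hm.2)]
          have := le_max_left (τ * (e - w)) ((τ - 1) * (e - w))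
          rw [← check_eq_max] at this
          linarith
    · rw [abs_of_nonpos hw] at haw ⊢
      refine ⟨Set.Ico (-a) 0, measurableSet_Ico, h.left a ha0 haη, fun e => ?_⟩
      rw [check_eq_max τ e]
      by_cases he : e < 0
      · rw [Set.indicator_of_mem (show e ∈ Set.Iio 0 from he), max_eq_right (by nlinarith)]
        by_cases hea : -a ≤ e
        · rw [Set.indicator_of_mem (show e ∈ Set.Ico (-a) 0 from ⟨hea, he⟩)]
          have := le_max_left (τ * (e - w)) ((τ - 1) * (e - w))
          rw [← check_eq_max] at this
          simp only [Pi.one_apply]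
          linarith
        · rw [Set.indicator_of_notMem (fun hm => hea hm.1)]
          have := le_max_right (τ * (e - w)) ((τ - 1) * (e - w))
          rw [← check_eq_max] at this
          simp only [Pi.one_apply]
          linarith
      · rw [Set.indicator_of_notMem (show e ∉ Set.Iio 0 from he),
          Set.indicator_of_notMem (fun hm => he hm.2), max_eq_left (by nlinarith)]
        have := le_max_left (τ * (e - w)) ((τ - 1) * (e - w))
        rw [← check_eq_max] at this
        linarith
  have hi₁ : Integrable (fun e => w * (Set.Iio (0 : ℝ)).indicator (1 : ℝ → ℝ) e) ν :=
    ((integrable_const (1 : ℝ)).indicator measurableSet_Iio).const_mul w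
  have hi₂ : Integrable (fun e => |w| / 2 * S.indicator (1 : ℝ → ℝ) e) ν :=
    ((integrable_const (1 : ℝ)).indicator hS).const_mul _
  have hi₃ : Integrable (fun e => w * (Set.Iio (0 : ℝ)).indicator (1 : ℝ → ℝ) e +
      |w| / 2 * S.indicator (1 : ℝ → ℝ) e) ν := hi₁.add hi₂
  have hle := integral_mono (hi₃.sub (integrable_const (w * τ)))
    (integrable_check_sub (ν := ν) h₀ h₁ w) hpt
  refine le_trans ?_ hle
  have he : ∫ e, (w * (Set.Iio (0 : ℝ)).indicator (1 : ℝ → ℝ) e + |w| / 2 * S.indicator (1 : ℝ → ℝ) e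
      - w * τ) ∂ν = w * τ + |w| / 2 * ν.real S - w * τ := by
    rw [integral_sub hi₃ (integrable_const _), integral_add hi₁ hi₂,
      integral_const_mul, integral_const_mul, integral_indicator_one measurableSet_Iio,
      integral_indicator_one hS, h.quantile]
    simp
  refine le_of_le_of_eq ?_ he.symm
  have := mul_le_mul_of_nonneg_left hcS (show 0 ≤ |w| / 2 by positivity)
  linarith

/-- For bounded shifts, `min (|w| / 2) η` is at least a fixed multiple of `|w|`, so the gain of
`integral_check_sub_ge` becomes quadratic. -/
lemma exists_sq_le_integral (h : QuantileLaw ν τ η c) {R : ℝ} (hR : 0 < R) :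
    ∃ c' > 0, ∀ w, |w| ≤ R → c' * w ^ 2 ≤ ∫ e, (check τ (e - w) - check τ e) ∂ν := by
  have hη := h.eta_pos
  have hc := h.c_pos
  refine ⟨c / 2 * min (1 / 2) (η / R), by positivity, fun w hw => ?_⟩
  refine le_trans ?_ (h.integral_check_sub_ge w)
  have h₁ : |w| * min (1 / 2) (η / R) ≤ min (|w| / 2) η := by
    refine le_min ?_ ?_
    · have := mul_le_mul_of_nonneg_left (min_le_left (1 / 2) (η / R)) (abs_nonneg w)
      linarith
    · calc |w| * min (1 / 2) (η / R) ≤ R * (η / R) := by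
            gcongr
            exact min_le_right _ _
        _ = η := by field_simp
  calc c / 2 * min (1 / 2) (η / R) * w ^ 2
      = |w| / 2 * (c * (|w| * min (1 / 2) (η / R))) := by rw [← sq_abs w]; ring
    _ ≤ _ := by gcongr

/-- Integrate `exp y ≤ 1 + y + y ^ 2`, valid for `|y| ≤ 1`; the Lipschitz bound gives `|y| ≤ s *
|w|`. -/
lemma integral_exp_le (h : QuantileLaw ν τ η c) {s w : ℝ} (hs : 0 ≤ s) (hsw : s * |w| ≤ 1) :
    ∫ e, Real.exp (-s * (check τ (e - w) - check τ e)) ∂ν ≤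
      1 - s * ∫ e, (check τ (e - w) - check τ e) ∂ν + s ^ 2 * w ^ 2 := by
  have h₀ := h.tau_pos.le
  have h₁ := h.tau_lt.le
  have hi := integrable_check_sub (ν := ν) h₀ h₁ w
  have hpt : ∀ e, Real.exp (-s * (check τ (e - w) - check τ e)) ≤
      1 - s * (check τ (e - w) - check τ e) + s ^ 2 * w ^ 2 := by
    intro e
    have hX := abs_check_sub_check_le h₀ h₁ w e
    have hX' : |-s * (check τ (e - w) - check τ e)| ≤ s * |w| := by
      rw [abs_mul, abs_neg, abs_of_nonneg hs]
      exact mul_le_mul_of_nonneg_left hX hs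
    have := (abs_le.1 (Real.abs_exp_sub_one_sub_id_le (hX'.trans hsw))).2
    have hsq : (-s * (check τ (e - w) - check τ e)) ^ 2 ≤ s ^ 2 * w ^ 2 := by
      rw [← sq_abs, ← sq_abs w, ← mul_pow]
      exact pow_le_pow_left₀ (abs_nonneg _) hX' 2
    linarith
  have hi' : Integrable (fun e => 1 - s * (check τ (e - w) - check τ e)) ν :=
    (integrable_const (1 : ℝ)).sub (hi.const_mul s)
  have hle := integral_mono (integrable_exp_check_sub (ν := ν) h₀ h₁ (-s) w)
    (hi'.add (integrable_const (s ^ 2 * w ^ 2))) hpt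
  refine hle.trans (le_of_eq ?_)
  have he : ∫ e, (1 - s * (check τ (e - w) - check τ e) + s ^ 2 * w ^ 2) ∂ν =
      1 - s * ∫ e, (check τ (e - w) - check τ e) ∂ν + s ^ 2 * w ^ 2 := by
    rw [integral_add hi' (integrable_const _),
      integral_sub (integrable_const _) (hi.const_mul s), integral_const_mul]
    simp
  exact he

/-- An exponential moment bound with a quadratic gain, for bounded shifts. -/
lemma exists_integral_exp_le_exp (h : QuantileLaw ν τ η c) {R : ℝ} (hR : 0 < R) :
    ∃ s > 0, ∃ c' > 0, ∀ w, |w| ≤ R →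
      ∫ e, Real.exp (-s * (check τ (e - w) - check τ e)) ∂ν ≤ Real.exp (-c' * w ^ 2) := by
  obtain ⟨c', hc', hE⟩ := h.exists_sq_le_integral hR
  -- The bound `1 / R` keeps the exponent in the range of the quadratic expansion; `c' / 2` lets the
  -- remainder absorb only half of the linear gain.
  refine ⟨min (1 / R) (c' / 2), by positivity, min (1 / R) (c' / 2) * (c' / 2), by positivity,
    fun w hw => ?_⟩
  set s := min (1 / R) (c' / 2) with hs
  have hs0 : 0 < s := by positivity
  have hsw : s * |w| ≤ 1 := by
    calc s * |w| ≤ 1 / R * R := by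
          gcongr
          exact min_le_left _ _
      _ = 1 := by field_simp
  have hsc : s ≤ c' / 2 := min_le_right _ _
  refine (h.integral_exp_le hs0.le hsw).trans ?_
  have h₁ := mul_le_mul_of_nonneg_left (hE w hw) hs0.le
  have h₂ : s ^ 2 * w ^ 2 ≤ s * (c' / 2) * w ^ 2 := by
    rw [sq s]
    gcongr
  have h₃ := Real.add_one_le_exp (-(s * (c' / 2)) * w ^ 2)
  linarith

/-- An exponential moment bound in which the product of the exponent and of the bound for the
shifts is arbitrarily large. -/
lemma exists_integral_exp_le_one (h : QuantileLaw ν τ η c) {B : ℝ} (hB : 0 < B) (R₀ : ℝ) :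
    ∃ R, R₀ ≤ R ∧ 0 < R ∧ ∀ w, |w| ≤ R →
      ∫ e, Real.exp (-(B / R) * (check τ (e - w) - check τ e)) ∂ν ≤ 1 := by
  have h₀ := h.tau_pos.le
  have h₁ := h.tau_lt.le
  set a : ℝ := min τ (1 - τ) / 2 with ha
  have ha0 : 0 < a := by
    have := h.tau_pos
    have := sub_pos.2 h.tau_lt
    positivity
  have haτ : 2 * a ≤ τ := by rw [ha]; linarith [min_le_left τ (1 - τ)]
  have haτ' : 2 * a ≤ 1 - τ := by rw [ha]; linarith [min_le_right τ (1 - τ)]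
  have ha1 : a ≤ 1 := by linarith
  -- the tails of the law are small
  obtain ⟨N, hN⟩ : ∃ N : ℕ, ν.real {e : ℝ | (N : ℝ) < |e|} ≤ a / 2 * Real.exp (-(2 * B)) := by
    have ht : Tendsto (fun N : ℕ => ν.real {e : ℝ | (N : ℝ) < |e|}) atTop (𝓝 0) := by
      have hanti : Antitone fun N : ℕ => {e : ℝ | (N : ℝ) < |e|} := fun i j hij e he =>
        lt_of_le_of_lt (Nat.cast_le.2 hij : (i : ℝ) ≤ j) he
      have := tendsto_measure_iInter_atTop (μ := ν) (s := fun N : ℕ => {e : ℝ | (N : ℝ) < |e|})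
        (fun N => (measurableSet_lt measurable_const measurable_id.abs).nullMeasurableSet)
        hanti ⟨0, measure_ne_top _ _⟩
      have hempty : ⋂ N : ℕ, {e : ℝ | (N : ℝ) < |e|} = ∅ := by
        ext e
        simp only [Set.mem_iInter, Set.mem_ofPred_eq, Set.mem_empty_iff_false, iff_false, not_forall,
          not_lt]
        exact exists_nat_ge |e|
      rw [hempty, measure_empty] at this
      have h₂ := (ENNReal.tendsto_toReal ENNReal.zero_ne_top).comp this
      rw [ENNReal.toReal_zero] at h₂
      exact h₂
    obtain ⟨N, hN⟩ := (ht.eventually (ge_mem_nhds (show 0 < a / 2 * Real.exp (-(2 * B)) by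
      positivity))).exists
    exact ⟨N, hN⟩
  -- Beyond `w₁` the shift outweighs every error in `[-N, N]`: the check function grows at least
  -- with slope `2 * a`, so the excess loss is at least `a * |w|`.
  set w₁ : ℝ := 2 * N / a + 1 with hw₁
  have hw₁0 : 0 < w₁ := by positivity
  obtain ⟨c', hc', hE⟩ := h.exists_sq_le_integral hw₁0
  -- For the exponent `s = B / R` the last two bounds mean `s * w₁ ≤ 1` and `s ≤ c'`, which settles
  -- the shifts up to `w₁` by the quadratic gain.
  set R := max (max R₀ (B * w₁)) (B / c') with hR
  have hRR₀ : R₀ ≤ R := (le_max_left _ _).trans (le_max_left _ _)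
  have hRw : B * w₁ ≤ R := (le_max_right _ _).trans (le_max_left _ _)
  have hRc : B / c' ≤ R := le_max_right _ _
  have hR0 : 0 < R := lt_of_lt_of_le (by positivity) hRc
  refine ⟨R, hRR₀, hR0, fun w hw => ?_⟩
  set s := B / R with hs
  have hs0 : 0 < s := by positivity
  rcases le_total |w| w₁ with hww | hww
  · have hsw : s * |w| ≤ 1 := by
      calc s * |w| ≤ s * w₁ := by gcongr
        _ = B * w₁ / R := by rw [hs]; ring
        _ ≤ 1 := (div_le_one hR0).2 hRw
    have hsc : s ≤ c' := by
      rw [hs, div_le_iff₀ hR0]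
      rwa [div_le_iff₀ hc', mul_comm] at hRc
    refine (h.integral_exp_le hs0.le hsw).trans ?_
    have h₂ := mul_le_mul_of_nonneg_left (hE w hww) hs0.le
    have h₃ : s ^ 2 * w ^ 2 ≤ s * (c' * w ^ 2) := by
      rw [sq s, mul_assoc]
      gcongr
    linarith
  -- For large shifts the exponential is at most `exp (-(a * y))` for typical errors and at most
  -- `exp y` in the tail `T`. On `[0, B]` both have bounds linear in `y`, and the tail probability
  -- was chosen so that the gain cancels the loss.
  · set y := s * |w| with hy
    have hy0 : 0 ≤ y := by positivity
    have hyB : y ≤ B := by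
      calc y ≤ s * R := by rw [hy]; gcongr
        _ = B := by rw [hs]; field_simp
    set T := {e : ℝ | (N : ℝ) < |e|} with hT
    have hTm : MeasurableSet T := measurableSet_lt measurable_const measurable_id.abs
    have hpt : ∀ e, Real.exp (-s * (check τ (e - w) - check τ e)) ≤
        1 - a * y * Real.exp (-B) + (2 * y * Real.exp B) * T.indicator 1 e := by
      intro e
      by_cases he : e ∈ T
      · rw [Set.indicator_of_mem he, Pi.one_apply, mul_one]
        have hX := (abs_le.1 (abs_check_sub_check_le h₀ h₁ w e)).1
        have hb : -s * (check τ (e - w) - check τ e) ≤ y := by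
          have := mul_le_mul_of_nonneg_left hX hs0.le
          rw [hy]; linarith
        have h₂ : Real.exp y ≤ 1 + y * Real.exp B := by
          have h₃ := Real.add_one_le_exp (-y)
          have h₄ := mul_le_mul_of_nonneg_right h₃ (Real.exp_pos y).le
          rw [← Real.exp_add, neg_add_cancel, Real.exp_zero] at h₄
          have h₅ := mul_le_mul_of_nonneg_left (Real.exp_le_exp.2 hyB) hy0
          linarith
        have h₃ : a * y * Real.exp (-B) ≤ y * Real.exp B := by
          have h₄ : Real.exp (-B) ≤ Real.exp B := Real.exp_le_exp.2 (by linarith)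
          calc a * y * Real.exp (-B) ≤ 1 * y * Real.exp B := by gcongr
            _ = _ := by ring
        have := Real.exp_le_exp.2 hb
        linarith
      · rw [Set.indicator_of_notMem he, mul_zero, add_zero]
        have heN : |e| ≤ N := not_lt.1 he
        have hNw : 2 * (N : ℝ) ≤ a * |w| := by
          have : a * w₁ ≤ a * |w| := by gcongr
          rw [hw₁, mul_add, mul_div_cancel₀ _ ha0.ne'] at this
          linarith
        have hX : a * |w| ≤ check τ (e - w) - check τ e := by
          have hce : check τ e ≤ |e| := by
            have := check_sub_le h₀ h₁ e 0
            rw [show check τ 0 = 0 by simp [check], sub_zero, sub_zero] at this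
            exact this
          have hcw : 2 * a * (|w| - |e|) ≤ check τ (e - w) := by
            have h₂ : |w| - |e| ≤ |e - w| := by
              rw [abs_sub_comm]
              exact abs_sub_abs_le_abs_sub w e
            have h₃ : 2 * a * |e - w| ≤ check τ (e - w) := by
              rw [check_eq_max]
              rcases le_total 0 (e - w) with hew | hew
              · rw [abs_of_nonneg hew]
                exact le_max_of_le_left (by gcongr)
              · rw [abs_of_nonpos hew]
                exact le_max_of_le_right (by nlinarith)
            have h₄ := mul_le_mul_of_nonneg_left h₂ (show 0 ≤ 2 * a by positivity)
            linarith
          have h₂ : 2 * a * |e| ≤ |e| := by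
            have := mul_le_mul_of_nonneg_right (show 2 * a ≤ 1 by linarith) (abs_nonneg e)
            linarith
          linarith
        have hb : -s * (check τ (e - w) - check τ e) ≤ -(a * y) := by
          have := mul_le_mul_of_nonneg_left hX hs0.le
          rw [hy]; linarith
        refine (Real.exp_le_exp.2 hb).trans ?_
        have h₃ := Real.add_one_le_exp (a * y)
        have h₄ := mul_le_mul_of_nonneg_left h₃ (Real.exp_pos (-(a * y))).le
        rw [← Real.exp_add, neg_add_cancel, Real.exp_zero] at h₄
        have h₅ : Real.exp (-B) ≤ Real.exp (-(a * y)) := by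
          refine Real.exp_le_exp.2 (neg_le_neg ?_)
          calc a * y ≤ 1 * B := by gcongr
            _ = B := one_mul B
        have h₆ := mul_le_mul_of_nonneg_left h₅ (show 0 ≤ a * y by positivity)
        linarith
    have hi : Integrable (fun e => (2 * y * Real.exp B) * T.indicator (1 : ℝ → ℝ) e) ν :=
      ((integrable_const (1 : ℝ)).indicator hTm).const_mul _
    have hle := integral_mono (integrable_exp_check_sub (ν := ν) h₀ h₁ (-s) w)
      ((integrable_const (1 - a * y * Real.exp (-B))).add hi) hpt
    refine hle.trans ?_
    have he : ∫ e, (1 - a * y * Real.exp (-B) + (2 * y * Real.exp B) * T.indicator (1 : ℝ → ℝ) e) ∂ν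
        = 1 - a * y * Real.exp (-B) + (2 * y * Real.exp B) * ν.real T := by
      rw [integral_add (integrable_const _) hi, integral_const_mul, integral_indicator_one hTm]
      simp
    refine le_of_eq_of_le he ?_
    have h₂ : (2 * y * Real.exp B) * ν.real T ≤ a * y * Real.exp (-B) := by
      calc (2 * y * Real.exp B) * ν.real T
          ≤ (2 * y * Real.exp B) * (a / 2 * Real.exp (-(2 * B))) := by gcongr
        _ = a * y * (Real.exp B * Real.exp (-(2 * B))) := by ring
        _ = a * y * Real.exp (-B) := by rw [← Real.exp_add]; ring_nf
    linarith

end QuantileLaw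

end ErrorLaw

/-! ### The law of the errors, and a Chernoff bound for fixed shifts. -/

section ErrorAssumptions

variable {Ω : Type*} [MeasurableSpace Ω] {μ : Measure Ω} [IsProbabilityMeasure μ]
  {ε : ℕ → Ω → ℝ} {f : ℝ → ℝ} {τ : ℝ}

lemma ErrorAssumptions.isProbabilityMeasure (h : ErrorAssumptions μ ε f τ) :
    IsProbabilityMeasure (errorLaw f) := by
  rw [← h.law 0]
  exact Measure.isProbabilityMeasure_map (h.measurable 0).aemeasurable

lemma ErrorAssumptions.exists_quantileLaw (h : ErrorAssumptions μ ε f τ) (hτ₀ : 0 < τ)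
    (hτ₁ : τ < 1) : ∃ η c, QuantileLaw (errorLaw f) τ η c := by
  obtain ⟨η, hη, c, hc, hf⟩ := h.density_pos_near_zero
  have := h.isProbabilityMeasure
  have key : ∀ a b, -η ≤ a → b ≤ η → c * (b - a) ≤ (errorLaw f).real (Set.Ico a b) := by
    intro a b ha hb
    rcases le_total b a with hba | hab
    · exact (mul_nonpos_of_nonneg_of_nonpos hc.le (sub_nonpos.2 hba)).trans measureReal_nonneg
    have h₁ : ENNReal.ofReal (c * (b - a)) ≤ errorLaw f (Set.Ico a b) := by
      rw [errorLaw, withDensity_apply _ measurableSet_Ico, ENNReal.ofReal_mul hc.le,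
        ← Real.volume_Ico, ← setLIntegral_const]
      refine setLIntegral_mono' measurableSet_Ico fun u hu => ENNReal.ofReal_le_ofReal (hf u ?_)
      rw [abs_le]
      exact ⟨ha.trans hu.1, hu.2.le.trans hb⟩
    exact (ENNReal.ofReal_le_iff_le_toReal (measure_ne_top _ _)).1 h₁
  refine ⟨η, c, hτ₀, hτ₁, hη, hc, ?_, fun a ha haη => ?_, fun a ha haη => ?_⟩
  · have h₁ := h.quantile 0
    have h₂ : errorLaw f (Set.Iio 0) = ENNReal.ofReal τ := by
      rw [← h₁, ← h.law 0, Measure.map_apply (h.measurable 0) measurableSet_Iio]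
      rfl
    rw [Measure.real, h₂, ENNReal.toReal_ofReal hτ₀.le]
  · simpa using key 0 a (by linarith) haη
  · simpa using key (-a) 0 (by linarith) hη.le

/-- A lower tail bound for the excess loss on a fixed set of observations. -/
lemma ErrorAssumptions.measure_sum_check_le (h : ErrorAssumptions μ ε f τ) {s c R : ℝ}
    (hτ₀ : 0 ≤ τ) (hτ₁ : τ ≤ 1) (hs : 0 < s)
    (hmgf : ∀ w, |w| ≤ R →
      ∫ e, Real.exp (-s * (check τ (e - w) - check τ e)) ∂(errorLaw f) ≤ Real.exp (-c * w ^ 2))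
    (I : Finset ℕ) (w : ℕ → ℝ) (hw : ∀ i ∈ I, |w i| ≤ R) (a : ℝ) :
    μ.real {ω | ∑ i ∈ I, (check τ (ε i ω - w i) - check τ (ε i ω)) ≤
      c / s * ∑ i ∈ I, w i ^ 2 - a} ≤ Real.exp (-(s * a)) := by
  have := h.isProbabilityMeasure
  set X : ℕ → Ω → ℝ := fun i ω => check τ (ε i ω - w i) - check τ (ε i ω) with hX
  have hXm : ∀ i, Measurable (X i) := fun i =>
    (measurable_check_sub τ (w i)).comp (h.measurable i)
  have hind : iIndepFun X μ := h.indep.comp (fun i e => check τ (e - w i) - check τ e)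
    fun i => measurable_check_sub τ (w i)
  have hint : ∀ i, Integrable (fun ω => Real.exp (-s * X i ω)) μ := by
    intro i
    have h₁ := integrable_exp_check_sub (ν := errorLaw f) hτ₀ hτ₁ (-s) (w i)
    rw [← h.law i] at h₁
    exact h₁.comp_measurable (h.measurable i)
  have hmgfi : ∀ i ∈ I, mgf (X i) μ (-s) ≤ Real.exp (-c * w i ^ 2) := by
    intro i hi
    refine le_of_eq_of_le ?_ (hmgf (w i) (hw i hi))
    rw [mgf, ← h.law i, integral_map (h.measurable i).aemeasurable]
    exact (((measurable_check_sub τ (w i)).const_mul (-s)).exp).aestronglyMeasurable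
  have h₁ := measure_le_le_exp_mul_mgf (μ := μ) (X := ∑ i ∈ I, X i) (t := -s)
    (c / s * ∑ i ∈ I, w i ^ 2 - a) (by linarith)
    (hind.integrable_exp_mul_sum hXm fun i _ => hint i)
  rw [hind.mgf_sum hXm] at h₁
  have h₂ : ∏ i ∈ I, mgf (X i) μ (-s) ≤ Real.exp (-c * ∑ i ∈ I, w i ^ 2) := by
    rw [Finset.mul_sum, Real.exp_sum]
    exact Finset.prod_le_prod (fun i _ => mgf_nonneg) hmgfi
  have h₃ : {ω | ∑ i ∈ I, (check τ (ε i ω - w i) - check τ (ε i ω)) ≤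
      c / s * ∑ i ∈ I, w i ^ 2 - a} =
      {ω | (∑ i ∈ I, X i) ω ≤ c / s * ∑ i ∈ I, w i ^ 2 - a} := by
    ext ω
    simp [hX]
  rw [h₃]
  refine h₁.trans ((mul_le_mul_of_nonneg_left h₂ (Real.exp_pos _).le).trans (le_of_eq ?_))
  rw [← Real.exp_add]
  congr 1
  field_simp
  ring

end ErrorAssumptions

/-! ### A polynomially large grid in a ball. -/

section Grid

variable {p : ℕ}

/-- Rounding towards zero to a multiple of `1 / n`. -/
noncomputable def roundZ (n : ℕ) (a : ℝ) : ℤ := if 0 ≤ a then ⌊a * n⌋ else ⌈a * n⌉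

/-- Rounding towards zero, unlike rounding to the nearest multiple, never increases the absolute
value; this keeps the grid points inside the ball. -/
lemma roundZ_spec {n : ℕ} (hn : 0 < n) (a : ℝ) :
    |(roundZ n a : ℝ) / n| ≤ |a| ∧ |a - (roundZ n a : ℝ) / n| ≤ 1 / n := by
  have hn' : (0 : ℝ) < n := Nat.cast_pos.2 hn
  have h₂ : ∀ z : ℤ, a - (z : ℝ) / n = (a * n - z) / n := fun z => by field_simp
  unfold roundZ
  split_ifs with ha
  · have h₁ : (0 : ℝ) ≤ ⌊a * n⌋ := by exact_mod_cast Int.floor_nonneg.2 (by positivity)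
    have h₃ := Int.floor_le (a * n)
    have h₄ := Int.lt_floor_add_one (a * n)
    rw [h₂, abs_div, abs_div, abs_of_pos hn', abs_of_nonneg h₁, abs_of_nonneg ha]
    refine ⟨(div_le_iff₀ hn').2 h₃, div_le_div_of_nonneg_right ?_ hn'.le⟩
    rw [abs_le]
    constructor <;> linarith
  · push Not at ha
    have h₁ : ((⌈a * n⌉ : ℤ) : ℝ) ≤ 0 := by
      exact_mod_cast Int.ceil_le.2 (by push_cast; exact mul_nonpos_of_nonpos_of_nonneg ha.le hn'.le)
    have h₃ := Int.le_ceil (a * n)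
    have h₄ := Int.ceil_lt_add_one (a * n)
    rw [h₂, abs_div, abs_div, abs_of_pos hn', abs_of_nonpos h₁, abs_of_neg ha]
    refine ⟨(div_le_iff₀ hn').2 (by linarith), div_le_div_of_nonneg_right ?_ hn'.le⟩
    rw [abs_le]
    constructor <;> linarith

/-- The point of the grid of mesh `1 / n` with the integer coordinates `z`. -/
noncomputable def gridPoint (n : ℕ) (z : Fin p → ℤ) : Vec p := WithLp.toLp 2 fun j => (z j : ℝ) / n

lemma exists_gridPoint {n : ℕ} (hn : 0 < n) {R : ℝ} {u : Vec p} (hu : ‖u‖ ≤ R) :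
    ∃ z : Fin p → ℤ, (∀ j, |z j| ≤ ⌈R * n⌉) ∧ ‖gridPoint n z‖ ≤ R ∧ ‖u - gridPoint n z‖ ≤ p / n := by
  have hn' : (0 : ℝ) < n := Nat.cast_pos.2 hn
  refine ⟨fun j => roundZ n (u j), fun j => ?_, ?_, ?_⟩
  · have h₁ := (roundZ_spec hn (u j)).1
    have h₂ : |u j| ≤ ‖u‖ := PiLp.norm_apply_le u j
    rw [abs_div, abs_of_pos hn', div_le_iff₀ hn'] at h₁
    have h₃ : |(roundZ n (u j) : ℝ)| ≤ R * n := by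
      refine h₁.trans ?_
      gcongr
      exact h₂.trans hu
    have h₄ : ((|roundZ n (u j)| : ℤ) : ℝ) ≤ ⌈R * n⌉ := by
      push_cast
      exact h₃.trans (Int.le_ceil _)
    exact_mod_cast h₄
  · refine le_trans ?_ hu
    refine le_of_sq_le_sq ?_ (norm_nonneg _)
    rw [EuclideanSpace.real_norm_sq_eq, EuclideanSpace.real_norm_sq_eq]
    exact Finset.sum_le_sum fun j _ => sq_le_sq.2 (roundZ_spec hn (u j)).1
  · refine le_of_sq_le_sq ?_ (by positivity)
    rw [EuclideanSpace.real_norm_sq_eq]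
    have h₁ : ∑ j, (u - gridPoint n fun j => roundZ n (u j)) j ^ 2 ≤ ∑ _j : Fin p, (1 / (n : ℝ)) ^ 2 :=
      Finset.sum_le_sum fun j _ => by
        rw [← sq_abs]
        exact pow_le_pow_left₀ (abs_nonneg _) (roundZ_spec hn (u j)).2 2
    refine h₁.trans ?_
    rw [Finset.sum_const, Finset.card_univ, Fintype.card_fin, nsmul_eq_mul, div_pow, div_pow,
      one_pow, ← mul_div_assoc, mul_one]
    gcongr
    rw [sq]
    exact_mod_cast Nat.le_mul_self p

end Grid

/-! ### Quadratic growth of the loss, uniformly over intervals and shifts. -/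

section Uniform

variable {p : ℕ} {Ω : Type*} [MeasurableSpace Ω] {μ : Measure Ω} [IsProbabilityMeasure μ]
  {ε : ℕ → Ω → ℝ} {f : ℝ → ℝ} {τ : ℝ}

/-- The excess loss has the quadratic growth `c`, up to `A`, uniformly over all intervals of
observations and all shifts of norm at most `R`. -/
def UniformLower (τ : ℝ) (n : ℕ) (x : ℕ → Vec p) (e : ℕ → ℝ) (R c A : ℝ) : Prop :=
  ∀ a b : ℕ, 1 ≤ a → b ≤ n + 1 → ∀ u : Vec p, ‖u‖ ≤ R →
    c * ∑ i ∈ Finset.Ico a b, (inner ℝ (x i) u) ^ 2 - A ≤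
      ∑ i ∈ Finset.Ico a b, (check τ (e i - inner ℝ (x i) u) - check τ (e i))

/-- Moving `u` to a grid point changes each inner product by at most `p / n`. Over at most `n`
observations the losses change by at most `p` in total and the squares by at most `2 * R * p`. -/
lemma uniformLower_of_grid {n : ℕ} (hn : 0 < n) {x : ℕ → Vec p}
    (hx : ∀ i ∈ Finset.Icc 1 n, ‖x i‖ ≤ 1) {e : ℕ → ℝ} {R c A : ℝ} (hR : 0 ≤ R) (hc : 0 ≤ c)
    (hτ₀ : 0 ≤ τ) (hτ₁ : τ ≤ 1)
    (h : ∀ a b : ℕ, 1 ≤ a → b ≤ n + 1 → ∀ z : Fin p → ℤ, (∀ j, |z j| ≤ ⌈R * n⌉) →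
      ‖gridPoint n z‖ ≤ R →
      c * ∑ i ∈ Finset.Ico a b, (inner ℝ (x i) (gridPoint n z)) ^ 2 - A ≤
      ∑ i ∈ Finset.Ico a b, (check τ (e i - inner ℝ (x i) (gridPoint n z)) - check τ (e i))) :
    UniformLower τ n x e R c (A + p + c * (2 * R * p)) := by
  intro a b ha hb u hu
  have hn' : (0 : ℝ) < n := Nat.cast_pos.2 hn
  obtain ⟨z, hz, hzR, hzu⟩ := exists_gridPoint hn hu
  have h₁ := h a b ha hb z hz hzR
  set v := gridPoint n z with hv
  have hmem : ∀ i ∈ Finset.Ico a b, i ∈ Finset.Icc 1 n := fun i hi => by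
    rw [Finset.mem_Ico] at hi; rw [Finset.mem_Icc]; omega
  have hinner : ∀ i ∈ Finset.Ico a b, ∀ y : Vec p, |inner ℝ (x i) y| ≤ ‖y‖ := fun i hi y =>
    (abs_real_inner_le_norm _ _).trans (mul_le_of_le_one_left (norm_nonneg _) (hx i (hmem i hi)))
  have hcard : ((Finset.Ico a b).card : ℝ) ≤ n := by
    rw [Nat.card_Ico]
    exact_mod_cast (by omega : b - a ≤ n)
  have hsum : ∀ (g : ℕ → ℝ) (C : ℝ), 0 ≤ C → (∀ i ∈ Finset.Ico a b, g i ≤ C / n) →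
      ∑ i ∈ Finset.Ico a b, g i ≤ C := by
    intro g C hC hg
    refine (Finset.sum_le_card_nsmul _ _ _ hg).trans ?_
    rw [nsmul_eq_mul]
    calc ((Finset.Ico a b).card : ℝ) * (C / n) ≤ n * (C / n) := by gcongr
      _ = C := by field_simp
  have h₂ : ∑ i ∈ Finset.Ico a b, ((inner ℝ (x i) u) ^ 2 - (inner ℝ (x i) v) ^ 2 : ℝ) ≤
      2 * R * p := by
    refine hsum _ _ (by positivity) fun i hi => ?_
    have h₃ : (inner ℝ (x i) u) ^ 2 - (inner ℝ (x i) v) ^ 2 =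
        (inner ℝ (x i) (u - v) * inner ℝ (x i) (u + v) : ℝ) := by
      rw [inner_sub_right, inner_add_right]; ring
    rw [h₃]
    refine (le_abs_self _).trans ?_
    rw [abs_mul]
    have h₄ : |inner ℝ (x i) (u + v)| ≤ 2 * R :=
      (hinner i hi _).trans ((norm_add_le _ _).trans (by linarith))
    calc |inner ℝ (x i) (u - v)| * |inner ℝ (x i) (u + v)| ≤ (p / n) * (2 * R) := by
          gcongr
          exact (hinner i hi _).trans hzu
      _ = 2 * R * p / n := by ring
  have h₃ : ∑ i ∈ Finset.Ico a b, ((check τ (e i - inner ℝ (x i) v) - check τ (e i)) -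
      (check τ (e i - inner ℝ (x i) u) - check τ (e i))) ≤ p := by
    refine hsum _ _ (by positivity) fun i hi => ?_
    have h₄ := check_sub_le hτ₀ hτ₁ (e i - inner ℝ (x i) v) (e i - inner ℝ (x i) u)
    have h₅ : e i - inner ℝ (x i) v - (e i - inner ℝ (x i) u) = inner ℝ (x i) (u - v) := by
      rw [inner_sub_right]; ring
    rw [h₅] at h₄
    have := (hinner i hi (u - v)).trans hzu
    linarith
  rw [Finset.sum_sub_distrib] at h₂ h₃
  have h₄ := mul_le_mul_of_nonneg_left h₂ hc
  linarith

/-- A union bound: a pair of interval ends and a grid point fails with probability at most `n ^ -(p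
+ 4)`, and there are `O(n ^ (p + 2))` such triples. -/
lemma ErrorAssumptions.whp_uniformLower (h : ErrorAssumptions μ ε f τ) {s c R : ℝ}
    (hτ₀ : 0 ≤ τ) (hτ₁ : τ ≤ 1) (hs : 0 < s) (hc : 0 ≤ c) (hR : 0 ≤ R)
    (hmgf : ∀ w, |w| ≤ R →
      ∫ e, Real.exp (-s * (check τ (e - w) - check τ e)) ∂(errorLaw f) ≤ Real.exp (-c * w ^ 2))
    (x : ℕ → ℕ → Vec p) (hx : ∀ n, ∀ i ∈ Finset.Icc 1 n, ‖x n i‖ ≤ 1) :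
    Whp μ (fun n ω => UniformLower τ n (x n) (fun i => ε i ω) R (c / s)
      ((p + 5) / s * Real.log n)) := by
  classical
  set N : ℕ → ℤ := fun n => ⌈R * n⌉ with hN
  set Z : ℕ → Finset (Fin p → ℤ) := fun n => Fintype.piFinset fun _ => Finset.Icc (-N n) (N n)
    with hZ
  set S : ℕ → Finset (ℕ × ℕ × (Fin p → ℤ)) := fun n =>
    (Finset.Icc 1 (n + 1) ×ˢ Finset.range (n + 2) ×ˢ Z n).filter
      (fun q => ‖gridPoint n q.2.2‖ ≤ R) with hS
  set bad : ℕ → ℕ × ℕ × (Fin p → ℤ) → Set Ω := fun n q =>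
    {ω | ∑ i ∈ Finset.Ico q.1 q.2.1, (check τ (ε i ω - inner ℝ (x n i) (gridPoint n q.2.2)) -
      check τ (ε i ω)) ≤ c / s * ∑ i ∈ Finset.Ico q.1 q.2.1,
        (inner ℝ (x n i) (gridPoint n q.2.2)) ^ 2 - (p + 4) / s * Real.log n} with hbad
  have hprob : ∀ n : ℕ, 0 < n → ∀ q ∈ S n, μ.real (bad n q) ≤ (1 / (n : ℝ)) ^ (p + 4) := by
    intro n hn q hq
    simp only [hS, Finset.mem_filter, Finset.mem_product, Finset.mem_Icc, Finset.mem_range] at hq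
    refine (h.measure_sum_check_le hτ₀ hτ₁ hs hmgf (Finset.Ico q.1 q.2.1)
      (fun i => inner ℝ (x n i) (gridPoint n q.2.2)) (fun i hi => ?_) _).trans (le_of_eq ?_)
    · rw [Finset.mem_Ico] at hi
      exact (abs_real_inner_le_norm _ _).trans ((mul_le_of_le_one_left (norm_nonneg _)
        (hx n i (Finset.mem_Icc.2 (by omega)))).trans hq.2)
    · have hn' : (0 : ℝ) < n := Nat.cast_pos.2 hn
      have h₁ : -(s * ((p + 4) / s * Real.log n)) = ((p + 4 : ℕ) : ℝ) * (-Real.log n) := by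
        push_cast
        field_simp
      rw [h₁, Real.exp_nat_mul, Real.exp_neg, Real.exp_log hn', one_div]
  have hcard : ∀ n : ℕ, 0 < n → ((S n).card : ℝ) ≤ 6 * (2 * R + 3) ^ p * (n : ℝ) ^ (p + 2) := by
    intro n hn
    have hn1 : (1 : ℝ) ≤ n := by exact_mod_cast hn
    have hZc : ((Z n).card : ℝ) ≤ ((2 * R + 3) * n) ^ p := by
      rw [hZ, Fintype.card_piFinset, Finset.prod_const, Finset.card_univ, Fintype.card_fin]
      push_cast
      gcongr
      have hN0 : 0 ≤ N n := Int.ceil_nonneg (by positivity)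
      rw [Int.card_Icc]
      have h₁ : ((N n + 1 - -N n).toNat : ℝ) = 2 * (N n : ℝ) + 1 := by
        have : ((N n + 1 - -N n).toNat : ℤ) = 2 * N n + 1 := by omega
        exact_mod_cast this
      rw [h₁]
      have h₂ : (N n : ℝ) < R * n + 1 := Int.ceil_lt_add_one _
      nlinarith
    have h₁ : (S n).card ≤ (n + 1) * ((n + 2) * (Z n).card) := by
      refine (Finset.card_filter_le _ _).trans (le_of_eq ?_)
      rw [Finset.card_product, Finset.card_product, Nat.card_Icc, Finset.card_range]
      simp
    calc ((S n).card : ℝ) ≤ ((n + 1) * ((n + 2) * (Z n).card) : ℕ) := by exact_mod_cast h₁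
      _ ≤ (2 * n) * ((3 * n) * ((2 * R + 3) * n) ^ p) := by
          push_cast
          gcongr <;> linarith
      _ = _ := by rw [mul_pow]; ring
  have hlim : Tendsto (fun n : ℕ => μ (⋃ q ∈ S n, bad n q)) atTop (𝓝 0) := by
    have h₁ : Tendsto (fun n : ℕ => ENNReal.ofReal (6 * (2 * R + 3) ^ p * (1 / (n : ℝ)))) atTop
        (𝓝 0) := by
      have := (tendsto_one_div_atTop_nhds_zero_nat (𝕜 := ℝ)).const_mul (6 * (2 * R + 3) ^ p)
      rw [mul_zero] at this
      simpa using ENNReal.tendsto_ofReal this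
    refine tendsto_of_tendsto_of_tendsto_of_le_of_le' tendsto_const_nhds h₁
      (Eventually.of_forall fun _ => zero_le) ?_
    filter_upwards [eventually_gt_atTop 0] with n hn
    have hn1 : (1 : ℝ) ≤ n := by exact_mod_cast hn
    have hn' : (0 : ℝ) < n := Nat.cast_pos.2 hn
    have h₂ : μ.real (⋃ q ∈ S n, bad n q) ≤ 6 * (2 * R + 3) ^ p * (1 / (n : ℝ)) := by
      refine (measureReal_biUnion_finset_le _ _).trans ?_
      refine (Finset.sum_le_card_nsmul _ _ _ (hprob n hn)).trans ?_
      rw [nsmul_eq_mul]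
      calc ((S n).card : ℝ) * (1 / (n : ℝ)) ^ (p + 4)
          ≤ (6 * (2 * R + 3) ^ p * (n : ℝ) ^ (p + 2)) * (1 / (n : ℝ)) ^ (p + 4) := by
            gcongr
            exact hcard n hn
        _ = 6 * (2 * R + 3) ^ p * (1 / (n : ℝ)) ^ 2 := by
            have h₃ : (n : ℝ) ^ (p + 2) * (1 / (n : ℝ)) ^ (p + 2) = 1 := by
              rw [← mul_pow, mul_one_div_cancel hn'.ne', one_pow]
            rw [show p + 4 = (p + 2) + 2 by ring, pow_add _ (p + 2) 2]
            linear_combination 6 * (2 * R + 3) ^ p * (1 / (n : ℝ)) ^ 2 * h₃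
        _ ≤ 6 * (2 * R + 3) ^ p * (1 / (n : ℝ)) := by
            gcongr
            rw [sq]
            exact mul_le_of_le_one_left (by positivity) ((div_le_one hn').2 hn1)
    rw [← ofReal_measureReal (measure_ne_top _ _)]
    exact ENNReal.ofReal_le_ofReal h₂
  have hgood : Whp μ (fun n ω => ω ∉ ⋃ q ∈ S n, bad n q) := by
    simp only [Whp, not_not]
    exact hlim
  -- The step from `p + 4` to `p + 5` in the constant leaves one extra `log n / s`, which absorbs
  -- the constant discretization error.
  have hlog : ∀ᶠ n : ℕ in atTop, (p + c / s * (2 * R * p)) * s ≤ Real.log n :=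
    (Real.tendsto_log_atTop.comp tendsto_natCast_atTop_atTop).eventually_ge_atTop _
  refine hgood.mono ?_
  filter_upwards [hlog, eventually_gt_atTop 0] with n hnlog hn ω hω
  simp only [Set.mem_iUnion, not_exists, hbad, Set.mem_ofPred_eq, not_le] at hω
  have h₁ := uniformLower_of_grid (τ := τ) (e := fun i => ε i ω) (A := (p + 4) / s * Real.log n)
    hn (hx n) hR (div_nonneg hc hs.le) hτ₀ hτ₁ (fun a b ha hb z hz hzR => by
      by_cases hab : a ≤ n + 1
      · refine (hω (a, b, z) ?_).le
        simp only [hS, hZ, Finset.mem_filter, Finset.mem_product, Finset.mem_Icc, Finset.mem_range,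
          Fintype.mem_piFinset]
        exact ⟨⟨⟨ha, hab⟩, by omega, fun j => abs_le.1 (hz j)⟩, hzR⟩
      · rw [Finset.Ico_eq_empty (by omega)]
        have : 0 ≤ Real.log n := Real.log_natCast_nonneg n
        simp only [Finset.sum_empty, mul_zero, zero_sub, Left.neg_nonpos_iff]
        positivity)
  intro a b ha hb u hu
  refine le_trans ?_ (h₁ a b ha hb u hu)
  have h₂ : (p + c / s * (2 * R * p)) ≤ 1 / s * Real.log n := by
    rw [one_div, inv_mul_eq_div, le_div_iff₀ hs]
    exact hnlog
  have h₃ : (p + 5) / s * Real.log n = (p + 4) / s * Real.log n + 1 / s * Real.log n := by ring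
  linarith

end Uniform

/-! ### Blocks of very negative errors. -/

section Blocks

variable {Ω : Type*} [MeasurableSpace Ω] {μ : Measure Ω} [IsProbabilityMeasure μ]
  {ε : ℕ → Ω → ℝ} {f : ℝ → ℝ} {τ : ℝ}

/-- The probability that none of `N` consecutive blocks of length `m` consists of values in `S`. -/
lemma measure_iInter_compl_block {ε : ℕ → Ω → ℝ} (hm : ∀ i, Measurable (ε i)) (hi : iIndepFun ε μ)
    {S : Set ℝ} (hS : MeasurableSet S) {q : ℝ≥0∞} (hq : ∀ i, μ (ε i ⁻¹' S) = q) (lo m N : ℕ) :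
    μ (⋂ l ∈ Finset.range N, (⋂ i ∈ Finset.Ico (lo + l * m) (lo + (l + 1) * m), ε i ⁻¹' S)ᶜ) =
      (1 - q ^ m) ^ N := by
  have hmS : ∀ i, MeasurableSet (ε i ⁻¹' S) := fun i => hm i hS
  have hblock : ∀ l, μ (⋂ i ∈ Finset.Ico (lo + l * m) (lo + (l + 1) * m), ε i ⁻¹' S) = q ^ m := by
    intro l
    rw [hi.meas_biInter fun i _ => ⟨S, hS, rfl⟩, Finset.prod_congr rfl fun i _ => hq i,
      Finset.prod_const, Nat.card_Ico]
    congr 1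
    rw [add_mul, one_mul]
    omega
  induction N with
  | zero => simp
  | succ N ih =>
    rw [Finset.range_add_one, Finset.set_biInter_insert, pow_succ', Set.inter_comm]
    -- The earlier blocks depend only on the errors before `lo + N * m`, the new block only on those
    -- from there on.
    have hind := indep_iSup_of_disjoint (fun i => (hm i).comap_le) hi.iIndep
      (S := Set.Iio (lo + N * m)) (T := Set.Ici (lo + N * m))
      (Set.disjoint_left.2 fun i h₁ h₂ => absurd (Set.mem_Ici.1 h₂) (not_le.2 h₁))
    have hmeas : ∀ (U : Set ℕ) (l : ℕ), (∀ i ∈ Finset.Ico (lo + l * m) (lo + (l + 1) * m), i ∈ U) →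
        MeasurableSet[⨆ i ∈ U, MeasurableSpace.comap (ε i) inferInstance]
          (⋂ i ∈ Finset.Ico (lo + l * m) (lo + (l + 1) * m), ε i ⁻¹' S)ᶜ := by
      intro U l hU
      refine MeasurableSet.compl (Finset.measurableSet_biInter _ fun i hiI => ?_)
      exact le_iSup₂ (f := fun i (_ : i ∈ U) => MeasurableSpace.comap (ε i) inferInstance) i
        (hU i hiI) _ ⟨S, hS, rfl⟩
    rw [(Indep_iff _ _ _).1 hind _ _ (Finset.measurableSet_biInter _ fun l hl =>
      hmeas _ l fun i hiI => ?_) (hmeas _ N fun i hiI => ?_), ih, prob_compl_eq_one_sub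
        (Finset.measurableSet_biInter _ fun i _ => hmS i), hblock, mul_comm]
    · rw [Finset.mem_range] at hl
      rw [Finset.mem_Ico] at hiI
      have : (l + 1) * m ≤ N * m := Nat.mul_le_mul_right m hl
      exact Set.mem_Iio.2 (by omega)
    · exact Set.mem_Ici.2 (Finset.mem_Ico.1 hiI).1

/-- Long intervals contain blocks of logarithmic length on which all the errors are at most
`-1`. -/
lemma ErrorAssumptions.exists_whp_block (h : ErrorAssumptions μ ε f τ) :
    ∃ c > 0, ∀ (D : ℝ) (lo len m : ℕ → ℕ), 0 < D → (∀ n, 0 < m n) →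
      (∀ᶠ n : ℕ in atTop, (n : ℝ) / D ≤ len n) →
      Whp μ (fun n ω => (m n : ℝ) ≤ c * Real.log n → ∃ a, lo n ≤ a ∧ a + m n ≤ lo n + len n ∧
        ∀ i ∈ Finset.Ico a (a + m n), ε i ω ≤ -1) := by
  have := h.isProbabilityMeasure
  set q := errorCdf f (-1) with hq
  have hq0 : 0 < q := h.cdf_pos (-1)
  have hq1 : q ≤ 1 := measureReal_le_one
  have hlogq : 0 ≤ -Real.log q := neg_nonneg.2 (Real.log_nonpos hq0.le hq1)
  have hqi : ∀ i, μ (ε i ⁻¹' Set.Iic (-1)) = ENNReal.ofReal q := by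
    intro i
    rw [← Measure.map_apply (h.measurable i) measurableSet_Iic, h.law i, hq, errorCdf,
      ofReal_measureReal (measure_ne_top _ _)]
  -- This constant makes a block succeed with probability `q ^ m ≥ n ^ (-1/2)`. The `+ 2` keeps the
  -- denominator positive when `q = 1` and the constant at most one.
  refine ⟨1 / (2 * -Real.log q + 2), by positivity, fun D lo len m hD hm hlen => ?_⟩
  set c := 1 / (2 * -Real.log q + 2) with hc
  have hc1 : c ≤ 1 := by
    rw [hc, div_le_one (by positivity)]
    linarith
  have hlim : Tendsto (fun n : ℕ => ENNReal.ofReal (Real.exp (-(n : ℝ) ^ (1 / 4 : ℝ)))) atTop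
      (𝓝 0) := by
    have h₁ : Tendsto (fun n : ℕ => Real.exp (-(n : ℝ) ^ (1 / 4 : ℝ))) atTop (𝓝 0) :=
      Real.tendsto_exp_neg_atTop_nhds_zero.comp
        ((tendsto_rpow_atTop (by norm_num)).comp tendsto_natCast_atTop_atTop)
    simpa using ENNReal.tendsto_ofReal h₁
  refine tendsto_of_tendsto_of_tendsto_of_le_of_le' tendsto_const_nhds hlim
    (Eventually.of_forall fun _ => zero_le) ?_
  have hlog : ∀ᶠ n : ℕ in atTop, Real.log n ≤ 1 / (2 * D) * (n : ℝ) ^ (1 / 4 : ℝ) := by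
    have h₁ := (isLittleO_log_rpow_atTop (show (0 : ℝ) < 1 / 4 by norm_num)).bound
      (show 0 < 1 / (2 * D) by positivity)
    filter_upwards [tendsto_natCast_atTop_atTop.eventually h₁, eventually_ge_atTop 1] with n hn hn1
    rw [Real.norm_of_nonneg (Real.log_natCast_nonneg n), Real.norm_of_nonneg (by positivity)] at hn
    exact hn
  filter_upwards [hlen, hlog, eventually_ge_atTop 1] with n hlen hlog hn1
  by_cases hmn : (m n : ℝ) ≤ c * Real.log n
  swap
  · simp [hmn]
  have hn : (1 : ℝ) ≤ n := by exact_mod_cast hn1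
  have hn0 : (0 : ℝ) < n := by linarith
  have hm0 : (0 : ℝ) < m n := Nat.cast_pos.2 (hm n)
  set N := len n / m n with hN
  -- There are at least `y ^ 3` disjoint blocks, each succeeding with probability at least `1 / y ^
  -- 2`, so all fail with probability at most `exp (-y)`.
  set y : ℝ := (n : ℝ) ^ (1 / 4 : ℝ) with hy
  have hy1 : 1 ≤ y := Real.one_le_rpow hn (by norm_num)
  have hy4 : y ^ 4 = n := by
    rw [hy, ← Real.rpow_natCast, ← Real.rpow_mul hn0.le]
    norm_num
  have hlog0 : 0 ≤ Real.log n := Real.log_natCast_nonneg n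
  have hmy : (m n : ℝ) ≤ 1 / (2 * D) * y :=
    (hmn.trans (mul_le_of_le_one_left hlog0 hc1)).trans hlog
  have hNy : y ^ 3 ≤ N := by
    have h₁ : (len n : ℝ) < (N + 1) * m n := by
      exact_mod_cast Nat.lt_of_lt_of_eq (Nat.lt_mul_div_succ (len n) (hm n)) (mul_comm _ _)
    have h₂ : 2 * y ^ 3 * m n ≤ len n := by
      calc 2 * y ^ 3 * m n ≤ 2 * y ^ 3 * (1 / (2 * D) * y) := by gcongr
        _ = y ^ 4 / D := by field_simp
        _ ≤ len n := by rw [hy4]; exact hlen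
    have h₃ : 2 * y ^ 3 < N + 1 := lt_of_mul_lt_mul_right (h₂.trans_lt h₁) hm0.le
    have h₄ : 1 ≤ y ^ 3 := one_le_pow₀ hy1
    linarith
  have hqm : 1 / y ^ 2 ≤ q ^ m n := by
    have h₁ : (m n : ℝ) * -Real.log q ≤ 1 / 2 * Real.log n := by
      calc (m n : ℝ) * -Real.log q ≤ c * Real.log n * -Real.log q := by gcongr
        _ = (-Real.log q / (2 * -Real.log q + 2)) * Real.log n := by rw [hc]; ring
        _ ≤ 1 / 2 * Real.log n := by
          refine mul_le_mul_of_nonneg_right ?_ hlog0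
          rw [div_le_div_iff₀ (by positivity) (by norm_num)]
          linarith
    have h₂ : Real.log y = 1 / 4 * Real.log n := by rw [hy, Real.log_rpow hn0]
    have h₃ : q ^ m n = Real.exp (m n * Real.log q) := by
      rw [Real.exp_nat_mul, Real.exp_log hq0]
    have h₄ : 1 / y ^ 2 = Real.exp (-(2 * Real.log y)) := by
      rw [Real.exp_neg, one_div, show (2 : ℝ) * Real.log y = ((2 : ℕ) : ℝ) * Real.log y by norm_num,
        Real.exp_nat_mul, Real.exp_log (by linarith)]
    rw [h₃, h₄, Real.exp_le_exp]
    linarith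
  have hsub : {ω | ¬((m n : ℝ) ≤ c * Real.log n → ∃ a, lo n ≤ a ∧ a + m n ≤ lo n + len n ∧
      ∀ i ∈ Finset.Ico a (a + m n), ε i ω ≤ -1)} ⊆
      ⋂ l ∈ Finset.range N, (⋂ i ∈ Finset.Ico (lo n + l * m n) (lo n + (l + 1) * m n),
        ε i ⁻¹' Set.Iic (-1))ᶜ := by
    intro ω hω
    simp only [Set.mem_iInter, Set.mem_compl_iff]
    intro l hl hall
    refine hω fun _ => ⟨lo n + l * m n, by omega, ?_, fun i hi => ?_⟩
    · rw [Finset.mem_range] at hl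
      have h₁ : (l + 1) * m n ≤ N * m n := Nat.mul_le_mul_right _ hl
      have h₂ : N * m n ≤ len n := Nat.div_mul_le_self _ _
      rw [add_mul, one_mul] at h₁
      omega
    · refine hall i ?_
      rwa [add_mul, one_mul, ← add_assoc]
  refine (measure_mono hsub).trans ?_
  rw [measure_iInter_compl_block h.measurable h.indep measurableSet_Iic hqi,
    ← ENNReal.ofReal_pow hq0.le, ← ENNReal.ofReal_one, ← ENNReal.ofReal_sub _ (by positivity),
    ← ENNReal.ofReal_pow (sub_nonneg.2 (pow_le_one₀ hq0.le hq1))]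
  refine ENNReal.ofReal_le_ofReal ?_
  calc (1 - q ^ m n) ^ N ≤ (Real.exp (-(1 / y ^ 2))) ^ N := by
        refine pow_le_pow_left₀ (sub_nonneg.2 (pow_le_one₀ hq0.le hq1)) ?_ N
        have := Real.add_one_le_exp (-(1 / y ^ 2))
        linarith
    _ = Real.exp (-(N * (1 / y ^ 2))) := by rw [← Real.exp_nat_mul]; ring_nf
    _ ≤ Real.exp (-y) := by
        refine Real.exp_le_exp.2 (neg_le_neg ?_)
        calc y = y ^ 3 * (1 / y ^ 2) := by field_simp
          _ ≤ N * (1 / y ^ 2) := by gcongr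

end Blocks

/-! ### The rate assumptions in eventual form. -/

section Asymptotics

variable {p : ℕ} [NeZero p] {m : Model p} {f : ℝ → ℝ} {τ : ℝ} {δ lam : ℕ → ℝ}

namespace ModelAssumptions

lemma eventually_log_le (hm : ModelAssumptions m f τ δ lam) {θ : ℝ} (hθ : 0 < θ) :
    ∀ᶠ n : ℕ in atTop, Real.log n ≤ θ * (n * δ n) := by
  have hlog : ∀ᶠ n : ℕ in atTop, 1 ≤ Real.log n :=
    (Real.tendsto_log_atTop.comp tendsto_natCast_atTop_atTop).eventually_ge_atTop _
  filter_upwards [hm.delta_log.eventually_ge_atTop (1 / θ), hlog] with n h₁ h₂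
  rw [inv_mul_eq_div, div_le_div_iff₀ hθ (by linarith)] at h₁
  linarith

lemma eventually_const_le (hm : ModelAssumptions m f τ δ lam) (M : ℝ) {θ : ℝ} (hθ : 0 < θ) :
    ∀ᶠ n : ℕ in atTop, M ≤ θ * (n * δ n) := by
  have hlog : ∀ᶠ n : ℕ in atTop, M ≤ Real.log n :=
    (Real.tendsto_log_atTop.comp tendsto_natCast_atTop_atTop).eventually_ge_atTop _
  filter_upwards [hm.eventually_log_le hθ, hlog] with n h₁ h₂
  exact h₂.trans h₁

lemma eventually_lam_le (hm : ModelAssumptions m f τ δ lam) {θ : ℝ} (hθ : 0 < θ) :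
    ∀ᶠ n : ℕ in atTop, n * lam n ≤ θ * (n * δ n) := by
  filter_upwards [hm.lam_delta.eventually_le_const hθ] with n h₁
  rw [div_le_iff₀ (hm.delta_pos n)] at h₁
  have := mul_le_mul_of_nonneg_left h₁ (Nat.cast_nonneg (α := ℝ) n)
  linarith

lemma eventually_delta_le (hm : ModelAssumptions m f τ δ lam) {θ : ℝ} (hθ : 0 < θ) :
    ∀ᶠ n : ℕ in atTop, n * δ n ≤ θ * n := by
  filter_upwards [hm.delta_tendsto.eventually_le_const hθ] with n h₁
  have := mul_le_mul_of_nonneg_left h₁ (Nat.cast_nonneg (α := ℝ) n)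
  linarith

lemma exists_mul_norm_sq_le (hm : ModelAssumptions m f τ δ lam) :
    ∃ m₀ > 0, ∀ᶠ n : ℕ in atTop, ∀ n₁ n₂ : ℕ, 1 ≤ n₁ → n₂ ≤ n →
      n * δ n ≤ (n₂ : ℝ) - n₁ → ∀ u : Vec p,
      m₀ * ((n₂ : ℝ) - n₁) * ‖u‖ ^ 2 ≤ ∑ i ∈ Finset.Ico n₁ n₂, (inner ℝ (m.x n i) u) ^ 2 := by
  obtain ⟨m₀, M₀, hm₀, -, h⟩ := hm.design_eigenvalues
  refine ⟨m₀, hm₀, ?_⟩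
  filter_upwards [h, eventually_gt_atTop 0] with n h hn n₁ n₂ h₁ h₂ h₁₂ u
  have hlt : n₁ < n₂ := by
    have h₃ : (0 : ℝ) < n * δ n := mul_pos (Nat.cast_pos.2 hn) (hm.delta_pos n)
    have h₄ : (n₁ : ℝ) < n₂ := by linarith
    exact_mod_cast h₄
  exact m.mul_norm_sq_le_of_spectrum hlt (h n₁ n₂ h₁ hlt h₂ h₁₂) u

lemma norm_x_le (hm : ModelAssumptions m f τ δ lam) (n : ℕ) {i : ℕ} (hi : i ∈ Finset.Icc 1 n) :
    ‖m.x n i‖ ≤ 1 := by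
  obtain ⟨c₁, -, h₁, h⟩ := hm.design_bounded
  exact (h n i hi).trans h₁.le

lemma abs_inner_le (hm : ModelAssumptions m f τ δ lam) (n : ℕ) {i : ℕ} (hi : i ∈ Finset.Icc 1 n)
    (u : Vec p) : |inner ℝ (m.x n i) u| ≤ ‖u‖ :=
  (abs_real_inner_le_norm _ _).trans (mul_le_of_le_one_left (norm_nonneg _) (hm.norm_x_le n hi))

end ModelAssumptions

end Asymptotics

/-! ### Residuals, counting and telescoping. -/

section General

variable {p : ℕ} {Ω : Type*}

lemma Model.response_sub (m : Model p) (ε : ℕ → Ω → ℝ) (n : ℕ) (ω : Ω) (i : ℕ) (v : Vec p) :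
    m.response ε n ω i - inner ℝ (m.x n i) (m.trueCoef n i + v) =
      ε i ω - inner ℝ (m.x n i) v := by
  rw [Model.response, inner_add_right]
  ring

lemma Model.response_sub' (m : Model p) (ε : ℕ → Ω → ℝ) (n : ℕ) (ω : Ω) (i : ℕ) (v : Vec p) :
    m.response ε n ω i - inner ℝ (m.x n i) v =
      ε i ω - inner ℝ (m.x n i) (v - m.trueCoef n i) := by
  rw [← m.response_sub, add_sub_cancel]

/-- Changing a sequence at few places changes a sum by a controlled amount. -/
lemma sum_sub_le_card_mul {n : ℕ} (Z : Finset ℕ) (g g' : ℕ → ℝ) {M : ℝ} (hM : 0 ≤ M)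
    (heq : ∀ i ∈ Finset.Icc 1 n, i ∉ Z → g i = g' i)
    (hle : ∀ i ∈ Finset.Icc 1 n, g i - g' i ≤ M) :
    ∑ i ∈ Finset.Icc 1 n, g i - ∑ i ∈ Finset.Icc 1 n, g' i ≤ Z.card * M := by
  rw [← Finset.sum_sub_distrib,
    ← Finset.sum_filter_add_sum_filter_not (Finset.Icc 1 n) (fun i => i ∈ Z)]
  have h₁ : ∑ i ∈ (Finset.Icc 1 n).filter (fun i => i ∉ Z), (g i - g' i) = 0 :=
    Finset.sum_eq_zero fun i hi => by
      rw [Finset.mem_filter] at hi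
      rw [heq i hi.1 hi.2, sub_self]
  rw [h₁, add_zero]
  refine (Finset.sum_le_card_nsmul _ _ M fun i hi => hle i (Finset.mem_filter.1 hi).1).trans ?_
  rw [nsmul_eq_mul]
  gcongr
  exact fun i hi => (Finset.mem_filter.1 hi).2

/-- Among sufficiently many consecutive intervals, one contains no point of a given set. -/
lemma exists_interval_disjoint (P : Finset ℕ) (lo l : ℕ) {q : ℕ} (hq : P.card < q) :
    ∃ j < q, ∀ t ∈ P, ¬ (lo + j * l < t ∧ t ≤ lo + (j + 1) * l) := by
  by_contra hne
  push Not at hne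
  choose! g hg using hne
  have hmaps : Set.MapsTo g (Finset.range q) P := fun j hj =>
    (hg j (Finset.mem_range.1 (Finset.mem_coe.1 hj))).1
  have hlt : P.card < (Finset.range q).card := by rwa [Finset.card_range]
  obtain ⟨j, hj, k, hk, hjk, he⟩ := Finset.exists_ne_map_eq_of_card_lt_of_maps_to hlt hmaps
  have key : ∀ a b : ℕ, a < b → a < q → b < q → g a = g b → False := by
    intro a b hab ha hb he
    have h₁ := (hg a ha).2.2
    have h₂ := (hg b hb).2.1
    have h₃ : (a + 1) * l ≤ b * l := Nat.mul_le_mul_right l hab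
    omega
  rw [Finset.mem_range] at hj hk
  rcases lt_or_gt_of_ne hjk with h | h
  · exact key j k h hj hk he
  · exact key k j h hk hj he.symm

lemma norm_sub_le_sum_norm {n : ℕ} (u : ℕ → Vec p) {i j : ℕ} (hi : i ∈ Finset.Icc 1 n)
    (hj : j ∈ Finset.Icc 1 n) :
    ‖u i - u j‖ ≤ ∑ k ∈ Finset.Icc 2 n, ‖u k - u (k - 1)‖ := by
  have key : ∀ i j : ℕ, 1 ≤ j → j ≤ i → i ≤ n →
      ‖u i - u j‖ ≤ ∑ k ∈ Finset.Icc (j + 1) i, ‖u k - u (k - 1)‖ := by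
    intro i j h1 hji hin
    induction i, hji using Nat.le_induction with
    | base => simp
    | succ i hji ih =>
      rw [Finset.sum_Icc_succ_top (by omega)]
      have h₁ : u (i + 1) - u j = (u i - u j) + (u (i + 1) - u i) := by abel
      rw [h₁, Nat.add_sub_cancel]
      exact (norm_add_le _ _).trans (add_le_add_left (ih (by omega)) _)
  have hsub : ∀ i j : ℕ, 1 ≤ j → i ≤ n → ∑ k ∈ Finset.Icc (j + 1) i, ‖u k - u (k - 1)‖ ≤
      ∑ k ∈ Finset.Icc 2 n, ‖u k - u (k - 1)‖ := fun i j h1 hin =>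
    Finset.sum_le_sum_of_subset_of_nonneg (Finset.Icc_subset_Icc (by omega) hin)
      fun _ _ _ => norm_nonneg _
  rw [Finset.mem_Icc] at hi hj
  rcases le_total j i with h | h
  · exact (key i j hj.1 h hi.2).trans (hsub i j hj.1 hi.2)
  · rw [norm_sub_rev]
    exact (key j i hi.1 h hj.2).trans (hsub j i hi.1 hj.2)

lemma card_changePoints_merged_le (m : Model p) {n K₀ : ℕ} {B : Finset ℕ} (hc : B.card ≤ K₀)
    (b : ℕ → Vec p) (g : Vec p → Vec p → Vec p) :
    (changePoints n fun i => g (mergedCoef n B b i) (m.trueCoef n i)).card ≤ K₀ + m.K := by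
  refine (card_changePoints_map₂_le (n := n) g (mergedCoef n B b) (m.trueCoef n)).trans ?_
  exact Nat.add_le_add ((Finset.card_le_card (changePoints_mergedCoef_subset n _ _)).trans hc)
    (card_changePoints_trueCoef_le m n)

end General

/-! ### Consistency of the truncated first-step estimator. -/

/-- The assumptions on the fused quantile estimator of the first step. -/
structure FirstStep {p : ℕ} [NeZero p] {Ω : Type*} [MeasurableSpace Ω] (μ : Measure Ω)
    (m : Model p) (ε : ℕ → Ω → ℝ) (f : ℝ → ℝ) (τ : ℝ) (δ lam : ℕ → ℝ) (bv : ℕ → Ω → ℕ → Vec p)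
    (B : ℕ → Ω → Finset ℕ) (K₀ : ℕ) : Prop where
  tau_pos : 0 < τ
  tau_lt : τ < 1
  errors : ErrorAssumptions μ ε f τ
  model : ModelAssumptions m f τ δ lam
  estimator : ∀ n, ∀ᵐ ω ∂μ,
    IsEstimator τ n (m.x n) (m.response ε n ω) (fun _ => n * lam n) (bv n ω)
  merging : IsMerging μ (fun n => n * lam n) (fun n ω => changePoints n (bv n ω)) B
  card_le : Whp μ fun n ω => (B n ω).card ≤ K₀

namespace FirstStep

variable {p : ℕ} [NeZero p] {Ω : Type*} [MeasurableSpace Ω] {μ : Measure Ω}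
  {m : Model p} {ε : ℕ → Ω → ℝ} {f : ℝ → ℝ} {τ : ℝ} {δ lam : ℕ → ℝ}
  {bv : ℕ → Ω → ℕ → Vec p} {B : ℕ → Ω → Finset ℕ} {K₀ : ℕ}

lemma subset (h : FirstStep μ m ε f τ δ lam bv B K₀) (n : ℕ) (ω : Ω) :
    B n ω ⊆ changePoints n (bv n ω) := h.merging.subset n ω

lemma lam_nonneg (h : FirstStep μ m ε f τ δ lam bv B K₀) (n : ℕ) : 0 ≤ n * lam n :=
  mul_nonneg (Nat.cast_nonneg n) (h.model.lam_pos n).le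

/-- With probability tending to one, the points that are not kept are close to the kept points, and
there are few kept points. -/
lemma whp_zone (h : FirstStep μ m ε f τ δ lam bv B K₀) {η : ℝ} (hη : 0 < η) :
    Whp μ fun n ω => (B n ω).card ≤ K₀ ∧
      ∀ t ∈ changePoints n (bv n ω) \ B n ω, (t : ℝ) - (prev (B n ω) t : ℝ) ≤ η * (n * lam n) := by
  refine h.card_le.and ?_
  have h₁ := h.merging.dropped η hη
  refine h₁.congr fun n => ?_
  simp only [not_forall, not_le, exists_prop]

lemma card_zone_le (h : FirstStep μ m ε f τ δ lam bv B K₀) {n : ℕ} {ω : Ω} {η : ℝ} (hη : 0 ≤ η)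
    (hc : (B n ω).card ≤ K₀) :
    ((clusterZone (B n ω) (η * (n * lam n))).card : ℝ) ≤ (K₀ + 1) * (η * (n * lam n) + 1) := by
  have h0 := mul_nonneg hη (h.lam_nonneg n)
  refine (card_clusterZone_le _ h0).trans ?_
  gcongr

/-- The truncated deviations of the estimator are small in the empirical norm. -/
lemma whp_sum_trunc_sq_le [IsProbabilityMeasure μ]
    (h : FirstStep μ m ε f τ δ lam bv B K₀) {R ζ : ℝ} (hR : 0 < R)
    (hζ : 0 < ζ) :
    Whp μ fun n ω => ∑ i ∈ Finset.Icc 1 n,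
      (inner ℝ (m.x n i) (trunc R (bv n ω i - m.trueCoef n i))) ^ 2 ≤ ζ * (n * δ n) := by
  have hm := h.model
  have := h.errors.isProbabilityMeasure
  have hτ₀ := h.tau_pos.le
  have hτ₁ := h.tau_lt.le
  obtain ⟨η, c₀, hν⟩ := h.errors.exists_quantileLaw h.tau_pos h.tau_lt
  obtain ⟨s, hs, c, hc, hmgf⟩ := hν.exists_integral_exp_le_exp hR
  obtain ⟨ca, hca, hjump⟩ := hm.jump_lt
  set c' := c / s with hc'
  have hc'0 : 0 < c' := div_pos hc hs
  -- The price of one observation in the cluster zone: each of the two losses is at most `R` in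
  -- absolute value, and the quadratic term of the original sequence is at most `c' * R ^ 2`.
  set M := 2 * R + c' * R ^ 2 with hM
  have hM0 : 0 < M := by positivity
  set C₁ : ℝ := 2 * (m.K * ca) + (K₀ + 1) * M with hC₁
  set C₂ : ℝ := (K₀ + m.K + 1) * ((p + 5) / s) with hC₂
  have hC₁0 : 0 < C₁ := by positivity
  have hC₂0 : 0 < C₂ := by positivity
  refine (((h.errors.whp_uniformLower hτ₀ hτ₁ hs hc.le hR.le hmgf m.x
    fun n i hi => hm.norm_x_le n hi).and (h.whp_zone one_pos)).and (whp_of_ae h.estimator)).mono ?_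
  filter_upwards [hm.increasing, hm.eventually_log_le (show 0 < ζ * c' / 3 / C₂ by positivity),
    hm.eventually_lam_le (show 0 < ζ * c' / 3 / C₁ by positivity),
    hm.eventually_const_le ((K₀ + 1) * M) (show 0 < ζ * c' / 3 by positivity)]
    with n hinc hlog hlam hconst ω ⟨⟨hG, hcard, hzone⟩, hest⟩
  set z : ℕ → Vec p := fun i => trunc R (bv n ω i - m.trueCoef n i) with hz
  set z' : ℕ → Vec p := fun i => trunc R (mergedCoef n (B n ω) (bv n ω) i - m.trueCoef n i) with hz'
  set Z := clusterZone (B n ω) (1 * (n * lam n)) with hZ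
  set H : ℕ → Vec p → ℝ := fun i v =>
    (check τ (ε i ω - inner ℝ (m.x n i) v) - check τ (ε i ω)) - c' * (inner ℝ (m.x n i) v) ^ 2
    with hH
  have hlam0 := h.lam_nonneg n
  have hlog0 : 0 ≤ Real.log n := Real.log_natCast_nonneg n
  -- the basic inequality
  have h₁ : ∑ i ∈ Finset.Icc 1 n, (check τ (ε i ω - inner ℝ (m.x n i) (z i)) - check τ (ε i ω)) ≤
      2 * (n * lam n * (m.K * ca)) := by
    have h₂ := hest.sum_trunc_le (fun _ _ => hlam0) (m.trueCoef n) hR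
    have h₃ : ∀ i, m.response ε n ω i - inner ℝ (m.x n i) (m.trueCoef n i) = ε i ω := fun i => by
      simpa using m.response_sub ε n ω i 0
    simp only [m.response_sub, h₃] at h₂
    refine h₂.trans ?_
    rw [← Finset.mul_sum]
    gcongr
    exact Model.sum_norm_trueCoef_sub_le hinc (hm.start n) hca.le fun k hk => (hjump n k hk).le
  -- the lower bound for the merged sequence
  have h₂ : -((K₀ + m.K + 1) * ((p + 5) / s * Real.log n)) ≤
      ∑ i ∈ Finset.Icc 1 n, H i (z' i) := by
    have hA : 0 ≤ (p + 5) / s * Real.log n := by positivity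
    have h₃ := neg_card_mul_le_sum hA H z' n (fun a b v ha hab hb hv => by
      obtain ⟨i, -, rfl⟩ := hv
      have := hG a b ha hb (z' i) (norm_trunc_le hR _)
      rw [Finset.sum_sub_distrib, ← Finset.mul_sum]
      linarith)
    refine le_trans (neg_le_neg ?_) h₃
    gcongr
    exact_mod_cast card_changePoints_merged_le m hcard (bv n ω) (fun a b => trunc R (a - b))
  -- comparison of the merged sequence with the original one
  have h₃ : ∑ i ∈ Finset.Icc 1 n, H i (z' i) - ∑ i ∈ Finset.Icc 1 n, H i (z i) ≤ Z.card * M := by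
    refine sum_sub_le_card_mul Z _ _ hM0.le (fun i hi hiZ => ?_) fun i hi => ?_
    · rw [hz', hz]
      simp only
      rw [mergedCoef_eq_of_notMem_clusterZone (h.subset n ω) hzone hi hiZ]
    · have h₄ := (abs_le.1 (abs_check_sub_check_le hτ₀ hτ₁ (inner ℝ (m.x n i) (z i)) (ε i ω))).1
      have h₅ := (abs_le.1 (abs_check_sub_check_le hτ₀ hτ₁ (inner ℝ (m.x n i) (z' i)) (ε i ω))).2
      have h₆ := (hm.abs_inner_le n hi (z i)).trans (norm_trunc_le hR _)
      have h₇ := (hm.abs_inner_le n hi (z' i)).trans (norm_trunc_le hR _)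
      have h₈ : (inner ℝ (m.x n i) (z i)) ^ 2 ≤ R ^ 2 := by
        rw [← sq_abs]
        exact pow_le_pow_left₀ (abs_nonneg _) h₆ 2
      have h₉ := mul_le_mul_of_nonneg_left h₈ hc'0.le
      have h₁₀ : 0 ≤ c' * (inner ℝ (m.x n i) (z' i)) ^ 2 := by positivity
      simp only [hH]
      linarith
  have h₄ := h.card_zone_le (n := n) zero_le_one hcard
  rw [← hZ, one_mul] at h₄
  have h₅ := mul_le_mul_of_nonneg_right h₄ hM0.le
  have h₆ : ∑ i ∈ Finset.Icc 1 n, H i (z i) =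
      ∑ i ∈ Finset.Icc 1 n, (check τ (ε i ω - inner ℝ (m.x n i) (z i)) - check τ (ε i ω)) -
        c' * ∑ i ∈ Finset.Icc 1 n, (inner ℝ (m.x n i) (z i)) ^ 2 := by
    rw [Finset.sum_sub_distrib, ← Finset.mul_sum]
  have h₇ : C₂ * Real.log n ≤ ζ * c' / 3 * (n * δ n) := by
    calc C₂ * Real.log n ≤ C₂ * (ζ * c' / 3 / C₂ * (n * δ n)) := by gcongr
      _ = _ := by field_simp
  have h₈ : C₁ * (n * lam n) ≤ ζ * c' / 3 * (n * δ n) := by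
    calc C₁ * (n * lam n) ≤ C₁ * (ζ * c' / 3 / C₁ * (n * δ n)) := by gcongr
      _ = _ := by field_simp
  refine le_of_mul_le_mul_left ?_ hc'0
  rw [h₆] at h₃
  have h₉ : C₁ * (n * lam n) = 2 * (n * lam n * (m.K * ca)) + (K₀ + 1) * (n * lam n) * M := by
    rw [hC₁]; ring
  have h₁₀ : C₂ * Real.log n = (K₀ + m.K + 1) * ((p + 5) / s * Real.log n) := by
    rw [hC₂]; ring
  nlinarith

end FirstStep

/-! ### Intercept shifts and unbounded deviations. -/

/-- For an optimal sequence, long blocks of negative residuals are impossible if the design has an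
intercept: shifting the intercept on the block would improve the objective function. -/
lemma IsEstimator.card_block_le {p : ℕ} [NeZero p] {τ : ℝ} {n : ℕ} {x : ℕ → Vec p} {Y : ℕ → ℝ}
    {r : ℝ} {b : ℕ → Vec p} (hb : IsEstimator τ n x Y (fun _ => r) b) (hr : 0 ≤ r) {c₀ : ℝ}
    (hc₀ : c₀ ≠ 0) (hx : ∀ i ∈ Finset.Icc 1 n, x i 0 = c₀) {a l : ℕ} (ha : 1 ≤ a)
    (hl : a + l ≤ n + 1) (hneg : ∀ i ∈ Finset.Ico a (a + l), Y i - inner ℝ (x i) (b i) ≤ -(1 / 2)) :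
    l * ((1 - τ) * |c₀|) ≤ 2 * r := by
  -- The shift lowers the fitted values on the block by `1 / 2`. Residuals at most `-1 / 2` stay
  -- nonpositive, so each gains exactly `(1 - τ) / 2`, against at most two new jumps of size `1 / (2
  -- * |c₀|)`.
  set e : Vec p := (-(1 / (2 * c₀))) • EuclideanSpace.single 0 1 with he
  set h : ℕ → Vec p := fun i => if i ∈ Finset.Ico a (a + l) then e else 0 with hh
  have hc₀' : 0 < |c₀| := abs_pos.2 hc₀
  have hnorm : ‖e‖ = 1 / (2 * |c₀|) := by
    rw [he, norm_smul, PiLp.norm_single, norm_one, mul_one, norm_neg, Real.norm_eq_abs,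
      abs_div, abs_one, abs_mul, abs_two]
  have hsub : Finset.Ico a (a + l) ⊆ Finset.Icc 1 n := fun i hi => by
    rw [Finset.mem_Ico] at hi
    rw [Finset.mem_Icc]
    omega
  have hinner : ∀ i ∈ Finset.Icc 1 n, inner ℝ (x i) e = -(1 / 2 : ℝ) := by
    intro i hi
    rw [he, real_inner_smul_right, real_inner_comm, EuclideanSpace.inner_single_left, hx i hi]
    simp
    field_simp
  have hopt := hb (fun i => b i + h i)
  unfold objective at hopt
  have hpen : ∑ i ∈ Finset.Icc 2 n, r * ‖(b i + h i) - (b (i - 1) + h (i - 1))‖ ≤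
      ∑ i ∈ Finset.Icc 2 n, r * ‖b i - b (i - 1)‖ + r * (1 / |c₀|) := by
    have h₁ : ∀ i ∈ Finset.Icc 2 n, ‖h i - h (i - 1)‖ ≤
        (if i = a then ‖e‖ else 0) + (if i = a + l then ‖e‖ else 0) := by
      intro i hi
      rw [Finset.mem_Icc] at hi
      simp only [hh, Finset.mem_Ico]
      have h0 := norm_nonneg e
      by_cases h₂ : a ≤ i ∧ i < a + l <;> by_cases h₃ : a ≤ i - 1 ∧ i - 1 < a + l
      · rw [if_pos h₂, if_pos h₃, sub_self, norm_zero]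
        positivity
      · rw [if_pos h₂, if_neg h₃, sub_zero, if_pos (show i = a by omega)]
        have : 0 ≤ if i = a + l then ‖e‖ else 0 := by positivity
        linarith
      · rw [if_neg h₂, if_pos h₃, zero_sub, norm_neg, if_pos (show i = a + l by omega)]
        have : 0 ≤ if i = a then ‖e‖ else 0 := by positivity
        linarith
      · rw [if_neg h₂, if_neg h₃, sub_self, norm_zero]
        positivity
    have h₂ : ∑ i ∈ Finset.Icc 2 n, ‖h i - h (i - 1)‖ ≤ 1 / |c₀| := by
      refine (Finset.sum_le_sum h₁).trans ?_
      rw [Finset.sum_add_distrib, Finset.sum_ite_eq', Finset.sum_ite_eq']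
      have h₃ : ∀ q : Prop, [Decidable q] → (if q then ‖e‖ else 0) ≤ 1 / (2 * |c₀|) := by
        intro q _
        split_ifs
        · exact hnorm.le
        · positivity
      have h₄ : 1 / |c₀| = 1 / (2 * |c₀|) + 1 / (2 * |c₀|) := by field_simp; norm_num
      rw [h₄]
      exact add_le_add (h₃ _) (h₃ _)
    rw [← Finset.mul_sum, ← Finset.mul_sum, ← mul_add]
    refine mul_le_mul_of_nonneg_left ?_ hr
    refine le_trans (Finset.sum_le_sum fun i _ => ?_) ((Finset.sum_add_distrib).le.trans
      (add_le_add_right h₂ _))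
    rw [add_sub_add_comm]
    exact norm_add_le _ _
  have hloss : ∑ i ∈ Finset.Icc 1 n, (check τ (Y i - inner ℝ (x i) (b i + h i)) -
      check τ (Y i - inner ℝ (x i) (b i))) = -(l * ((1 - τ) / 2)) := by
    rw [← Finset.sum_subset hsub]
    · rw [Finset.sum_congr rfl (g := fun _ => -((1 - τ) / 2))]
      · rw [Finset.sum_const, Nat.card_Ico, nsmul_eq_mul]
        simp
      · intro i hi
        have h₁ := hneg i hi
        rw [inner_add_right, show h i = e from if_pos hi, hinner i (hsub hi), check_eq_max,
          check_eq_max, max_eq_right (by nlinarith), max_eq_right (by nlinarith)]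
        ring
    · intro i _ hi
      rw [show h i = 0 from if_neg hi]
      simp
  rw [Finset.sum_sub_distrib] at hloss
  have h₁ : (l : ℝ) * ((1 - τ) / 2) ≤ r * (1 / |c₀|) := by linarith
  have h₂ := mul_le_mul_of_nonneg_right h₁ (show 0 ≤ 2 * |c₀| by positivity)
  have h₃ : r * (1 / |c₀|) * (2 * |c₀|) = 2 * r := by field_simp
  linarith

/-- Without a bound for the shift, the excess loss is bounded below by a multiple of the shift. -/
lemma UniformLower.le_sum {p : ℕ} {τ : ℝ} {n : ℕ} {x : ℕ → Vec p} {e : ℕ → ℝ} {R A : ℝ}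
    (h : UniformLower τ n x e R 0 A) (hR : 0 < R) (hA : 0 ≤ A) {a b : ℕ} (ha : 1 ≤ a)
    (hb : b ≤ n + 1) (u : Vec p) :
    -((1 + ‖u‖ / R) * A) ≤
      ∑ i ∈ Finset.Ico a b, (check τ (e i - inner ℝ (x i) u) - check τ (e i)) := by
  have h0 : 0 ≤ ‖u‖ / R := by positivity
  rcases le_total ‖u‖ R with hu | hu
  · have := h a b ha hb u hu
    nlinarith
  · have hu0 : 0 < ‖u‖ := hR.trans_le hu
    have ht1 : R / ‖u‖ ≤ 1 := (div_le_one hu0).2 hu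
    have ht0 : 0 < R / ‖u‖ := by positivity
    -- Shrink `u` to norm `R`. By convexity the excess loss shrinks at least proportionally, so
    -- scaling back multiplies the error `A` only by `‖u‖ / R`.
    have h₁ := h a b ha hb ((R / ‖u‖) • u) (by
      rw [norm_smul, Real.norm_of_nonneg ht0.le]
      field_simp
      exact le_rfl)
    have h₂ : ∑ i ∈ Finset.Ico a b, (check τ (e i - inner ℝ (x i) ((R / ‖u‖) • u)) -
        check τ (e i)) ≤ R / ‖u‖ *
        ∑ i ∈ Finset.Ico a b, (check τ (e i - inner ℝ (x i) u) - check τ (e i)) := by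
      rw [Finset.mul_sum]
      refine Finset.sum_le_sum fun i _ => ?_
      have h₃ := check_convex (τ := τ) (e i - inner ℝ (x i) u) (e i) ht0.le ht1
      rw [real_inner_smul_right]
      have h₄ : R / ‖u‖ * (e i - inner ℝ (x i) u) + (1 - R / ‖u‖) * e i =
          e i - R / ‖u‖ * inner ℝ (x i) u := by ring
      rw [h₄] at h₃
      linarith
    have h₃ := mul_le_mul_of_nonneg_left (h₁.trans h₂) (show 0 ≤ ‖u‖ / R by positivity)
    rw [← mul_assoc, show ‖u‖ / R * (R / ‖u‖) = 1 by field_simp, one_mul] at h₃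
    nlinarith

/-! ### A lower bound for the tuning parameter, and boundedness of the estimator. -/

namespace FirstStep

variable {p : ℕ} [NeZero p] {Ω : Type*} [MeasurableSpace Ω] {μ : Measure Ω}
  [IsProbabilityMeasure μ] {m : Model p} {ε : ℕ → Ω → ℝ} {f : ℝ → ℝ} {τ : ℝ} {δ lam : ℕ → ℝ}
  {bv : ℕ → Ω → ℕ → Vec p} {B : ℕ → Ω → Finset ℕ} {K₀ : ℕ}

/-- Half of a `Q`-th part of the sample has length about `n / (2 * Q)`; the rounding costs at most
another factor two. -/
lemma eventually_le_half_div (Q : ℕ) (hQ : 0 < Q) :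
    ∀ᶠ n : ℕ in atTop, (n : ℝ) / (4 * Q) ≤ ((n - 1) / Q / 2 : ℕ) := by
  filter_upwards [eventually_ge_atTop (8 * Q)] with n hn
  rw [Nat.div_div_eq_div_mul]
  have h₁ := Nat.lt_mul_div_succ (n - 1) (show 0 < Q * 2 by omega)
  have h₂ : (n : ℝ) ≤ Q * 2 * (((n - 1) / (Q * 2) : ℕ) + 1) := by exact_mod_cast (by omega)
  have h₃ : (8 : ℝ) * Q ≤ n := by exact_mod_cast hn
  have hQ' : (0 : ℝ) < Q := Nat.cast_pos.2 hQ
  rw [div_le_iff₀ (by positivity)]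
  nlinarith

/-- On one of finitely many long intervals, the estimator is close to the true coefficient. -/
lemma whp_exists_interval (h : FirstStep μ m ε f τ δ lam bv B K₀) :
    Whp μ fun n ω => ∃ j < K₀ + m.K + 1,
      ∀ i ∈ Finset.Ico (1 + j * ((n - 1) / (K₀ + m.K + 1)) + (n - 1) / (K₀ + m.K + 1) / 2)
        (1 + (j + 1) * ((n - 1) / (K₀ + m.K + 1))), ‖bv n ω i - m.trueCoef n i‖ ≤ 1 / 2 := by
  have hm := h.model
  obtain ⟨m₀, hm₀, hgram⟩ := hm.exists_mul_norm_sq_le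
  -- There are more intervals than kept points and true change-points together, so some interval
  -- contains none of them.
  set Q := K₀ + m.K + 1 with hQ
  have hQ0 : (0 : ℝ) < Q := by positivity
  refine ((h.whp_zone one_pos).and (h.whp_sum_trunc_sq_le one_pos
    (show 0 < m₀ / 8 by positivity))).mono ?_
  filter_upwards [hgram, eventually_le_half_div Q (by omega), eventually_ge_atTop 1,
    hm.eventually_delta_le (show 0 < 1 / (4 * (Q : ℝ)) by positivity),
    hm.eventually_lam_le one_pos, hm.eventually_const_le 1 one_pos]
    with n hgram hhalf hn1 hdelta hlam hone ω ⟨⟨hcard, hzone⟩, hsum⟩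
  set l := (n - 1) / Q with hl
  have hdl : n * δ n ≤ (l / 2 : ℕ) := by
    refine le_trans ?_ hhalf
    rwa [div_eq_mul_one_div, mul_comm (n : ℝ) (1 / _)]
  have hPcard : (B n ω ∪ m.trueLocations n).card < Q := by
    have h₁ := Finset.card_union_le (B n ω) (m.trueLocations n)
    have h₂ : (m.trueLocations n).card ≤ m.K := Finset.card_image_le.trans (by simp)
    omega
  obtain ⟨j, hj, hP⟩ := exists_interval_disjoint (B n ω ∪ m.trueLocations n) 1 l hPcard
  refine ⟨j, hj, ?_⟩
  set a := 1 + j * l + l / 2 with ha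
  set b := 1 + (j + 1) * l with hb
  have hbn : b ≤ n := by
    have h₁ : (j + 1) * l ≤ Q * l := Nat.mul_le_mul_right l hj
    have h₂ : Q * l ≤ n - 1 := Nat.mul_div_le _ _
    omega
  have hjl := Nat.zero_le (j * l)
  clear_value l
  have hab : a + l / 2 ≤ b := by
    rw [ha, hb, add_mul, one_mul]; omega
  -- This is why only the second half is used: a jump there would be a dropped point more than `l /
  -- 2 ≥ n δ_n ≥ n λ_n` beyond the preceding kept point, which `hzone` excludes.
  have hconst₁ : ∀ i ∈ Finset.Ico a b, bv n ω i = bv n ω a := by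
    intro i hi
    rw [Finset.mem_Ico] at hi
    refine eq_of_forall_notMem_changePoints (n := n) (by omega) hi.1 (by omega) fun t hat hti ht => ?_
    have htB : t ∉ B n ω := fun htB => hP t (Finset.mem_union_left _ htB) (by omega)
    have h₁ := hzone t (Finset.mem_sdiff.2 ⟨ht, htB⟩)
    have h₂ : prev (B n ω) t ≤ 1 + j * l := prev_le_of_forall_notMem (by omega) fun s hs hst hsB =>
      hP s (Finset.mem_union_left _ hsB) (by omega)
    have h₃ : (prev (B n ω) t : ℝ) + (l / 2 : ℕ) < t := by
      exact_mod_cast (by omega : prev (B n ω) t + l / 2 < t)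
    linarith
  have hconst₂ : ∀ i ∈ Finset.Ico a b, m.trueCoef n i = m.trueCoef n a := by
    intro i hi
    rw [Finset.mem_Ico] at hi
    refine eq_of_forall_notMem_changePoints (n := n) (by omega) hi.1 (by omega) fun t hat hti ht => ?_
    exact hP t (Finset.mem_union_right _ (changePoints_trueCoef_subset m n ht)) (by omega)
  have hlen : ((l / 2 : ℕ) : ℝ) ≤ (b : ℝ) - a := by
    rw [le_sub_iff_add_le']
    exact_mod_cast hab
  have h₁ := hgram a b (by omega) hbn (hdl.trans hlen)
    (trunc 1 (bv n ω a - m.trueCoef n a))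
  have h₂ : ∑ i ∈ Finset.Ico a b,
      (inner ℝ (m.x n i) (trunc 1 (bv n ω a - m.trueCoef n a))) ^ 2 ≤ m₀ / 8 * (n * δ n) := by
    refine le_trans ?_ hsum
    rw [Finset.sum_congr rfl fun i hi => by rw [← hconst₁ i hi, ← hconst₂ i hi]]
    refine Finset.sum_le_sum_of_subset_of_nonneg (fun i hi => ?_) fun _ _ _ => sq_nonneg _
    rw [Finset.mem_Ico] at hi
    rw [Finset.mem_Icc]
    omega
  have hu : ‖bv n ω a - m.trueCoef n a‖ < 1 / 2 := by
    refine norm_lt_of_norm_trunc_lt one_pos (by norm_num) ?_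
    have h₃ := h₁.trans h₂
    have h₄ : m₀ * (n * δ n) * ‖trunc 1 (bv n ω a - m.trueCoef n a)‖ ^ 2 ≤ m₀ / 8 * (n * δ n) := by
      refine le_trans ?_ h₃
      gcongr
      exact hdl.trans hlen
    have h₅ : 0 < m₀ * (n * δ n) := by
      have : 0 < n * δ n := by linarith
      positivity
    have h₆ : ‖trunc 1 (bv n ω a - m.trueCoef n a)‖ ^ 2 ≤ 1 / 8 := by
      refine le_of_mul_le_mul_left ?_ h₅
      linarith
    nlinarith [norm_nonneg (trunc 1 (bv n ω a - m.trueCoef n a))]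
  intro i hi
  rw [hconst₁ i hi, hconst₂ i hi]
  exact hu.le

/-- The tuning parameter dominates the logarithm of the sample size. -/
lemma exists_log_le (h : FirstStep μ m ε f τ δ lam bv B K₀) :
    ∃ c > 0, ∀ᶠ n : ℕ in atTop, c * Real.log n ≤ n * lam n := by
  have hm := h.model
  obtain ⟨c, hc, hblock⟩ := h.errors.exists_whp_block
  obtain ⟨c₀, hc₀, hint⟩ := hm.intercept
  have hτ := sub_pos.2 h.tau_lt
  have hc₀' : 0 < |c₀| := abs_pos.2 hc₀
  -- By `IsEstimator.card_block_le`, a block of residuals at most `-1 / 2` cannot be longer than `(C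
  -- - 1) * (n λ_n)`.
  set C := 2 / ((1 - τ) * |c₀|) + 1 with hC
  have hC0 : 0 < C := by positivity
  set Q := K₀ + m.K + 1 with hQ
  set l : ℕ → ℕ := fun n => ⌊C * (n * lam n)⌋₊ + 1 with hl
  have hblocks := Whp.forall_finset (Finset.range Q) fun j _ =>
    hblock (4 * Q) (fun n => 1 + j * ((n - 1) / Q) + (n - 1) / Q / 2) (fun n => (n - 1) / Q / 2) l
      (by positivity) (fun n => by simp [hl]) (eventually_le_half_div Q (by omega))
  refine ⟨c / (2 * C), by positivity, ?_⟩
  -- The claim is deterministic, so one outcome for each `n` suffices. Blocks are available in all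
  -- `Q` intervals because the well-fitted one is random.
  filter_upwards [((hblocks.and h.whp_exists_interval).and (whp_of_ae h.estimator)).eventually_exists,
    hm.lam_tendsto.eventually_ge_atTop (1 / C), eventually_ge_atTop 1]
    with n ⟨ω, ⟨hbl, j, hj, hi⟩, hest⟩ hlam hn1
  by_contra hlt
  push Not at hlt
  have h1 : 1 ≤ C * (n * lam n) := by
    rwa [div_le_iff₀' hC0] at hlam
  have hln : (l n : ℝ) ≤ c * Real.log n := by
    simp only [hl]
    push_cast
    have h₁ := Nat.floor_le (show 0 ≤ C * (n * lam n) by linarith)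
    have h₂ := mul_lt_mul_of_pos_left hlt (show 0 < 2 * C by positivity)
    rw [show 2 * C * (c / (2 * C) * Real.log n) = c * Real.log n by field_simp] at h₂
    linarith
  obtain ⟨a, ha, hal, hneg⟩ := hbl j (Finset.mem_range.2 hj) hln
  rw [← hQ] at hi
  set L := (n - 1) / Q with hL
  have hbn : 1 + (j + 1) * L ≤ n := by
    have h₁ : (j + 1) * L ≤ Q * L := Nat.mul_le_mul_right L hj
    have h₂ : Q * L ≤ n - 1 := Nat.mul_div_le _ _
    omega
  have hjL := Nat.zero_le (j * L)
  clear_value L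
  have hend : a + l n ≤ 1 + (j + 1) * L := by
    rw [add_mul, one_mul]; omega
  have h₁ := hest.card_block_le (h.lam_nonneg n) hc₀ (hint n) (a := a) (l := l n) (by omega)
    (by omega) fun i hia => by
      have h₂ := hneg i hia
      rw [Finset.mem_Ico] at hia
      have h₃ := hi i (Finset.mem_Ico.2 (by omega))
      have h₄ := (abs_le.1 ((hm.abs_inner_le n (i := i) (Finset.mem_Icc.2 (by omega))
        (bv n ω i - m.trueCoef n i)).trans h₃)).1
      rw [m.response_sub']
      linarith
  have h₂ : C * (n * lam n) < l n := by
    simp only [hl]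
    push_cast
    exact Nat.lt_floor_add_one _
  have h₃ := mul_lt_mul_of_pos_right h₂ (show 0 < (1 - τ) * |c₀| by positivity)
  have h₄ : C * (n * lam n) * ((1 - τ) * |c₀|) =
      2 * (n * lam n) + n * lam n * ((1 - τ) * |c₀|) := by
    rw [hC]; field_simp
  have h₅ : 0 ≤ n * lam n * ((1 - τ) * |c₀|) := mul_nonneg (h.lam_nonneg n) (by positivity)
  linarith

/-- The deviations of the estimator are bounded, with probability tending to one. -/
lemma exists_whp_norm_sub_le (h : FirstStep μ m ε f τ δ lam bv B K₀) :
    ∃ C, 0 < C ∧ Whp μ fun n ω => ∀ i ∈ Finset.Icc 1 n, ∀ s ∈ Finset.Icc 1 n,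
      ‖bv n ω s - m.trueCoef n i‖ ≤ C := by
  have hm := h.model
  have := h.errors.isProbabilityMeasure
  have hτ₀ := h.tau_pos.le
  have hτ₁ := h.tau_lt.le
  obtain ⟨η₀, c₀, hν⟩ := h.errors.exists_quantileLaw h.tau_pos h.tau_lt
  obtain ⟨cL, hcL, hlog⟩ := h.exists_log_le
  obtain ⟨ca, hca, hjump⟩ := hm.jump_lt
  set q : ℝ := K₀ + m.K + 1 with hq
  have hq0 : 0 < q := by positivity
  -- With the exponent `Bd / R`, the stochastic error of `q` pieces with deviations up to `N` is at
  -- most `n λ_n * (R + N) / 8`, because `cL * log n ≤ n λ_n`.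
  set Bd : ℝ := 8 * q * (p + 5) / cL with hBd
  have hBd0 : 0 < Bd := by positivity
  obtain ⟨R, -, hR, hmgf⟩ := hν.exists_integral_exp_le_one hBd0 0
  -- Limits the cluster zone to `n λ_n / 12` observations, each costing at most `2 * N`.
  set η : ℝ := 1 / (24 * (K₀ + 1)) with hη
  have hη0 : 0 < η := by positivity
  set D := m.K * ca with hD
  have hD0 : 0 ≤ D := by positivity
  refine ⟨1 + 2 * (D + R + (1 + 2 * D)) + 2 * D, by positivity, ?_⟩
  have hG := h.errors.whp_uniformLower hτ₀ hτ₁ (div_pos hBd0 hR) le_rfl hR.le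
    (fun w hw => by simpa using hmgf w hw) m.x fun n i hi => hm.norm_x_le n hi
  refine (((hG.and (h.whp_zone hη0)).and h.whp_exists_interval).and
    (whp_of_ae h.estimator)).mono ?_
  filter_upwards [hm.increasing, hlog, hm.lam_tendsto.eventually_ge_atTop (1 / η),
    hm.lam_tendsto.eventually_ge_atTop 1, eventually_le_half_div (K₀ + m.K + 1) (by omega),
    eventually_ge_atTop 1]
    with n hinc hlog hlamη hlam1 hhalf hn1 ω ⟨⟨⟨hG, hcard, hzone⟩, j, hj, hint⟩, hest⟩
  set b := bv n ω with hb
  set V := ∑ i ∈ Finset.Icc 2 n, ‖b i - b (i - 1)‖ with hV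
  have hV0 : 0 ≤ V := Finset.sum_nonneg fun _ _ => norm_nonneg _
  set r := n * lam n with hr
  have hr0 : 0 < r := by linarith
  have hTV : ∑ i ∈ Finset.Icc 2 n, ‖m.trueCoef n i - m.trueCoef n (i - 1)‖ ≤ D :=
    Model.sum_norm_trueCoef_sub_le hinc (hm.start n) hca.le fun k hk => (hjump n k hk).le
  -- Some observation has a deviation of at most `1 / 2`; every other pair of places is reached
  -- through the variation `V` of the estimator and at most `D` of the truth.
  set N := 1 + V + 2 * D with hN
  -- a uniform bound for the deviations
  have hdev : ∀ i ∈ Finset.Icc 1 n, ∀ s ∈ Finset.Icc 1 n, ‖b s - m.trueCoef n i‖ ≤ N := by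
    intro i hi s hs
    set L := (n - 1) / (K₀ + m.K + 1) with hL
    have hL0 : 0 < L / 2 := by
      have h₁ : (0 : ℝ) < (n : ℝ) / (4 * ((K₀ + m.K + 1 : ℕ) : ℝ)) := by
        have : (0 : ℝ) < n := Nat.cast_pos.2 hn1
        positivity
      exact_mod_cast h₁.trans_le hhalf
    have hLn : 1 + (j + 1) * L ≤ n := by
      have h₁ : (j + 1) * L ≤ (K₀ + m.K + 1) * L := Nat.mul_le_mul_right L hj
      have h₂ : (K₀ + m.K + 1) * L ≤ n - 1 := Nat.mul_div_le _ _
      omega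
    set a := 1 + j * L + L / 2 with ha
    have haL : a < 1 + (j + 1) * L := by rw [ha, add_mul, one_mul]; omega
    have h₁ := hint a (Finset.mem_Ico.2 ⟨le_rfl, haL⟩)
    have han : a ∈ Finset.Icc 1 n := Finset.mem_Icc.2 (by omega)
    have h₂ := norm_sub_le_sum_norm b hs han
    have h₃ := (norm_sub_le_sum_norm (m.trueCoef n) han hi).trans hTV
    have h₄ : b s - m.trueCoef n i = (b s - b a) + (b a - m.trueCoef n a) +
        (m.trueCoef n a - m.trueCoef n i) := by abel
    rw [h₄]
    refine (norm_add₃_le).trans ?_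
    linarith
  set u : ℕ → Vec p := fun i => b i - m.trueCoef n i with hu
  set u' : ℕ → Vec p := fun i => mergedCoef n (B n ω) b i - m.trueCoef n i with hu'
  have hu'N : ∀ i ∈ Finset.Icc 1 n, ‖u' i‖ ≤ N := by
    intro i hi
    have h₁ := lastBeforeNext_spec ((h.subset n ω).trans (Finset.filter_subset _ _))
      (Finset.mem_Icc.1 hi).2
    exact hdev i hi _ (Finset.mem_Icc.2 ⟨(Finset.mem_Icc.1 hi).1.trans h₁.1, h₁.2.1⟩)
  set H : ℕ → Vec p → ℝ := fun i v =>
    check τ (ε i ω - inner ℝ (m.x n i) v) - check τ (ε i ω) with hH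
  set A := (p + 5) / (Bd / R) * Real.log n with hA
  have hA0 : 0 ≤ A := by
    have := Real.log_natCast_nonneg n
    positivity
  -- the basic inequality
  have h₁ : ∑ i ∈ Finset.Icc 1 n, H i (u i) + r * V ≤ r * D := by
    have h₂ := hest (m.trueCoef n)
    unfold objective at h₂
    simp only [m.response_sub', sub_self, inner_zero_right, sub_zero] at h₂
    rw [← Finset.mul_sum, ← Finset.mul_sum] at h₂
    rw [Finset.sum_sub_distrib]
    have := mul_le_mul_of_nonneg_left hTV hr0.le
    linarith
  have h₂ : -(q * ((1 + N / R) * A)) ≤ ∑ i ∈ Finset.Icc 1 n, H i (u' i) := by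
    have hNA : 0 ≤ (1 + N / R) * A := by positivity
    have h₃ := neg_card_mul_le_sum hNA H u' n (fun a b v ha hab hb hv => by
      obtain ⟨i, hi, rfl⟩ := hv
      have h₄ := hu'N i (Finset.mem_Icc.2 hi)
      rw [zero_div] at hG
      refine le_trans (neg_le_neg ?_) (hG.le_sum hR hA0 ha hb (u' i))
      gcongr)
    refine le_trans (neg_le_neg ?_) h₃
    rw [hq]
    gcongr
    exact_mod_cast card_changePoints_merged_le m hcard b (fun a b => a - b)
  set Z := clusterZone (B n ω) (η * r) with hZ
  have h₃ : ∑ i ∈ Finset.Icc 1 n, H i (u' i) - ∑ i ∈ Finset.Icc 1 n, H i (u i) ≤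
      Z.card * (2 * N) := by
    refine sum_sub_le_card_mul Z _ _ (by positivity) (fun i hi hiZ => ?_) fun i hi => ?_
    · rw [hu', hu]
      simp only
      rw [mergedCoef_eq_of_notMem_clusterZone (h.subset n ω) hzone hi hiZ]
    · have h₄ := (abs_le.1 (abs_check_sub_check_le hτ₀ hτ₁ (inner ℝ (m.x n i) (u i)) (ε i ω))).1
      have h₅ := (abs_le.1 (abs_check_sub_check_le hτ₀ hτ₁ (inner ℝ (m.x n i) (u' i)) (ε i ω))).2
      have h₆ := (hm.abs_inner_le n hi (u i)).trans (hdev i hi i hi)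
      have h₇ := (hm.abs_inner_le n hi (u' i)).trans (hu'N i hi)
      simp only [hH]
      linarith
  have h₄ := h.card_zone_le (n := n) (ω := ω) hη0.le hcard
  rw [← hr, ← hZ] at h₄
  have h1η : 1 ≤ η * r := by rwa [div_le_iff₀' hη0] at hlamη
  have h₅ : (Z.card : ℝ) ≤ r / 12 := by
    refine h₄.trans ?_
    calc (K₀ + 1 : ℝ) * (η * r + 1) ≤ (K₀ + 1 : ℝ) * (η * r + η * r) := by gcongr
      _ = r / 12 := by rw [hη]; field_simp; norm_num
  have h₆ := mul_le_mul_of_nonneg_right h₅ (show 0 ≤ 2 * N by positivity)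
  have h₇ : q * ((1 + N / R) * A) ≤ r * (R + N) / 8 := by
    have h₈ : A ≤ (p + 5) / (Bd / R) * (r / cL) := by
      rw [hA]
      gcongr
      rw [le_div_iff₀ hcL]
      linarith
    calc q * ((1 + N / R) * A) ≤ q * ((1 + N / R) * ((p + 5) / (Bd / R) * (r / cL))) := by gcongr
      _ = r * (R + N) / 8 := by rw [hBd]; field_simp
  -- Since `N = 1 + V + 2 * D` and `1 / 8 + 1 / 6 < 1`, this self-referential inequality bounds `V`.
  have h₈ : r * V ≤ r * (D + (R + N) / 8 + N / 6) := by nlinarith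
  have h₉ := le_of_mul_le_mul_left h₈ hr0
  intro i hi s hs
  have h₁₀ := hdev i hi s hs
  rw [hN] at h₉ h₁₀
  linarith

end FirstStep

/-! ### Moving a true jump to places where another sequence jumps. -/

section Bump

variable {p : ℕ}

/-- The difference between the sequence that changes from `φ` to `v` at `a` and from `v` to `φ'` at
`b`, and the sequence that changes from `φ` to `φ'` at `t`. -/
noncomputable def bump (t a b : ℕ) (φ φ' v : Vec p) (i : ℕ) : Vec p :=
  (if b ≤ i then φ' - φ else if a ≤ i then v - φ else 0) - if t ≤ i then φ' - φ else 0

/-- A step function `g` that is close to `φ` on the left of `t` and to `φ'` on the right of `t` can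
be replaced near `t` by a step function with at most two jumps, at places where `g` has a large
jump. -/
lemma exists_bump {n t L : ℕ} {x g : ℕ → Vec p} {φ φ' : Vec p} {κ θ N : ℝ} (big : ℕ → Prop)
    (hx : ∀ i ∈ Finset.Icc 1 n, ∀ u, |inner ℝ (x i) u| ≤ ‖u‖) (hLt : L < t) (hLn : t + L ≤ n)
    (hL : 0 < L) (hκ : 0 ≤ κ) (hθ0 : 0 ≤ θ)
    (hrun : ∀ i j, 1 ≤ i → i ≤ j → j ≤ n → (∀ s, i < s → s ≤ j → ¬ big s) → ‖g j - g i‖ ≤ κ)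
    (hleft : (∀ i ∈ Finset.Ico (t - L) t, ‖g i - g t‖ ≤ κ) → ‖g t - φ‖ ≤ θ)
    (hright : (∀ i ∈ Finset.Ico t (t + L), ‖g i - g t‖ ≤ κ) → ‖g t - φ'‖ ≤ θ)
    (hθ : 2 * θ < ‖φ' - φ‖) (hN₁ : ‖g t - φ‖ ≤ N) (hN₂ : ‖g t - φ'‖ ≤ N) (hN₃ : ‖φ' - φ‖ ≤ N) :
    ∃ a b v, a ∈ Finset.Icc 2 n ∧ b ∈ Finset.Icc 2 n ∧ big a ∧ big b ∧ ‖v - φ‖ ≤ N ∧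
      ‖φ' - v‖ ≤ N ∧ ∀ i ∈ Finset.Icc 1 n, ‖bump t a b φ φ' v i‖ ≤ N ∧
        |inner ℝ (x i) (bump t a b φ φ' v i)| ≤ if i ∈ Finset.Ico (t - L) (t + L) then
          |inner ℝ (x i) (g i - if t ≤ i then φ' else φ)| + (κ + θ) else 0 := by
  classical
  have hN0 : 0 ≤ N := (norm_nonneg _).trans hN₃
  have hzero : ∀ (i : ℕ) (e : Vec p), e = 0 → ‖e‖ ≤ N ∧ |inner ℝ (x i) e| ≤
      if i ∈ Finset.Ico (t - L) (t + L) then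
        |inner ℝ (x i) (g i - if t ≤ i then φ' else φ)| + (κ + θ) else 0 := by
    rintro i e rfl
    refine ⟨by simpa using hN0, ?_⟩
    rw [inner_zero_right, abs_zero]
    split_ifs <;> positivity
  have habs : ∀ i ∈ Finset.Icc 1 n, ∀ (y z w : Vec p) (r : ℝ), w = y + z → ‖z‖ ≤ r →
      |inner ℝ (x i) w| ≤ |inner ℝ (x i) y| + r := by
    rintro i hi y z w r rfl hz
    rw [inner_add_right]
    exact (abs_add_le _ _).trans (add_le_add_right ((hx i hi z).trans hz) _)
  -- the last big jump on the left
  have hA : (∃ a, t - L < a ∧ a ≤ t ∧ big a ∧ ∀ i, a ≤ i → i ≤ t → ‖g i - g t‖ ≤ κ) ∨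
      ‖g t - φ‖ ≤ θ ∧ ∀ i, t - L ≤ i → i ≤ t → ‖g i - g t‖ ≤ κ := by
    by_cases h : ((Finset.Ioc (t - L) t).filter big).Nonempty
    · left
      have hm := Finset.max'_mem _ h
      set a := ((Finset.Ioc (t - L) t).filter big).max' h with ha
      rw [Finset.mem_filter, Finset.mem_Ioc] at hm
      refine ⟨a, hm.1.1, hm.1.2, hm.2, fun i hi hit => ?_⟩
      rw [norm_sub_rev]
      refine hrun i t (by omega) hit (by omega) fun s his hst hs => ?_
      have := ((Finset.Ioc (t - L) t).filter big).le_max' s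
        (Finset.mem_filter.2 ⟨Finset.mem_Ioc.2 ⟨by omega, hst⟩, hs⟩)
      omega
    · right
      have h₁ : ∀ i, t - L ≤ i → i ≤ t → ‖g i - g t‖ ≤ κ := by
        intro i hi hit
        rw [norm_sub_rev]
        refine hrun i t (by omega) hit (by omega) fun s his hst hs => h ⟨s, ?_⟩
        exact Finset.mem_filter.2 ⟨Finset.mem_Ioc.2 ⟨by omega, hst⟩, hs⟩
      refine ⟨hleft fun i hi => ?_, h₁⟩
      rw [Finset.mem_Ico] at hi
      exact h₁ i hi.1 hi.2.le
  -- the first big jump on the right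
  have hB : (∃ b, t < b ∧ b < t + L ∧ big b ∧ ∀ i, t ≤ i → i < b → ‖g i - g t‖ ≤ κ) ∨
      ‖g t - φ'‖ ≤ θ ∧ ∀ i, t ≤ i → i < t + L → ‖g i - g t‖ ≤ κ := by
    by_cases h : ((Finset.Ioo t (t + L)).filter big).Nonempty
    · left
      have hm := Finset.min'_mem _ h
      set b := ((Finset.Ioo t (t + L)).filter big).min' h with hb
      rw [Finset.mem_filter, Finset.mem_Ioo] at hm
      refine ⟨b, hm.1.1, hm.1.2, hm.2, fun i hti hib => ?_⟩
      refine hrun t i (by omega) hti (by omega) fun s hts hsi hs => ?_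
      have := ((Finset.Ioo t (t + L)).filter big).min'_le s
        (Finset.mem_filter.2 ⟨Finset.mem_Ioo.2 ⟨hts, by omega⟩, hs⟩)
      omega
    · right
      have h₁ : ∀ i, t ≤ i → i < t + L → ‖g i - g t‖ ≤ κ := by
        intro i hti hi
        refine hrun t i (by omega) hti (by omega) fun s hts hsi hs => h ⟨s, ?_⟩
        exact Finset.mem_filter.2 ⟨Finset.mem_Ioo.2 ⟨hts, by omega⟩, hs⟩
      refine ⟨hright fun i hi => ?_, h₁⟩
      rw [Finset.mem_Ico] at hi
      exact h₁ i hi.1 hi.2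
  -- With big jumps on both sides, the replacement takes the value `g t` in between. If one side has
  -- none, `g t` is already close to the true value of that side, and a single jump on the other
  -- side, coded as `a = b`, suffices. Big jumps cannot be missing on both sides, as `φ` and `φ'`
  -- are more than `2 * θ` apart.
  rcases hA with ⟨a, hta, hat, hba, hga⟩ | ⟨hφ, hgl⟩ <;>
    rcases hB with ⟨b, htb, hbt, hbb, hgb⟩ | ⟨hφ', hgr⟩
  · refine ⟨a, b, g t, Finset.mem_Icc.2 (by omega), Finset.mem_Icc.2 (by omega), hba, hbb, hN₁,
      by rwa [norm_sub_rev], fun i hi => ?_⟩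
    unfold bump
    by_cases h₁ : i < a
    · exact hzero i _ (by rw [if_neg (by omega), if_neg (by omega), if_neg (by omega), sub_zero])
    by_cases h₂ : b ≤ i
    · exact hzero i _ (by rw [if_pos h₂, if_pos (by omega), sub_self])
    rw [if_neg h₂, if_pos (by omega), if_pos (Finset.mem_Ico.2 (by omega))]
    by_cases h₃ : t ≤ i
    · rw [if_pos h₃, if_pos h₃, sub_sub_sub_cancel_right]
      refine ⟨hN₂, habs i hi (g i - φ') (g t - g i) _ _ (by abel) ?_⟩
      rw [norm_sub_rev]
      linarith [hgb i h₃ (by omega)]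
    · rw [if_neg h₃, if_neg h₃, sub_zero]
      refine ⟨hN₁, habs i hi (g i - φ) (g t - g i) _ _ (by abel) ?_⟩
      rw [norm_sub_rev]
      linarith [hga i (by omega) (by omega)]
  · refine ⟨a, a, φ, Finset.mem_Icc.2 (by omega), Finset.mem_Icc.2 (by omega), hba, hba,
      by simpa using hN0, hN₃, fun i hi => ?_⟩
    unfold bump
    by_cases h₁ : i < a
    · exact hzero i _ (by rw [if_neg (by omega), if_neg (by omega), if_neg (by omega), sub_zero])
    by_cases h₂ : t ≤ i
    · exact hzero i _ (by rw [if_pos (by omega), if_pos (by omega), sub_self])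
    rw [if_pos (by omega), if_neg h₂, if_pos (Finset.mem_Ico.2 (by omega)), if_neg h₂, sub_zero]
    refine ⟨hN₃, habs i hi (g i - φ) ((g t - g i) - (g t - φ')) _ _ (by abel) ?_⟩
    refine (norm_sub_le _ _).trans (add_le_add ?_ hφ')
    rw [norm_sub_rev]
    exact hga i (by omega) (by omega)
  · refine ⟨b, b, φ, Finset.mem_Icc.2 (by omega), Finset.mem_Icc.2 (by omega), hbb, hbb,
      by simpa using hN0, hN₃, fun i hi => ?_⟩
    unfold bump
    by_cases h₁ : b ≤ i
    · exact hzero i _ (by rw [if_pos (by omega), if_pos (by omega), sub_self])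
    by_cases h₂ : i < t
    · exact hzero i _ (by rw [if_neg (by omega), if_neg (by omega), if_neg (by omega), sub_zero])
    rw [if_neg h₁, if_neg h₁, if_pos (by omega), if_pos (Finset.mem_Ico.2 (by omega)),
      if_pos (by omega), zero_sub, norm_neg]
    refine ⟨hN₃, habs i hi (g i - φ') ((g t - g i) - (g t - φ)) _ _ (by abel) ?_⟩
    refine (norm_sub_le _ _).trans (add_le_add ?_ hφ)
    rw [norm_sub_rev]
    exact hgb i (by omega) (by omega)
  · exfalso
    have h₁ : φ' - φ = (g t - φ) - (g t - φ') := by abel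
    have h₂ := norm_sub_le (g t - φ) (g t - φ')
    rw [← h₁] at h₂
    linarith

lemma norm_le_mul_maxNorm (v : Vec p) : ‖v‖ ≤ p * maxNorm v := by
  have h0 : 0 ≤ maxNorm v := norm_nonneg _
  refine le_of_sq_le_sq ?_ (by positivity)
  rw [EuclideanSpace.real_norm_sq_eq]
  have h₁ : ∑ j, v j ^ 2 ≤ ∑ _j : Fin p, maxNorm v ^ 2 := Finset.sum_le_sum fun j _ => by
    rw [← sq_abs]
    exact pow_le_pow_left₀ (abs_nonneg _) (norm_le_pi_norm (fun j => v j : Fin p → ℝ) j) 2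
  refine h₁.trans ?_
  rw [Finset.sum_const, Finset.card_univ, Fintype.card_fin, nsmul_eq_mul, mul_pow]
  gcongr
  rw [sq]
  exact_mod_cast Nat.le_mul_self p

/-- Only change-points contribute to the telescoping sum, so the bound depends on their number and
not on the distance of `i` and `j`. -/
lemma norm_sub_le_card_mul {n i j : ℕ} {g : ℕ → Vec p} {C : ℝ} (hC : 0 ≤ C) (hi : 1 ≤ i)
    (hij : i ≤ j) (hj : j ≤ n) (h : ∀ s, i < s → s ≤ j → ‖g s - g (s - 1)‖ ≤ C) :
    ‖g j - g i‖ ≤ (changePoints n g).card * C := by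
  have h₁ : ‖g j - g i‖ ≤ ∑ s ∈ Finset.Icc (i + 1) j, ‖g s - g (s - 1)‖ := by
    clear h hj
    induction j, hij using Nat.le_induction with
    | base => simp
    | succ j hij ih =>
      rw [Finset.sum_Icc_succ_top (by omega)]
      have h₁ : g (j + 1) - g i = (g j - g i) + (g (j + 1) - g j) := by abel
      rw [h₁, Nat.add_sub_cancel]
      exact (norm_add_le _ _).trans (add_le_add_left ih _)
  refine h₁.trans ?_
  have h₂ : ∑ s ∈ Finset.Icc (i + 1) j, ‖g s - g (s - 1)‖ ≤
      ∑ s ∈ changePoints n g ∩ Finset.Icc (i + 1) j, ‖g s - g (s - 1)‖ := by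
    refine le_of_eq (Finset.sum_subset Finset.inter_subset_right fun s hs hn => ?_).symm
    rw [norm_eq_zero, sub_eq_zero]
    by_contra hne
    rw [Finset.mem_Icc] at hs
    refine hn (Finset.mem_inter.2 ⟨changePoints_mem.2 ⟨⟨by omega, by omega⟩, hne⟩, ?_⟩)
    exact Finset.mem_Icc.2 hs
  refine h₂.trans ((Finset.sum_le_card_nsmul _ _ C fun s hs => ?_).trans ?_)
  · rw [Finset.mem_inter, Finset.mem_Icc] at hs
    exact h s (by omega) hs.2.2
  · rw [nsmul_eq_mul]
    gcongr
    exact Finset.inter_subset_left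

end Bump

/-! ### Boundedness and consistency of the merged estimator. -/

namespace FirstStep

variable {p : ℕ} [NeZero p] {Ω : Type*} [MeasurableSpace Ω] {μ : Measure Ω}
  [IsProbabilityMeasure μ] {m : Model p} {ε : ℕ → Ω → ℝ} {f : ℝ → ℝ} {τ : ℝ} {δ lam : ℕ → ℝ}
  {bv : ℕ → Ω → ℕ → Vec p} {B : ℕ → Ω → Finset ℕ} {K₀ : ℕ}

/-- The merged estimator is bounded and close to the true coefficients in the empirical norm. -/
lemma exists_whp_merged (h : FirstStep μ m ε f τ δ lam bv B K₀) :
    ∃ N, 0 < N ∧ ∀ ζ > 0, Whp μ fun n ω => (B n ω).card ≤ K₀ ∧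
      (∀ i ∈ Finset.Icc 1 n, ∀ s ∈ Finset.Icc 1 n,
        ‖mergedCoef n (B n ω) (bv n ω) s - m.trueCoef n i‖ ≤ N) ∧
      ∑ i ∈ Finset.Icc 1 n, (inner ℝ (m.x n i)
        (mergedCoef n (B n ω) (bv n ω) i - m.trueCoef n i)) ^ 2 ≤ ζ * (n * δ n) := by
  have hm := h.model
  obtain ⟨N, hN, hdev⟩ := h.exists_whp_norm_sub_le
  refine ⟨N, hN, fun ζ hζ => ?_⟩
  refine ((hdev.and (h.whp_zone one_pos)).and
    (h.whp_sum_trunc_sq_le hN (show 0 < ζ / 3 by positivity))).mono ?_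
  filter_upwards [hm.eventually_lam_le (show 0 < ζ / 3 / ((K₀ + 1) * N ^ 2) by positivity),
    hm.eventually_const_le ((K₀ + 1) * N ^ 2) (show 0 < ζ / 3 by positivity)]
    with n hlam hconst ω ⟨⟨hdev, hcard, hzone⟩, hsum⟩
  have hdev' : ∀ i ∈ Finset.Icc 1 n, ∀ s ∈ Finset.Icc 1 n,
      ‖mergedCoef n (B n ω) (bv n ω) s - m.trueCoef n i‖ ≤ N := by
    intro i hi s hs
    have h₁ := lastBeforeNext_spec ((h.subset n ω).trans (Finset.filter_subset _ _))
      (Finset.mem_Icc.1 hs).2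
    exact hdev i hi _ (Finset.mem_Icc.2 ⟨(Finset.mem_Icc.1 hs).1.trans h₁.1, h₁.2.1⟩)
  refine ⟨hcard, hdev', ?_⟩
  have h₁ := sum_sub_le_card_mul (n := n) (clusterZone (B n ω) (1 * (n * lam n)))
    (fun i => (inner ℝ (m.x n i) (mergedCoef n (B n ω) (bv n ω) i - m.trueCoef n i) : ℝ) ^ 2)
    (fun i => (inner ℝ (m.x n i) (bv n ω i - m.trueCoef n i) : ℝ) ^ 2) (sq_nonneg N)
    (fun i hi hiZ => by
      rw [mergedCoef_eq_of_notMem_clusterZone (h.subset n ω) hzone hi hiZ])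
    (fun i hi => by
      have h₂ := (hm.abs_inner_le n hi (mergedCoef n (B n ω) (bv n ω) i - m.trueCoef n i)).trans
        (hdev' i hi i hi)
      have h₃ := pow_le_pow_left₀ (abs_nonneg _) h₂ 2
      rw [sq_abs] at h₃
      have h₄ := sq_nonneg (inner ℝ (m.x n i) (bv n ω i - m.trueCoef n i) : ℝ)
      linarith)
  -- The truncation radius is the bound `N` for the deviations, so the truncation does nothing.
  rw [Finset.sum_congr rfl fun i hi => by rw [trunc_of_le (hdev i hi i hi)]] at hsum
  have h₂ := h.card_zone_le (n := n) (ω := ω) zero_le_one hcard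
  rw [one_mul] at h₁ h₂
  have h₃ := mul_le_mul_of_nonneg_right h₂ (sq_nonneg N)
  have h₄ : (K₀ + 1) * N ^ 2 * (n * lam n) ≤ ζ / 3 * (n * δ n) := by
    calc (K₀ + 1) * N ^ 2 * (n * lam n)
        ≤ (K₀ + 1) * N ^ 2 * (ζ / 3 / ((K₀ + 1) * N ^ 2) * (n * δ n)) := by gcongr
      _ = ζ / 3 * (n * δ n) := by field_simp
  linarith

end FirstStep

/-! ### Windows around the true change-points. -/

section Window

variable {p : ℕ} [NeZero p] {m : Model p} {f : ℝ → ℝ} {τ : ℝ} {δ lam : ℕ → ℝ}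

/-- The phases are eventually much longer than windows of length `⌈n δ n⌉`. -/
lemma ModelAssumptions.eventually_window (hm : ModelAssumptions m f τ δ lam)
    (hsep : Tendsto (fun n : ℕ => ((n : ℝ) * δ n)⁻¹ * m.Imin n) atTop atTop) :
    ∀ᶠ n : ℕ in atTop, ((⌈n * δ n⌉₊ : ℕ) : ℝ) ≤ 2 * (n * δ n) ∧ 0 < ⌈n * δ n⌉₊ ∧
      ∀ k ∈ Finset.Icc 1 m.K, ⌈n * δ n⌉₊ < m.t n k ∧ m.t n k + ⌈n * δ n⌉₊ ≤ n ∧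
        (∀ i ∈ Finset.Ico (m.t n k - ⌈n * δ n⌉₊) (m.t n k), m.trueCoef n i = m.phi n k) ∧
        ∀ i ∈ Finset.Ico (m.t n k) (m.t n k + ⌈n * δ n⌉₊), m.trueCoef n i = m.phi n (k + 1) := by
  filter_upwards [hm.eventually_const_le 1 one_pos, hsep.eventually_ge_atTop 2, hm.increasing]
    with n h1 hI hinc
  rw [one_mul] at h1
  have hpos : 0 < n * δ n := by linarith
  have hL₀ : 0 < ⌈n * δ n⌉₊ := Nat.ceil_pos.2 hpos
  have hL₁ := Nat.ceil_lt_add_one hpos.le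
  rw [inv_mul_eq_div, le_div_iff₀ hpos] at hI
  set L := ⌈n * δ n⌉₊
  have hlen : ∀ k ≤ m.K, m.t n k + L ≤ m.t n (k + 1) := by
    intro k hk
    have h₁ : m.Imin n ≤ (m.t n (k + 1) : ℝ) - m.t n k :=
      Finset.inf'_le (fun k => (m.t n (k + 1) : ℝ) - (m.t n k : ℝ)) (Finset.mem_range.2 (by omega))
    have h₂ : (m.t n k : ℝ) + L ≤ m.t n (k + 1) := by linarith
    exact_mod_cast h₂
  refine ⟨by linarith, hL₀, fun k hk => ?_⟩
  rw [Finset.mem_Icc] at hk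
  have h₁ := hlen (k - 1) (by omega)
  have h₂ := hlen k hk.2
  rw [Nat.sub_add_cancel hk.1] at h₁
  have h₃ := Model.t_le_of_le hinc (Nat.zero_le (k - 1)) (by omega)
  have h₄ := Model.t_le_of_le hinc (show k + 1 ≤ m.K + 1 by omega) le_rfl
  rw [hm.start] at h₃
  rw [hm.finish] at h₄
  refine ⟨by omega, by omega, fun i hi => ?_, fun i hi => ?_⟩ <;> rw [Finset.mem_Ico] at hi
  · have h := Model.trueCoef_eq hinc (k := k - 1) (i := i) (by omega) (Or.inr (by omega))
      (Or.inr (by rw [Nat.sub_add_cancel hk.1]; omega))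
    rwa [Nat.sub_add_cancel hk.1] at h
  · exact Model.trueCoef_eq hinc hk.2 (Or.inr hi.1) (Or.inr (by omega))

end Window

/-- A vector that is close to a sequence with a small empirical norm is small. -/
lemma norm_sq_le_of_sum_sq_le {p : ℕ} {x u : ℕ → Vec p} {w : Vec p} {n a b L : ℕ} {m₀ κ S : ℝ}
    (hx : ∀ i ∈ Finset.Icc 1 n, ∀ u, |inner ℝ (x i) u| ≤ ‖u‖) (ha : 1 ≤ a) (hb : b ≤ n + 1)
    (hab : (b : ℝ) - a = L) (hL : 0 < L) (hm₀ : 0 < m₀)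
    (hgram : m₀ * ((b : ℝ) - a) * ‖w‖ ^ 2 ≤ ∑ i ∈ Finset.Ico a b, (inner ℝ (x i) w) ^ 2)
    (hu : ∑ i ∈ Finset.Ico a b, (inner ℝ (x i) (u i)) ^ 2 ≤ S * L)
    (hκ : ∀ i ∈ Finset.Ico a b, ‖u i - w‖ ≤ κ) :
    ‖w‖ ^ 2 ≤ (2 * S + 2 * κ ^ 2) / m₀ := by
  have hL' : (0 : ℝ) < L := Nat.cast_pos.2 hL
  have h₁ : ∑ i ∈ Finset.Ico a b, (inner ℝ (x i) w) ^ 2 ≤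
      ∑ i ∈ Finset.Ico a b, (2 * (inner ℝ (x i) (u i)) ^ 2 + 2 * κ ^ 2) := by
    refine Finset.sum_le_sum fun i hi => ?_
    have hi' := Finset.mem_Ico.1 hi
    have h₂ := (hx i (Finset.mem_Icc.2 (by omega)) (u i - w)).trans (hκ i hi)
    have h₃ := pow_le_pow_left₀ (abs_nonneg _) h₂ 2
    rw [sq_abs, inner_sub_right] at h₃
    nlinarith [sq_nonneg (2 * inner ℝ (x i) (u i) - inner ℝ (x i) w)]
  have hcard : ((b - a : ℕ) : ℝ) = L := by
    have h₂ : a ≤ b := by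
      have : (a : ℝ) ≤ b := by linarith
      exact_mod_cast this
    rw [Nat.cast_sub h₂, hab]
  rw [Finset.sum_add_distrib, ← Finset.mul_sum, Finset.sum_const, Nat.card_Ico, nsmul_eq_mul,
    hcard] at h₁
  rw [le_div_iff₀ hm₀]
  refine le_of_mul_le_mul_left ?_ hL'
  rw [hab] at hgram
  linarith

/-! ### A comparison sequence with controlled adaptive weights. -/

namespace FirstStep

variable {p : ℕ} [NeZero p] {Ω : Type*} [MeasurableSpace Ω] {μ : Measure Ω}
  [IsProbabilityMeasure μ] {m : Model p} {ε : ℕ → Ω → ℝ} {f : ℝ → ℝ} {τ : ℝ} {δ lam : ℕ → ℝ}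
  {bv : ℕ → Ω → ℕ → Vec p} {B : ℕ → Ω → Finset ℕ} {K₀ : ℕ}

/-- Near every change-point, the true coefficients can be replaced at a small cost by a sequence
that jumps only where the merged estimator has a jump bounded away from zero. -/
lemma exists_whp_bump (h : FirstStep μ m ε f τ δ lam bv B K₀)
    (hsep : Tendsto (fun n : ℕ => ((n : ℝ) * δ n)⁻¹ * m.Imin n) atTop atTop) :
    ∃ N, 0 < N ∧ ∀ ζ > 0, ∃ κ > 0, Whp μ fun n ω => ∀ k ∈ Finset.Icc 1 m.K, ∃ a b v,
      a ∈ Finset.Icc 2 n ∧ b ∈ Finset.Icc 2 n ∧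
      κ ≤ maxNorm (mergedCoef n (B n ω) (bv n ω) a - mergedCoef n (B n ω) (bv n ω) (a - 1)) ∧
      κ ≤ maxNorm (mergedCoef n (B n ω) (bv n ω) b - mergedCoef n (B n ω) (bv n ω) (b - 1)) ∧
      ‖v - m.phi n k‖ ≤ N ∧ ‖m.phi n (k + 1) - v‖ ≤ N ∧
      (∀ i ∈ Finset.Icc 1 n, ‖bump (m.t n k) a b (m.phi n k) (m.phi n (k + 1)) v i‖ ≤ N) ∧
      ∑ i ∈ Finset.Icc 1 n, |inner ℝ (m.x n i)
        (bump (m.t n k) a b (m.phi n k) (m.phi n (k + 1)) v i)| ≤ ζ * (n * δ n) := by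
  have hm := h.model
  obtain ⟨N, hN, hmerged⟩ := h.exists_whp_merged
  obtain ⟨m₀, hm₀, hgram⟩ := hm.exists_mul_norm_sq_le
  obtain ⟨ca, hca, hjump⟩ := hm.jump_lt
  obtain ⟨cb, hcb, hjump'⟩ := hm.jump_gt
  refine ⟨N + ca, by positivity, fun ζ hζ => ?_⟩
  -- `r` is the accuracy reached on a window without big jumps: `cb / 4` separates the two phases,
  -- and `ζ / 24` limits the cost of `3 * r` per observation to half of the allowance. The drift `r
  -- * s` within a window and the error `ζ₀` are small enough to reach this accuracy, and `ζ₀` also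
  -- pays for the other half.
  set r : ℝ := min (ζ / 24) (cb / 4) with hr
  have hr0 : 0 < r := lt_min (by positivity) (by positivity)
  have hrζ : r ≤ ζ / 24 := min_le_left _ _
  have hrc : r ≤ cb / 4 := min_le_right _ _
  set s : ℝ := min 1 m₀ / 4 with hs
  have hs0 : 0 < s := div_pos (lt_min one_pos hm₀) four_pos
  have hs1 : s ≤ 1 / 4 := div_le_div_of_nonneg_right (min_le_left _ _) zero_le_four
  have hsm : s ≤ m₀ / 4 := div_le_div_of_nonneg_right (min_le_right _ _) zero_le_four
  set ζ₀ : ℝ := min (r ^ 2 * m₀ / 8) (ζ * r / 2) with hζ₀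
  have hζ₀0 : 0 < ζ₀ := lt_min (by positivity) (by positivity)
  have hζm : ζ₀ ≤ r ^ 2 * m₀ / 8 := min_le_left _ _
  have hζr : ζ₀ ≤ ζ * r / 2 := min_le_right _ _
  have hθ : (2 * ζ₀ + 2 * (r * s) ^ 2) / m₀ ≤ r ^ 2 := by
    rw [div_le_iff₀ hm₀]
    have h₁ : s ^ 2 ≤ m₀ / 16 := by nlinarith
    nlinarith [mul_le_mul_of_nonneg_left h₁ (sq_nonneg r)]
  have hrs : r * s ≤ r := by nlinarith
  -- At most `K₀` jumps below this threshold in maximum norm add up to a drift of at most `r * s` in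
  -- Euclidean norm.
  refine ⟨r * s / (p * (K₀ + 1)), ?_, (hmerged ζ₀ hζ₀0).mono ?_⟩
  · have : (0 : ℝ) < p := Nat.cast_pos.2 (NeZero.pos p)
    positivity
  filter_upwards [hm.eventually_window hsep, hgram] with n ⟨hL₂, hL₀, hwin⟩ hgram
    ω ⟨hcard, hdev, hsum⟩ k hk
  obtain ⟨hLt, hLn, hwl, hwr⟩ := hwin k hk
  have hL₁ : n * δ n ≤ (⌈n * δ n⌉₊ : ℕ) := Nat.le_ceil _
  set L := ⌈n * δ n⌉₊
  set g := mergedCoef n (B n ω) (bv n ω) with hg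
  set t := m.t n k
  set φ := m.phi n k
  set φ' := m.phi n (k + 1)
  have hx : ∀ i ∈ Finset.Icc 1 n, ∀ u, |inner ℝ (m.x n i) u| ≤ ‖u‖ := fun i hi u =>
    hm.abs_inner_le n hi u
  have hpart : ∀ a b : ℕ, 1 ≤ a → b ≤ n + 1 →
      ∑ i ∈ Finset.Ico a b, (inner ℝ (m.x n i) (g i - m.trueCoef n i)) ^ 2 ≤ ζ₀ * (n * δ n) := by
    intro a b ha hb
    refine le_trans (Finset.sum_le_sum_of_subset_of_nonneg (fun i hi => ?_)
      fun _ _ _ => sq_nonneg _) hsum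
    rw [Finset.mem_Ico] at hi
    exact Finset.mem_Icc.2 (by omega)
  have hside : ∀ (a b : ℕ) (ψ : Vec p), 1 ≤ a → b ≤ n → b = a + L →
      (∀ i ∈ Finset.Ico a b, m.trueCoef n i = ψ) → (∀ i ∈ Finset.Ico a b, ‖g i - g t‖ ≤ r * s) →
      ‖g t - ψ‖ ≤ r := by
    intro a b ψ ha hb hab hψ hgt
    have hab' : (b : ℝ) - a = L := by rw [hab]; push_cast; ring
    refine le_of_sq_le_sq (le_trans (norm_sq_le_of_sum_sq_le (u := fun i => g i - ψ) (S := ζ₀)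
      (κ := r * s) hx ha (by omega) hab' hL₀ hm₀ (hgram a b ha hb (by rw [hab']; exact hL₁) _)
      ?_ fun i hi => ?_) hθ) hr0.le
    · rw [Finset.sum_congr rfl fun i hi => by rw [← hψ i hi]]
      exact (hpart a b ha (by omega)).trans (by gcongr)
    · rw [sub_sub_sub_cancel_right]
      exact hgt i hi
  have ht : t ∈ Finset.Icc 1 n := Finset.mem_Icc.2 (by omega)
  have hφt : ‖g t - φ'‖ ≤ N := by
    rw [← hwr t (Finset.mem_Ico.2 (by omega))]
    exact hdev t ht t ht
  have hφt' : ‖g t - φ‖ ≤ N := by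
    have h₁ : t - 1 ∈ Finset.Icc 1 n := Finset.mem_Icc.2 (by omega)
    rw [← hwl (t - 1) (Finset.mem_Ico.2 (by omega))]
    exact hdev (t - 1) h₁ t ht
  have hjk := hjump n k hk
  have hjk' := hjump' n k hk
  obtain ⟨a, b, v, ha, hb, hba, hbb, hv₁, hv₂, hbump⟩ := exists_bump (n := n) (t := t) (L := L)
    (x := m.x n) (g := g) (φ := φ) (φ' := φ') (κ := r * s) (θ := r) (N := N + ca)
    (fun i => r * s / (p * (K₀ + 1)) ≤ maxNorm (g i - g (i - 1))) hx hLt hLn hL₀ (by positivity)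
    hr0.le (fun i j hi hij hj hbig => by
      have hp : (0 : ℝ) < p := Nat.cast_pos.2 (NeZero.pos p)
      have h₁ := norm_sub_le_card_mul (n := n) (g := g) (C := r * s / (K₀ + 1)) (by positivity) hi
        hij hj fun q hq hqj => by
          have h₂ := hbig q hq hqj
          rw [not_le] at h₂
          refine (norm_le_mul_maxNorm _).trans ?_
          calc (p : ℝ) * maxNorm (g q - g (q - 1)) ≤ p * (r * s / (p * (K₀ + 1))) := by gcongr
            _ = r * s / (K₀ + 1) := by field_simp
      refine h₁.trans ?_
      have h₂ : ((changePoints n g).card : ℝ) ≤ K₀ + 1 := by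
        have h₃ := (Finset.card_le_card (changePoints_mergedCoef_subset n (B n ω) (bv n ω))).trans
          hcard
        have h₄ : ((changePoints n g).card : ℝ) ≤ K₀ := by exact_mod_cast h₃
        linarith
      calc ((changePoints n g).card : ℝ) * (r * s / (K₀ + 1)) ≤ (K₀ + 1) * (r * s / (K₀ + 1)) := by
            gcongr
        _ = r * s := by field_simp)
    (hside (t - L) t φ (by omega) (by omega) (by omega) hwl)
    (hside t (t + L) φ' (by omega) hLn rfl hwr) (by linarith) (by linarith) (by linarith)
    (by linarith)
  refine ⟨a, b, v, ha, hb, hba, hbb, hv₁, hv₂, fun i hi => (hbump i hi).1, ?_⟩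
  have hW : (Finset.Icc 1 n).filter (fun i => i ∈ Finset.Ico (t - L) (t + L)) =
      Finset.Ico (t - L) (t + L) := by
    ext i
    simp only [Finset.mem_filter, Finset.mem_Icc, Finset.mem_Ico]
    omega
  have hβ : ∀ i ∈ Finset.Ico (t - L) (t + L), (if t ≤ i then φ' else φ) = m.trueCoef n i := by
    intro i hi
    rw [Finset.mem_Ico] at hi
    split_ifs with hti
    · exact (hwr i (Finset.mem_Ico.2 ⟨hti, hi.2⟩)).symm
    · exact (hwl i (Finset.mem_Ico.2 ⟨hi.1, by omega⟩)).symm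
  calc ∑ i ∈ Finset.Icc 1 n, |inner ℝ (m.x n i) (bump t a b φ φ' v i)|
      ≤ ∑ i ∈ Finset.Icc 1 n, (if i ∈ Finset.Ico (t - L) (t + L) then
          |inner ℝ (m.x n i) (g i - if t ≤ i then φ' else φ)| + (r * s + r) else 0) :=
        Finset.sum_le_sum fun i hi => (hbump i hi).2
    _ = ∑ i ∈ Finset.Ico (t - L) (t + L),
          (|inner ℝ (m.x n i) (g i - if t ≤ i then φ' else φ)| + (r * s + r)) := by
        rw [← Finset.sum_filter, hW]
    _ ≤ ∑ i ∈ Finset.Ico (t - L) (t + L),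
          ((inner ℝ (m.x n i) (g i - m.trueCoef n i)) ^ 2 / r + 3 * r) := by
        refine Finset.sum_le_sum fun i hi => ?_
        rw [hβ i hi]
        set y : ℝ := inner ℝ (m.x n i) (g i - m.trueCoef n i)
        -- Squares control absolute values at the price of `r` per observation, which is affordable
        -- on a window of `2 * L` observations.
        have h₁ : |y| ≤ y ^ 2 / r + r := by
          rw [← sub_le_iff_le_add, le_div_iff₀ hr0, ← sq_abs]
          nlinarith [sq_nonneg (|y| - r), abs_nonneg y, mul_nonneg (abs_nonneg y) hr0.le]
        linarith
    _ = (∑ i ∈ Finset.Ico (t - L) (t + L), (inner ℝ (m.x n i) (g i - m.trueCoef n i)) ^ 2) / r +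
          (2 * L) * (3 * r) := by
        rw [Finset.sum_add_distrib, ← Finset.sum_div, Finset.sum_const, Nat.card_Ico, nsmul_eq_mul]
        congr 2
        have h₁ : t + L - (t - L) = 2 * L := by omega
        rw [h₁]
        push_cast
        ring
    _ ≤ ζ * r / 2 * (n * δ n) / r + (2 * (2 * (n * δ n))) * (3 * (ζ / 24)) := by
        have hpos : 0 ≤ n * δ n := mul_nonneg (Nat.cast_nonneg n) (hm.delta_pos n).le
        have h₁ := hpart (t - L) (t + L) (by omega) (by omega)
        gcongr
        exact h₁.trans (mul_le_mul_of_nonneg_right hζr hpos)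
    _ = ζ * (n * δ n) := by
        field_simp
        ring

end FirstStep

/-! ### Increments of the comparison sequence, and removal of the truncation. -/

section Approximation

variable {p : ℕ}

/-- Telescoping over the change-points already passed. In this form each true jump can be exchanged
separately for a `bump`. -/
lemma Model.trueCoef_eq_sum {m : Model p} {n : ℕ} (h : ∀ k ≤ m.K, m.t n k < m.t n (k + 1))
    (i : ℕ) :
    m.trueCoef n i = m.phi n 1 +
      ∑ k ∈ Finset.Icc 1 m.K, if m.t n k ≤ i then m.phi n (k + 1) - m.phi n k else 0 := by
  classical
  set q := Nat.findGreatest (fun k => k = 0 ∨ m.t n k ≤ i) m.K with hq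
  have hqK : q ≤ m.K := Nat.findGreatest_le _
  have hq₁ : q = 0 ∨ m.t n q ≤ i :=
    Nat.findGreatest_spec (P := fun k => k = 0 ∨ m.t n k ≤ i) (Nat.zero_le _) (Or.inl rfl)
  have hq₂ : ∀ k, q < k → k ≤ m.K → i < m.t n k := fun k hk hkK => by
    have := Nat.findGreatest_is_greatest hk hkK
    omega
  rw [Model.trueCoef_eq h hqK hq₁ ((eq_or_lt_of_le hqK).imp id fun hlt => hq₂ _ (by omega) hlt),
    ← Finset.sum_filter]
  have hS : (Finset.Icc 1 m.K).filter (fun k => m.t n k ≤ i) = Finset.Ico 1 (q + 1) := by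
    ext k
    simp only [Finset.mem_filter, Finset.mem_Icc, Finset.mem_Ico]
    constructor
    · rintro ⟨⟨h₁, h₂⟩, h₃⟩
      refine ⟨h₁, ?_⟩
      by_contra hk
      have := hq₂ k (by omega) h₂
      omega
    · rintro ⟨h₁, h₂⟩
      refine ⟨⟨h₁, by omega⟩, ?_⟩
      rcases hq₁ with h₃ | h₃
      · omega
      · exact (Model.t_le_of_le h (show k ≤ q by omega) (by omega)).trans h₃
  rw [hS, Finset.sum_Ico_sub (m.phi n) (by omega : 1 ≤ q + 1)]
  abel

/-- The increments of the sequence obtained by replacing the true jumps. -/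
lemma Model.norm_trueCoef_add_bump_sub_le {m : Model p} {n : ℕ}
    (h : ∀ k ≤ m.K, m.t n k < m.t n (k + 1)) {a b : ℕ → ℕ} {v : ℕ → Vec p} {N : ℝ}
    (hN₁ : ∀ k ∈ Finset.Icc 1 m.K, ‖v k - m.phi n k‖ ≤ N)
    (hN₂ : ∀ k ∈ Finset.Icc 1 m.K, ‖m.phi n (k + 1) - v k‖ ≤ N) {i : ℕ} (hi : 1 ≤ i) {b₀ : ℕ → Vec p}
    (hb₀ : ∀ i, b₀ i = m.trueCoef n i +
      ∑ k ∈ Finset.Icc 1 m.K, bump (m.t n k) (a k) (b k) (m.phi n k) (m.phi n (k + 1)) (v k) i) :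
    ‖b₀ i - b₀ (i - 1)‖ ≤
      ∑ k ∈ Finset.Icc 1 m.K, ((if i = a k then 2 * N else 0) + if i = b k then 2 * N else 0) := by
  -- The subtracted part of each `bump` cancels the true jump, so only the jumps at `a k` and `b k`
  -- survive.
  have h₁ : ∀ i, b₀ i = m.phi n 1 + ∑ k ∈ Finset.Icc 1 m.K,
      (if b k ≤ i then m.phi n (k + 1) - m.phi n k else if a k ≤ i then v k - m.phi n k else 0) := by
    intro i
    rw [hb₀, Model.trueCoef_eq_sum h, add_assoc, ← Finset.sum_add_distrib]
    congr 1
    refine Finset.sum_congr rfl fun k _ => ?_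
    rw [bump]
    abel
  rw [h₁, h₁, add_sub_add_left_eq_sub, ← Finset.sum_sub_distrib]
  refine (norm_sum_le _ _).trans (Finset.sum_le_sum fun k hk => ?_)
  have hN₁ := hN₁ k hk
  have hN₂ := hN₂ k hk
  have hN₀ : 0 ≤ N := (norm_nonneg _).trans hN₁
  have hN₃ : ‖m.phi n (k + 1) - m.phi n k‖ ≤ 2 * N := by
    have h₂ := norm_add_le (m.phi n (k + 1) - v k) (v k - m.phi n k)
    rw [sub_add_sub_cancel] at h₂
    linarith
  by_cases hb : i = b k
  · rw [if_pos hb, if_pos (by omega), if_neg (by omega)]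
    have h₃ : (0 : ℝ) ≤ if i = a k then 2 * N else 0 := by split_ifs <;> linarith
    refine le_trans ?_ (le_add_of_nonneg_left h₃)
    split_ifs
    · rw [sub_sub_sub_cancel_right]
      linarith
    · rwa [sub_zero]
  · rw [if_neg hb, add_zero]
    have hbi : b k ≤ i - 1 ↔ b k ≤ i := by omega
    simp only [hbi]
    by_cases hbk : b k ≤ i
    · rw [if_pos hbk, if_pos hbk, sub_self, norm_zero]
      split_ifs <;> linarith
    · rw [if_neg hbk, if_neg hbk]
      by_cases ha : i = a k
      · rw [if_pos ha, if_pos (by omega), if_neg (by omega), sub_zero]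
        linarith
      · have hai : a k ≤ i - 1 ↔ a k ≤ i := by omega
        simp only [hai]
        rw [sub_self, norm_zero, if_neg ha]

lemma adaptiveWeight_nonneg {d γ : ℝ} {b : ℕ → Vec p} (i : ℕ) : 0 ≤ adaptiveWeight d γ b i :=
  Real.rpow_nonneg (le_max_of_le_left (norm_nonneg _)) _

/-- The power is antitone, and clipping at `d` from below can only decrease the weight; the bound is
therefore free of `d`. -/
lemma adaptiveWeight_le {d γ κ : ℝ} {b : ℕ → Vec p} {i : ℕ} (hκ : 0 < κ) (hγ : 0 ≤ γ)
    (h : κ ≤ maxNorm (b i - b (i - 1))) : adaptiveWeight d γ b i ≤ κ ^ (-γ) :=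
  Real.rpow_le_rpow_of_nonpos hκ (le_max_of_le_left h) (neg_nonpos.2 hγ)

/-- If a truncated deviation from a sequence close to `ψ` has a small empirical norm in a window
where the estimator is constant, then the estimator is close to `ψ` there. -/
lemma norm_sub_le_of_sum_trunc_sq_le {x e : ℕ → Vec p} {y : Vec p} {n a b L : ℕ} {m₀ C R ζ r : ℝ}
    (hx : ∀ i ∈ Finset.Icc 1 n, ∀ u, |inner ℝ (x i) u| ≤ ‖u‖) (ha : 1 ≤ a) (hb : b ≤ n + 1)
    (hab : (b : ℝ) - a = L) (hL : 0 < L) (hm₀ : 0 < m₀) (hR : 0 < R)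
    (hgram : ∀ w, m₀ * ((b : ℝ) - a) * ‖w‖ ^ 2 ≤ ∑ i ∈ Finset.Ico a b, (inner ℝ (x i) w) ^ 2)
    (he : ∀ i ∈ Finset.Ico a b, ‖e i‖ ≤ C)
    (hu : ∑ i ∈ Finset.Ico a b, (inner ℝ (x i) (e i + trunc (R + C) (y - e i))) ^ 2 ≤ ζ * L)
    (hζR : (2 * ζ + 2 * (2 * C) ^ 2) / m₀ < R ^ 2) (hζr : 2 * ζ / m₀ ≤ r ^ 2) (hr : 0 ≤ r) :
    ‖y‖ ≤ r := by
  have hC : 0 ≤ C := by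
    have h₁ : (a : ℝ) < b := by
      have : (0 : ℝ) < L := Nat.cast_pos.2 hL
      linarith
    exact (norm_nonneg _).trans (he a (Finset.mem_Ico.2 ⟨le_rfl, by exact_mod_cast h₁⟩))
  have hRC : 0 < R + C := by linarith
  -- First pass: `e + trunc (R + C) (y - e)` is within `2 * C` of `trunc (R + C) y`, which gives the
  -- crude bound `‖y‖ < R`.
  have h₁ := norm_sq_le_of_sum_sq_le (κ := 2 * C) hx ha hb hab hL hm₀ (hgram (trunc (R + C) y)) hu
    fun i hi => by
      have h₂ := norm_trunc_sub_le hRC (y - e i) y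
      rw [sub_sub_cancel_left, norm_neg] at h₂
      rw [add_sub_assoc]
      refine (norm_add_le _ _).trans ?_
      linarith [he i hi]
  have hy : ‖y‖ < R :=
    norm_lt_of_norm_trunc_lt hRC (by linarith) (lt_of_pow_lt_pow_left₀ 2 hR.le (h₁.trans_lt hζR))
  -- Second pass: now `‖y - e‖ ≤ R + C`, so the truncation is inactive and `e` cancels exactly.
  refine le_of_sq_le_sq (le_trans (norm_sq_le_of_sum_sq_le (κ := 0) hx ha hb hab hL hm₀ (hgram y) hu
    fun i hi => ?_) (by simpa using hζr)) hr
  rw [trunc_of_le, add_sub_cancel, sub_self, norm_zero]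
  exact (norm_sub_le _ _).trans (add_le_add hy.le (he i hi))

end Approximation

/-! ### Localization of the change-points by the adaptive estimator. -/

namespace FirstStep

variable {p : ℕ} [NeZero p] {Ω : Type*} [MeasurableSpace Ω] {μ : Measure Ω}
  [IsProbabilityMeasure μ] {m : Model p} {ε : ℕ → Ω → ℝ} {f : ℝ → ℝ} {τ : ℝ} {δ lam : ℕ → ℝ}
  {bv : ℕ → Ω → ℕ → Vec p} {B : ℕ → Ω → Finset ℕ} {K₀ : ℕ}

/-- If the adaptive estimator has few change-points, then its truncated deviations from a bounded
perturbation of the true coefficients are small in the empirical norm. -/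
lemma exists_whp_adaptive (h : FirstStep μ m ε f τ δ lam bv B K₀)
    (hsep : Tendsto (fun n : ℕ => ((n : ℝ) * δ n)⁻¹ * m.Imin n) atTop atTop)
    (d : ℕ → ℝ) {γ : ℝ} (hγ : 0 ≤ γ) {bh : ℕ → Ω → ℕ → Vec p}
    (hbh : ∀ n, ∀ᵐ ω ∂μ, IsEstimator τ n (m.x n) (m.response ε n ω)
      (fun i => n * lam n * adaptiveWeight (d n) γ (mergedCoef n (B n ω) (bv n ω)) i) (bh n ω))
    (Kmax : ℕ) :
    ∃ C, 0 < C ∧ ∀ R > 0, ∀ ζ > 0, Whp μ fun n ω => (changePoints n (bh n ω)).card ≤ Kmax →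
      ∃ e : ℕ → Vec p, (∀ i ∈ Finset.Icc 1 n, ‖e i‖ ≤ C) ∧
        ∑ i ∈ Finset.Icc 1 n, (inner ℝ (m.x n i)
          (e i + trunc (R + C) (bh n ω i - m.trueCoef n i - e i))) ^ 2 ≤ ζ * (n * δ n) := by
  have hm := h.model
  have := h.errors.isProbabilityMeasure
  have hτ₀ := h.tau_pos.le
  have hτ₁ := h.tau_lt.le
  obtain ⟨N, hN, hbump⟩ := h.exists_whp_bump hsep
  refine ⟨(m.K + 1) * N, by positivity, fun R hR ζ hζ => ?_⟩
  set C := (m.K + 1) * N with hC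
  have hC0 : 0 < C := by positivity
  obtain ⟨η, c₀, hν⟩ := h.errors.exists_quantileLaw h.tau_pos h.tau_lt
  have hRC : 0 < R + C := by positivity
  have hRCC : 0 < R + C + C := by positivity
  obtain ⟨s, hs, c, hc, hmgf⟩ := hν.exists_integral_exp_le_exp hRCC
  set c' := c / s with hc'
  have hc'0 : 0 < c' := div_pos hc hs
  -- The extra loss of the comparison sequence, its penalty and the `log n` term each receive a
  -- third of the allowance. As `κ` does not depend on `n`, the penalty is `O(n λ_n)`.
  obtain ⟨κ, hκ, hbump⟩ := hbump (c' * ζ / 3 / (m.K + 1)) (by positivity)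
  set C₁ : ℝ := 2 * ((m.K + 1) * (4 * N * κ ^ (-γ))) with hC₁
  set C₂ : ℝ := (Kmax + 3 * m.K + 1) * ((p + 5) / s) with hC₂
  have hκγ : 0 < κ ^ (-γ) := Real.rpow_pos_of_pos hκ _
  have hC₁0 : 0 < C₁ := by positivity
  have hC₂0 : 0 < C₂ := by positivity
  refine (((h.errors.whp_uniformLower hτ₀ hτ₁ hs hc.le hRCC.le hmgf m.x
    fun n i hi => hm.norm_x_le n hi).and hbump).and (whp_of_ae hbh)).mono ?_
  filter_upwards [hm.increasing, hm.eventually_log_le (show 0 < ζ * c' / 3 / C₂ by positivity),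
    hm.eventually_lam_le (show 0 < ζ * c' / 3 / C₁ by positivity)]
    with n hinc hlog hlam ω ⟨⟨hG, hbump⟩, hest⟩ hcard
  choose! a b v ha hb hwa hwb hv₁ hv₂ hbd hsum using hbump
  set w : ℕ → ℝ := fun i => n * lam n * adaptiveWeight (d n) γ (mergedCoef n (B n ω) (bv n ω)) i
    with hw
  set e : ℕ → Vec p := fun i => ∑ k ∈ Finset.Icc 1 m.K,
    bump (m.t n k) (a k) (b k) (m.phi n k) (m.phi n (k + 1)) (v k) i with he
  set b₀ : ℕ → Vec p := fun i => m.trueCoef n i + e i with hb₀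
  set u : ℕ → Vec p := fun i => e i + trunc (R + C) (bh n ω i - m.trueCoef n i - e i) with hu
  have hlam0 := h.lam_nonneg n
  have hlog0 : 0 ≤ Real.log n := Real.log_natCast_nonneg n
  have hnδ : 0 ≤ n * δ n := mul_nonneg (Nat.cast_nonneg n) (hm.delta_pos n).le
  have hK : ((Finset.Icc 1 m.K).card : ℝ) = m.K := by simp
  have heC : ∀ i ∈ Finset.Icc 1 n, ‖e i‖ ≤ C := by
    intro i hi
    refine (norm_sum_le _ _).trans ((Finset.sum_le_card_nsmul _ _ N fun k hk =>
      hbd k hk i hi).trans ?_)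
    rw [nsmul_eq_mul, hK, hC]
    linarith
  have hw0 : ∀ i, 0 ≤ w i := fun i => mul_nonneg hlam0 (adaptiveWeight_nonneg i)
  have hstep := fun i hi => Model.norm_trueCoef_add_bump_sub_le (b₀ := b₀) hinc hv₁ hv₂
    (show 1 ≤ i from hi) fun _ => rfl
  -- the penalty of the perturbed sequence
  have hpen : ∑ i ∈ Finset.Icc 2 n, w i * ‖b₀ i - b₀ (i - 1)‖ ≤
      m.K * (n * lam n * (4 * N * κ ^ (-γ))) := by
    calc ∑ i ∈ Finset.Icc 2 n, w i * ‖b₀ i - b₀ (i - 1)‖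
        ≤ ∑ i ∈ Finset.Icc 2 n, ∑ k ∈ Finset.Icc 1 m.K,
            ((if i = a k then w i * (2 * N) else 0) + if i = b k then w i * (2 * N) else 0) := by
          refine Finset.sum_le_sum fun i hi => ?_
          rw [Finset.mem_Icc] at hi
          refine (mul_le_mul_of_nonneg_left (hstep i (by omega)) (hw0 i)).trans (le_of_eq ?_)
          rw [Finset.mul_sum]
          refine Finset.sum_congr rfl fun k _ => ?_
          rw [mul_add, mul_ite, mul_ite, mul_zero]
      _ = ∑ k ∈ Finset.Icc 1 m.K, (w (a k) * (2 * N) + w (b k) * (2 * N)) := by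
          rw [Finset.sum_comm]
          refine Finset.sum_congr rfl fun k hk => ?_
          rw [Finset.sum_add_distrib, Finset.sum_ite_eq', Finset.sum_ite_eq', if_pos (ha k hk),
            if_pos (hb k hk)]
      _ ≤ ∑ _k ∈ Finset.Icc 1 m.K, n * lam n * (4 * N * κ ^ (-γ)) := by
          refine Finset.sum_le_sum fun k hk => ?_
          have h₁ := mul_le_mul_of_nonneg_left (adaptiveWeight_le (d := d n) hκ hγ (hwa k hk)) hlam0
          have h₂ := mul_le_mul_of_nonneg_left (adaptiveWeight_le (d := d n) hκ hγ (hwb k hk)) hlam0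
          have h₃ := mul_le_mul_of_nonneg_right (add_le_add h₁ h₂) (by positivity : 0 ≤ 2 * N)
          simp only [hw]
          linarith
      _ = m.K * (n * lam n * (4 * N * κ ^ (-γ))) := by
          rw [Finset.sum_const, nsmul_eq_mul, hK]
  -- the basic inequality
  have h₁ : ∑ i ∈ Finset.Icc 1 n, (check τ (ε i ω - inner ℝ (m.x n i) (u i)) - check τ (ε i ω)) ≤
      2 * (m.K * (n * lam n * (4 * N * κ ^ (-γ)))) + c' * ζ / 3 * (n * δ n) := by
    have h₂ := hest.sum_trunc_le (fun i _ => hw0 i) b₀ hRC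
    have h₃ : ∀ i, m.response ε n ω i - inner ℝ (m.x n i) (b₀ i) =
        ε i ω - inner ℝ (m.x n i) (e i) := fun i => m.response_sub ε n ω i (e i)
    have h₄ : ∀ i, m.response ε n ω i - inner ℝ (m.x n i)
        (b₀ i + trunc (R + C) (bh n ω i - b₀ i)) = ε i ω - inner ℝ (m.x n i) (u i) := fun i => by
      simp only [hb₀]
      rw [add_assoc, m.response_sub, ← sub_sub]
    simp only [h₃, h₄] at h₂
    have h₅ : ∑ i ∈ Finset.Icc 1 n,
        (check τ (ε i ω - inner ℝ (m.x n i) (e i)) - check τ (ε i ω)) ≤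
        c' * ζ / 3 * (n * δ n) := by
      calc ∑ i ∈ Finset.Icc 1 n, (check τ (ε i ω - inner ℝ (m.x n i) (e i)) - check τ (ε i ω))
          ≤ ∑ i ∈ Finset.Icc 1 n, ∑ k ∈ Finset.Icc 1 m.K, |inner ℝ (m.x n i)
              (bump (m.t n k) (a k) (b k) (m.phi n k) (m.phi n (k + 1)) (v k) i)| := by
            refine Finset.sum_le_sum fun i _ => ?_
            refine ((le_abs_self _).trans (abs_check_sub_check_le hτ₀ hτ₁ _ _)).trans ?_
            simp only [he]
            rw [inner_sum]
            exact Finset.abs_sum_le_sum_abs _ _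
        _ ≤ ∑ _k ∈ Finset.Icc 1 m.K, c' * ζ / 3 / (m.K + 1) * (n * δ n) := by
            rw [Finset.sum_comm]
            exact Finset.sum_le_sum fun k hk => hsum k hk
        _ = m.K * (c' * ζ / 3 / (m.K + 1) * (n * δ n)) := by
            rw [Finset.sum_const, nsmul_eq_mul, hK]
        _ ≤ (m.K + 1) * (c' * ζ / 3 / (m.K + 1) * (n * δ n)) := by
            gcongr
            linarith
        _ = c' * ζ / 3 * (n * δ n) := by field_simp
    have h₆ := h₂.trans (mul_le_mul_of_nonneg_left hpen zero_le_two)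
    rw [Finset.sum_sub_distrib] at h₅ h₆ ⊢
    linarith
  -- the number of change-points
  have hcp : (changePoints n u).card ≤ Kmax + 3 * m.K := by
    have h₂ : (changePoints n b₀).card ≤ 2 * m.K := by
      have h₃ : changePoints n b₀ ⊆
          (Finset.Icc 1 m.K).image a ∪ (Finset.Icc 1 m.K).image b := by
        intro i hi
        rw [changePoints_mem] at hi
        by_contra hne
        simp only [Finset.mem_union, Finset.mem_image, not_or, not_exists, not_and] at hne
        refine hi.2 (sub_eq_zero.1 (norm_le_zero_iff.1 ((hstep i (by omega)).trans (le_of_eq ?_))))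
        refine Finset.sum_eq_zero fun k hk => ?_
        rw [if_neg fun he => hne.1 k hk he.symm, if_neg fun he => hne.2 k hk he.symm, add_zero]
      refine (Finset.card_le_card h₃).trans ((Finset.card_union_le _ _).trans ?_)
      have h₄ := Finset.card_image_le (s := Finset.Icc 1 m.K) (f := a)
      have h₅ := Finset.card_image_le (s := Finset.Icc 1 m.K) (f := b)
      rw [Nat.card_Icc] at h₄ h₅
      omega
    have h₃ : u = fun i => (fun y z => y - z) (b₀ i + trunc (R + C) (bh n ω i - b₀ i))
        (m.trueCoef n i) := by
      funext i
      simp only [hu, hb₀]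
      rw [← sub_sub]
      abel
    have h₄ := card_changePoints_map₂_le (n := n) (fun y z : Vec p => y - z)
      (fun i => b₀ i + trunc (R + C) (bh n ω i - b₀ i)) (m.trueCoef n)
    have h₅ := card_changePoints_map₂_le (n := n)
      (fun y z : Vec p => z + trunc (R + C) (y - z)) (bh n ω) b₀
    have h₆ := card_changePoints_trueCoef_le m n
    rw [← h₃] at h₄
    omega
  -- the lower bound
  have h₂ : -((Kmax + 3 * m.K + 1) * ((p + 5) / s * Real.log n)) ≤
      ∑ i ∈ Finset.Icc 1 n, ((check τ (ε i ω - inner ℝ (m.x n i) (u i)) - check τ (ε i ω)) -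
        c' * (inner ℝ (m.x n i) (u i)) ^ 2) := by
    have hA : 0 ≤ (p + 5) / s * Real.log n := by positivity
    have h₃ := neg_card_mul_le_sum hA (fun i y =>
      (check τ (ε i ω - inner ℝ (m.x n i) y) - check τ (ε i ω)) - c' * (inner ℝ (m.x n i) y) ^ 2)
      u n (fun a b y ha hab hb hy => by
        obtain ⟨i, hi, rfl⟩ := hy
        have := hG a b ha hb (u i) ((norm_add_le _ _).trans (by
          linarith [heC i (Finset.mem_Icc.2 hi),
            norm_trunc_le hRC (bh n ω i - m.trueCoef n i - e i)]))
        rw [Finset.sum_sub_distrib, ← Finset.mul_sum]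
        linarith)
    refine le_trans (neg_le_neg ?_) h₃
    gcongr
    exact_mod_cast hcp
  refine ⟨e, heC, ?_⟩
  rw [Finset.sum_sub_distrib, ← Finset.mul_sum] at h₂
  have h₇ : C₂ * Real.log n ≤ ζ * c' / 3 * (n * δ n) := by
    calc C₂ * Real.log n ≤ C₂ * (ζ * c' / 3 / C₂ * (n * δ n)) := by gcongr
      _ = _ := by field_simp
  have h₈ : C₁ * (n * lam n) ≤ ζ * c' / 3 * (n * δ n) := by
    calc C₁ * (n * lam n) ≤ C₁ * (ζ * c' / 3 / C₁ * (n * δ n)) := by gcongr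
      _ = _ := by field_simp
  have h₉ : 2 * (m.K * (n * lam n * (4 * N * κ ^ (-γ)))) ≤ C₁ * (n * lam n) := by
    rw [hC₁]
    have : 0 ≤ n * lam n * (4 * N * κ ^ (-γ)) := by positivity
    linarith
  have h₁₀ : C₂ * Real.log n = (Kmax + 3 * m.K + 1) * ((p + 5) / s * Real.log n) := by
    rw [hC₂]; ring
  refine le_of_mul_le_mul_left ?_ hc'0
  linarith

/-- Every true change-point is close to a change-point of the adaptive estimator. -/
lemma whp_exists_near (h : FirstStep μ m ε f τ δ lam bv B K₀)
    (hsep : Tendsto (fun n : ℕ => ((n : ℝ) * δ n)⁻¹ * m.Imin n) atTop atTop)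
    (d : ℕ → ℝ) {γ : ℝ} (hγ : 0 ≤ γ) {bh : ℕ → Ω → ℕ → Vec p}
    (hbh : ∀ n, ∀ᵐ ω ∂μ, IsEstimator τ n (m.x n) (m.response ε n ω)
      (fun i => n * lam n * adaptiveWeight (d n) γ (mergedCoef n (B n ω) (bv n ω)) i) (bh n ω))
    (Kmax : ℕ) :
    Whp μ fun n ω => (changePoints n (bh n ω)).card ≤ Kmax → ∀ k ∈ Finset.Icc 1 m.K,
      ∃ a ∈ changePoints n (bh n ω), |(a : ℝ) - m.t n k| ≤ n * δ n := by
  have hm := h.model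
  obtain ⟨C, hC, hadapt⟩ := h.exists_whp_adaptive hsep d hγ hbh Kmax
  obtain ⟨m₀, hm₀, hgram⟩ := hm.exists_mul_norm_sq_le
  obtain ⟨cb, hcb, hjump⟩ := hm.jump_gt
  set ζ : ℝ := min 1 ((cb / 2) ^ 2 * m₀ / 2) with hζ
  have hζ0 : 0 < ζ := lt_min one_pos (by positivity)
  have hζ₁ : ζ ≤ 1 := min_le_left _ _
  have hζ₂ : ζ ≤ (cb / 2) ^ 2 * m₀ / 2 := min_le_right _ _
  -- The added `1` makes `R ^ 2` exceed the crude bound for every `ζ ≤ 1`.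
  set R : ℝ := (2 * 1 + 2 * (2 * C) ^ 2) / m₀ + 1 with hR
  have hR₁ : 0 < (2 * 1 + 2 * (2 * C) ^ 2) / m₀ := by positivity
  have hζR : (2 * ζ + 2 * (2 * C) ^ 2) / m₀ < R ^ 2 := by
    have h₁ : (2 * ζ + 2 * (2 * C) ^ 2) / m₀ ≤ (2 * 1 + 2 * (2 * C) ^ 2) / m₀ := by gcongr
    nlinarith
  have hζr : 2 * ζ / m₀ ≤ (cb / 2) ^ 2 := by
    rw [div_le_iff₀ hm₀]
    linarith
  refine (hadapt R (by positivity) ζ hζ0).mono ?_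
  filter_upwards [hm.eventually_window hsep, hgram] with n ⟨_, hL₀, hwin⟩ hgram ω hω hcard k hk
  obtain ⟨hLt, hLn, hwl, hwr⟩ := hwin k hk
  obtain ⟨e, he, hsum⟩ := hω hcard
  have hL₁ : n * δ n ≤ (⌈n * δ n⌉₊ : ℕ) := Nat.le_ceil _
  -- Integers at distance less than `⌈n δ_n⌉` are at distance at most `⌈n δ_n⌉ - 1 < n δ_n`, so
  -- rounding up the window loses nothing.
  have hfar : ∀ a : ℕ, m.t n k - ⌈n * δ n⌉₊ < a → a < m.t n k + ⌈n * δ n⌉₊ →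
      |(a : ℝ) - m.t n k| ≤ n * δ n := by
    intro a h₁ h₂
    have hnδ : 0 ≤ n * δ n := mul_nonneg (Nat.cast_nonneg n) (hm.delta_pos n).le
    have h₃ := Nat.ceil_lt_add_one hnδ
    have h₄ : (m.t n k : ℝ) + 1 ≤ a + (⌈n * δ n⌉₊ : ℕ) := by exact_mod_cast (by omega)
    have h₅ : (a : ℝ) + 1 ≤ m.t n k + (⌈n * δ n⌉₊ : ℕ) := by exact_mod_cast (by omega)
    rw [abs_le]
    constructor <;> linarith
  set L := ⌈n * δ n⌉₊
  set t := m.t n k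
  by_contra hno
  push Not at hno
  have hconst : ∀ i ∈ Finset.Ico (t - L) (t + L), bh n ω i = bh n ω (t - L) := by
    intro i hi
    rw [Finset.mem_Ico] at hi
    refine eq_of_forall_notMem_changePoints (n := n) (by omega) hi.1 (by omega)
      fun q hq hqi hmem => ?_
    exact absurd (hfar q hq (by omega)) (not_le.2 (hno q hmem))
  have hside : ∀ (a b : ℕ) (ψ : Vec p), t - L ≤ a → b ≤ t + L → b = a + L →
      (∀ i ∈ Finset.Ico a b, m.trueCoef n i = ψ) → ‖bh n ω (t - L) - ψ‖ ≤ cb / 2 := by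
    intro a b ψ ha hb hab hψ
    have hab' : (b : ℝ) - a = L := by rw [hab]; push_cast; ring
    have hsub : Finset.Ico a b ⊆ Finset.Icc 1 n := fun i hi => by
      rw [Finset.mem_Ico] at hi
      exact Finset.mem_Icc.2 (by omega)
    refine norm_sub_le_of_sum_trunc_sq_le (fun i hi u => hm.abs_inner_le n hi u)
      (show 1 ≤ a by omega) (show b ≤ n + 1 by omega) hab' hL₀ hm₀ (by positivity)
      (hgram a b (by omega) (by omega) (by rw [hab']; exact hL₁)) (fun i hi => he i (hsub hi)) ?_
      hζR hζr (by positivity)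
    have h₁ := (Finset.sum_le_sum_of_subset_of_nonneg hsub fun _ _ _ => sq_nonneg _).trans hsum
    rw [Finset.sum_congr rfl fun i hi => by
      rw [hψ i hi, hconst i (by rw [Finset.mem_Ico] at hi ⊢; omega)]] at h₁
    exact h₁.trans (by gcongr)
  -- One constant would be within `cb / 2` of both phase values, which are more than `cb` apart.
  have h₁ := hside (t - L) t _ le_rfl (by omega) (by omega) hwl
  have h₂ := hside t (t + L) _ (by omega) le_rfl rfl hwr
  have h₃ := hjump n k hk
  have h₄ := norm_sub_le (bh n ω (t - L) - m.phi n k) (bh n ω (t - L) - m.phi n (k + 1))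
  rw [sub_sub_sub_cancel_left] at h₄
  linarith

end FirstStep

/-! ### Measurability of the numbers of change-points, and the conclusion. -/

lemma measurable_card {Ω : Type*} [MeasurableSpace Ω] {S : Ω → Finset ℕ} (T : Finset ℕ)
    (hT : ∀ ω, S ω ⊆ T) (hS : ∀ i, MeasurableSet {ω | i ∈ S ω}) :
    Measurable fun ω => (S ω).card := by
  classical
  have h : (fun ω => (S ω).card) = fun ω => ∑ i ∈ T, if i ∈ S ω then 1 else 0 := by
    funext ω
    rw [Finset.sum_boole, Finset.filter_mem_eq_inter, Finset.inter_eq_right.2 (hT ω), Nat.cast_id]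
  rw [h]
  exact Finset.measurable_sum _ fun i _ =>
    Measurable.ite (hS i) measurable_const measurable_const

lemma measurable_card_changePoints {p : ℕ} {Ω : Type*} [MeasurableSpace Ω] {n : ℕ}
    {b : Ω → ℕ → Vec p} (hb : ∀ i, Measurable fun ω => b ω i) :
    Measurable fun ω => (changePoints n (b ω)).card := by
  refine measurable_card (Finset.Icc 2 n) (fun ω => Finset.filter_subset _ _) fun i => ?_
  by_cases hi : i ∈ Finset.Icc 2 n
  · have h : {ω | i ∈ changePoints n (b ω)} = {ω | b ω i = b ω (i - 1)}ᶜ := by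
      ext ω
      simp [changePoints, Finset.mem_Icc.1 hi]
    rw [h]
    exact (measurableSet_eq_fun (hb i) (hb (i - 1))).compl
  · have h : {ω | i ∈ changePoints n (b ω)} = ∅ := by
      ext ω
      simp only [changePoints, Finset.mem_filter, hi, false_and]
      simp
    rw [h]
    exact MeasurableSet.empty

lemma excess_le {A B : Finset ℕ} {r : ℝ} (h : ∀ b ∈ B, ∃ a ∈ A, |(a : ℝ) - b| ≤ r) :
    excess A B ≤ ENNReal.ofReal r := by
  refine iSup₂_le fun b hb => ?_
  obtain ⟨a, ha, hab⟩ := h b hb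
  refine (iInf₂_le a ha).trans ?_
  rw [edist_dist, Real.dist_eq]
  exact ENNReal.ofReal_le_ofReal hab

end FusedQuantile

theorem mainTheorem3 {p : ℕ} [NeZero p] {Ω : Type*} [MeasurableSpace Ω]
    (μ : Measure Ω) [IsProbabilityMeasure μ]
    (m : Model p) (ε : ℕ → Ω → ℝ) (f : ℝ → ℝ) (τ : ℝ) (hτ₀ : 0 < τ) (hτ₁ : τ < 1)
    (δ lam d : ℕ → ℝ) (γ : ℝ) (hγ : 0 < γ)
    (hε : ErrorAssumptions μ ε f τ) (hm : ModelAssumptions m f τ δ lam)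
    -- the minimal phase length dominates `n δ_n`
    (hsep : Tendsto (fun n : ℕ => ((n : ℝ) * δ n)⁻¹ * m.Imin n) atTop atTop)
    -- the quantile fused estimator, and its merged change-points
    (bv : ℕ → Ω → ℕ → Vec p) (hbv_meas : ∀ n i, Measurable (fun ω => bv n ω i))
    (hbv : ∀ n, ∀ᵐ ω ∂μ,
      IsEstimator τ n (m.x n) (m.response ε n ω) (fun _ => n * lam n) (bv n ω))
    (B : ℕ → Ω → Finset ℕ) (hB_meas : ∀ n i, MeasurableSet {ω | i ∈ B n ω})
    (hB : IsMerging μ (fun n => n * lam n) (fun n ω => changePoints n (bv n ω)) B)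
    (K₀ : ℕ)
    (hB_card : Tendsto (fun n => μ {ω | m.K ≤ (B n ω).card ∧ (B n ω).card ≤ K₀}) atTop (𝓝 1))
    -- the conditions on the sequence `d`
    (hd_pos : ∀ n, 0 < d n) (hd : Tendsto d atTop (𝓝 0))
    (hrate : Tendsto (fun n => lam n / (δ n * (max (d n) (m.rate lam n)) ^ γ)) atTop (𝓝 0))
    -- the adaptive fused quantile estimator
    (bh : ℕ → Ω → ℕ → Vec p) (hbh_meas : ∀ n i, Measurable (fun ω => bh n ω i))
    (hbh : ∀ n, ∀ᵐ ω ∂μ,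
      IsEstimator τ n (m.x n) (m.response ε n ω)
        (fun i => n * lam n * adaptiveWeight (d n) γ (mergedCoef n (B n ω) (bv n ω)) i) (bh n ω))
    (Kmax : ℕ) :
    Tendsto (fun n : ℕ => μ {ω |
        (m.K ≤ (changePoints n (bh n ω)).card ∧ (changePoints n (bh n ω)).card ≤ Kmax) →
          excess (changePoints n (bh n ω)) (m.trueLocations n) ≤ ENNReal.ofReal (n * δ n)})
        atTop (𝓝 1) ∧
      (Tendsto (fun n : ℕ => μ {ω |
          m.K ≤ (changePoints n (bh n ω)).card ∧ (changePoints n (bh n ω)).card ≤ Kmax})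
          atTop (𝓝 1) →
        Tendsto (fun n : ℕ => μ {ω |
          excess (changePoints n (bh n ω)) (m.trueLocations n) ≤ ENNReal.ofReal (n * δ n)})
          atTop (𝓝 1)) := by 
  have hBS : ∀ n ω, B n ω ⊆ Finset.Icc 2 n := fun n ω =>
    (hB.subset n ω).trans (Finset.filter_subset _ _)
  have hfirst : FirstStep μ m ε f τ δ lam bv B K₀ := by
    refine ⟨hτ₀, hτ₁, hε, hm, hbv, hB, ?_⟩
    refine (whp_of_tendsto_one (fun n => ?_) hB_card).mono
      (Eventually.of_forall fun n ω hω => hω.2)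
    exact measurable_card (Finset.Icc 2 n) (hBS n) (hB_meas n) (measurableSet_Icc (a := m.K))
  have hnear : Whp μ fun n ω =>
      (m.K ≤ (changePoints n (bh n ω)).card ∧ (changePoints n (bh n ω)).card ≤ Kmax) →
        excess (changePoints n (bh n ω)) (m.trueLocations n) ≤ ENNReal.ofReal (n * δ n) := by
    refine (hfirst.whp_exists_near hsep d hγ.le hbh Kmax).mono
      (Eventually.of_forall fun n ω hω hcard => excess_le fun b hb => ?_)
    obtain ⟨k, hk, rfl⟩ := Finset.mem_image.1 hb
    exact hω hcard.2 k hk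
  refine ⟨hnear.tendsto_one, fun hcard => ?_⟩
  refine ((whp_of_tendsto_one (fun n => ?_) hcard).and hnear).mono
    (Eventually.of_forall fun n ω hω => hω.2 hω.1) |>.tendsto_one
  exact measurable_card_changePoints (hbh_meas n) (measurableSet_Icc (a := m.K))
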